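/- **Setting.** Let $\mathbb H^2=\mathbb R^5$ with coordinates $(x_1,x_2,y_1,y_2,t)$, left-invariant fields $X_j=\partial_{x_j}+y_j\partial_t$, $Y_j=\partial_{y_j}-x_j\partial_t$, $T=\partial_t$, the Riemannian metric $\langle\cdot,\cdot\rangle$ making $X_1,X_2,Y_1,Y_2,T$ orthonormal, the horizontal distribution $\mathcal H=\mathrm{span}\{X_j,Y_j\}$, the complex structure $J(X_j)=Y_j$, $J(Y_j)=-X_j$, $J(T)=0$, and the pseudohermitian connection $\nabla$, for which $X_j,Y_j,T$ are parallel. Let $S\subseteq\mathbb H^2$ be a smooth embedded hypersurface without boundary (not necessarily closed), two-sided and non-characteristic ($T_pS\ne\mathcal H_p$ for all $p\in S$), with Riemannian unit normal $N$, and put $N^{\mathbb H}=N-\langle N,T\rangle T$, $\nu=N^{\mathbb H}/|N^{\mathbb H}|$, $\alpha=\langle N,T\rangle/|N^{\mathbb H}|$, $\sigma_{\mathcal H}=|N^{\mathbb H}|\,dA$ with $dA$ the Riemannian surface measure of $S$, and $\mathcal HT_pS=\mathcal H_p\cap T_pS$. For a function $\varphi$ on $S$, $\nabla^{\mathcal H,S}\varphi=\sum_i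 (E_i\varphi)E_i$, where $E_1,E_2,E_3$ is an orthonormal basis of $\mathcal HT_pS$. For $X,Y\in\mathcal HT_pS$ let $$h(X,Y)=\langle\nabla_X\nu,Y\rangle,\qquad \tilde h(X,Y)=h(X,Y)+\alpha\langle J(X),Y\rangle ,$$ $|\tilde h|^2=\sum_{i,j}\tilde h(E_i,E_j)^2$, $H=\operatorname{tr}h$, $\ell=h(J(\nu),J(\nu))$, and $q=|\tilde h|^2+4\,J(\nu)\alpha+6\alpha^2$. Call $S$ *stable* if $H\equiv0$ and $$\int_S q\,\xi^2\,d\sigma_{\mathcal H}\le\int_S|\nabla^{\mathcal H,S}\xi|^2\,d\sigma_{\mathcal H}\qquad\text{for all }\xi\in C^1_c(S).$$ Consider the conditions, required at every point of $S$: * (P1) $\nabla_{J(\nu)}\nu=\ell\,J(\nu)$; * (P2) $\nabla^{\mathcal H,S}\alpha=(J(\nu)\alpha)\,J(\nu)$; * (P3) $J(\nu)\alpha+\alpha^2\ge0$. For $k\in[0,2]$ let $g_{S,k}=(6-4k)|\tilde h|^2-2k\,\ell^2$. **Theorem.** Let $k\in[0,2]$ and $\beta\in\left[1-\tfrac k3,\,1+\sqrt{\tfrac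 k3}\right)$. There is a constant $C=C(\beta,k)>0$ such that for every smooth, connected, two-sided, embedded, stable, non-characteristic hypersurface $S\subseteq\mathbb H^2$ satisfying (P1), (P2), (P3) and $g_{S,k}\ge0$ on $S$, $$\int_S|\tilde h|^{2\beta+2}|\varphi|^{2\beta+2}\,d\sigma_{\mathcal H}\le C\int_S|\nabla^{\mathcal H,S}\varphi|^{2\beta+2}\,d\sigma_{\mathcal H}\qquad\text{for all }\varphi\in C^1_c(S).$$ -/

import Mathlib

open MeasureTheory Set
open scoped RealInnerProductSpace ContDiff

noncomputable section

namespace Heisenberg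

/-- Points `(x, y, t)` of the `n`-th Heisenberg group, as a set `ℝ^{2n+1}`, with its Euclidean
structure as auxiliary structure: `x_j = p (inl (inl j))`, `y_j = p (inl (inr j))`,
`t = p (inr ())`. -/
abbrev Point (n : ℕ) := EuclideanSpace ℝ ((Fin n ⊕ Fin n) ⊕ Unit)

/-- Horizontal vectors, written in the left-invariant frame `X_1, …, X_n, Y_1, …, Y_n`: the vector
`∑ v_j X_j + ∑ w_j Y_j` has coordinates `v (inl j) = v_j`, `v (inr j) = w_j`. The sub-Riemannian
metric makes this frame orthonormal, so it is the Euclidean inner product of the coordinates. -/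
abbrev HVec (n : ℕ) := EuclideanSpace ℝ (Fin n ⊕ Fin n)

variable {n : ℕ}

/-- The tangent vector of `ℝ^{2n+1}` at `p` with frame coordinates `v`, where
`X_j = ∂_{x_j} + y_j ∂_t` and `Y_j = ∂_{y_j} - x_j ∂_t`. -/
def lift (p : Point n) (v : HVec n) : Point n :=
  WithLp.toLp 2 (Sum.elim (fun a => v a)
    (fun _ => ∑ j, (v (.inl j) * p (.inl (.inr j)) - v (.inr j) * p (.inl (.inl j)))))

/-- The left-invariant vertical field `T = ∂_t`. -/
def vertical : Point n := EuclideanSpace.single (.inr ()) 1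

/-- The complex structure on horizontal vectors: `J X_j = Y_j`, `J Y_j = -X_j`. -/
def J (v : HVec n) : HVec n :=
  WithLp.toLp 2 (Sum.elim (fun j => -v (.inr j)) (fun j => v (.inl j)))

/-- In the open neighbourhood `U` of `p`, the set `S` is the zero set of the smooth function `f`,
whose differential has no zeros. -/
def IsDefiningAt (S : Set (Point n)) (p : Point n) (U : Set (Point n)) (f : Point n → ℝ) : Prop :=
  IsOpen U ∧ p ∈ U ∧ ContDiffOn ℝ ∞ f U ∧ (∀ q ∈ U, fderiv ℝ f q ≠ 0) ∧ S ∩ U = {q ∈ U | f q = 0}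

/-- `S` is a smooth embedded hypersurface without boundary of `ℝ^{2n+1}` (not necessarily closed):
locally it is a regular level set of a smooth function. -/
def IsHypersurface (S : Set (Point n)) : Prop :=
  ∀ p ∈ S, ∃ U f, IsDefiningAt S p U f

/-- `η` is a continuous unit normal field (for the auxiliary Euclidean structure) along the
hypersurface `S`; `T_p S` is the kernel of the differential of a local defining function. A
hypersurface is two-sided if and only if it has such a field. -/
def IsUnitNormal (S : Set (Point n)) (η : Point n → Point n) : Prop :=
  ContinuousOn η S ∧ ∀ p ∈ S, ‖η p‖ = 1 ∧
    ∃ U f, IsDefiningAt S p U f ∧ ∀ v : Point n, fderiv ℝ f p v = 0 → ⟪η p, v⟫ = 0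

/-- The horizontal vector with coordinates `⟪η, X_j⟫`, `⟪η, Y_j⟫` (Euclidean inner products).

The covector `⟪η, ·⟫` annihilates `T_p S`. Hence, for the Riemannian metric that makes
`X_j, Y_j, T` orthonormal, the unit normal `N` has frame coordinates `(⟪η, Z_j⟫, ⟪η, T⟫) / c`, with
`c² = ∑ ⟪η, Z_j⟫² + ⟪η, T⟫²`, and `horNormal` is `c` times the horizontal part `N^ℍ` of `N`. -/
def horNormal (η : Point n → Point n) (p : Point n) : HVec n :=
  WithLp.toLp 2 (fun a => ⟪η p, lift p (EuclideanSpace.single a 1)⟫)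

/-- No point of `S` is characteristic: the horizontal distribution (the span of the `Z_j`) is
nowhere the tangent space `η(p)^⊥`, that is, `N^ℍ` does not vanish on `S`. -/
def IsNonCharacteristic (S : Set (Point n)) (η : Point n → Point n) : Prop :=
  ∀ p ∈ S, horNormal η p ≠ 0

/-- The horizontal unit normal `ν = N^ℍ / |N^ℍ|`. -/
def nu (η : Point n → Point n) (p : Point n) : HVec n := ‖horNormal η p‖⁻¹ • horNormal η p

/-- The fundamental function `α = ⟨N, T⟩ / |N^ℍ|`; equivalently `T - α ν` is tangent to `S`. -/
def alpha (η : Point n → Point n) (p : Point n) : ℝ := ⟪η p, vertical⟫ / ‖horNormal η p‖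

/-- The sub-Riemannian surface measure `σ_ℍ = |N^ℍ| dA` on `S`, where `dA` is the surface measure of
the Riemannian metric. Since the frame has determinant one, `dA = c dℋ^{2n}` with `c` as in
`horNormal` and `ℋ^{2n}` the Euclidean Hausdorff measure, and so `|N^ℍ| dA = |c N^ℍ| dℋ^{2n}`. -/
def sigmaH (S : Set (Point n)) (η : Point n → Point n) : Measure (Point n) :=
  (μHE[2 * n].restrict S).withDensity (fun p => ENNReal.ofReal ‖horNormal η p‖)

/-- The projection `π` of horizontal vectors at `p` onto the horizontal tangent space
`ℋT_p S = ν(p)^⊥`. -/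
def proj (η : Point n → Point n) (p : Point n) (v : HVec n) : HVec n := v - ⟪v, nu η p⟫ • nu η p

/-- The derivative `X φ` at `p ∈ S` of a function `φ` on `S` along the horizontal vector `X` tangent
to `S` with frame coordinates `v`. It depends only on the restriction of `φ` to `S`. -/
def tDeriv (S : Set (Point n)) (φ : Point n → ℝ) (p : Point n) (v : HVec n) : ℝ :=
  fderivWithin ℝ φ S p (lift p v)

/-- The horizontal tangential gradient `∇^{ℋ,S} φ = ∑_j (π(Z_j) φ) Z_j`: the horizontal tangent
vector that represents `X ↦ X φ` on `ℋT_p S`. -/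
def tGrad (S : Set (Point n)) (η : Point n → Point n) (φ : Point n → ℝ) (p : Point n) : HVec n :=
  WithLp.toLp 2 (fun a => tDeriv S φ p (proj η p (EuclideanSpace.single a 1)))

/-- The shape operator `A(X) = ∇_X ν`. The frame is parallel for the pseudohermitian connection, so
`∇_X` differentiates the frame coordinates. -/
def shape (S : Set (Point n)) (η : Point n → Point n) (p : Point n) (v : HVec n) : HVec n :=
  fderivWithin ℝ (nu η) S p (lift p v)

/-- The horizontal second fundamental form `h(X, Y) = ⟨∇_X ν, Y⟩`, for `X, Y ∈ ℋT_p S`. -/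
def sff (S : Set (Point n)) (η : Point n → Point n) (p : Point n) (v w : HVec n) : ℝ :=
  ⟪shape S η p v, w⟫

/-- The symmetric form `h̃(X, Y) = h(X, Y) + α ⟨J X, Y⟩`, for `X, Y ∈ ℋT_p S`. -/
def symSff (S : Set (Point n)) (η : Point n → Point n) (p : Point n) (v w : HVec n) : ℝ :=
  sff S η p v w + alpha η p * ⟪J v, w⟫

/-- `|h̃|²`. The sum of the squares `h̃(E_i, E_j)²` over an orthonormal basis of `ℋT_p S` is the sum
of the squares of `h̃(π ·, π ·)` over any orthonormal basis of the horizontal space. -/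
def symSffSq (S : Set (Point n)) (η : Point n → Point n) (p : Point n) : ℝ :=
  ∑ a, ∑ b, symSff S η p (proj η p (EuclideanSpace.single a 1))
    (proj η p (EuclideanSpace.single b 1)) ^ 2

/-- The norm `|h̃|`. -/
def symSffNorm (S : Set (Point n)) (η : Point n → Point n) (p : Point n) : ℝ :=
  √(symSffSq S η p)

/-- The horizontal mean curvature: the trace of `h` on `ℋT_p S`. -/
def meanCurv (S : Set (Point n)) (η : Point n → Point n) (p : Point n) : ℝ :=
  ∑ a, sff S η p (proj η p (EuclideanSpace.single a 1)) (proj η p (EuclideanSpace.single a 1))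

/-- `ℓ = h(J ν, J ν)`. -/
def ell (S : Set (Point n)) (η : Point n → Point n) (p : Point n) : ℝ :=
  sff S η p (J (nu η p)) (J (nu η p))

/-- `J(ν) α`, the derivative of `α` along the tangent vector `J(ν)`. -/
def jnuAlpha (S : Set (Point n)) (η : Point n → Point n) (p : Point n) : ℝ :=
  tDeriv S (alpha η) p (J (nu η p))

/-- The stability function `q = |h̃|² + 4 J(ν)α + 2(n+1) α²`. -/
def stabFun (S : Set (Point n)) (η : Point n → Point n) (p : Point n) : ℝ :=
  symSffSq S η p + 4 * jnuAlpha S η p + 2 * ((n : ℝ) + 1) * alpha η p ^ 2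

/-- `φ ∈ C^1_c(S)`: the restriction of `φ` to `S` is `C^1`, and it vanishes outside a compact subset
of `S`. The values of `φ` outside `S` play no role. -/
def IsC1c (S : Set (Point n)) (φ : Point n → ℝ) : Prop :=
  ContDiffOn ℝ 1 φ S ∧ ∃ K ⊆ S, IsCompact K ∧ ∀ p ∈ S, p ∉ K → φ p = 0

/-- `S` is stable: it is minimal (`H = 0`) and the second variation of `σ_ℍ` is non-negative. -/
def IsStable (S : Set (Point n)) (η : Point n → Point n) : Prop :=
  (∀ p ∈ S, meanCurv S η p = 0) ∧
    ∀ ξ : Point n → ℝ, IsC1c S ξ →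
      ∫ p, stabFun S η p * ξ p ^ 2 ∂(sigmaH S η) ≤ ∫ p, ‖tGrad S η ξ p‖ ^ 2 ∂(sigmaH S η)

/-- (P1): `∇_{J(ν)} ν - ℓ J(ν) = 0`, so that `J(ν)` is an eigenvector of `h̃`. -/
def PropP1 (S : Set (Point n)) (η : Point n → Point n) : Prop :=
  ∀ p ∈ S, shape S η p (J (nu η p)) - ell S η p • J (nu η p) = 0

/-- (P2): `∇^{ℋ,S} α = (J(ν)α) J(ν)`. -/
def PropP2 (S : Set (Point n)) (η : Point n → Point n) : Prop :=
  ∀ p ∈ S, tGrad S η (alpha η) p = jnuAlpha S η p • J (nu η p)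

/-- (P3): `J(ν)α + α² ≥ 0`; equivalently `q ≥ |h̃|² + (2n-2) α²`. -/
def PropP3 (S : Set (Point n)) (η : Point n → Point n) : Prop :=
  ∀ p ∈ S, 0 ≤ jnuAlpha S η p + alpha η p ^ 2

/-- The function `g_{S,k} = (6 - 4k) |h̃|² - 2k ℓ²` (used for `n = 2`). -/
def gFun (S : Set (Point n)) (η : Point n → Point n) (k : ℝ) (p : Point n) : ℝ :=
  (6 - 4 * k) * symSffSq S η p - 2 * k * ell S η p ^ 2

end Heisenberg

end

noncomputable section

open Module Filter


/-! Everything is controlled by the single function ℓ. Identify the horizontal space with the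
quaternions: besides `J` there is a constant complex structure `quatJ` anticommuting with it, so V =
Jν, A = `quatJ` ν, B = J `quatJ` ν is a global orthonormal frame of the horizontal tangent space.
The left-invariant frame is parallel, hence the covariant derivatives of V, A, B are these constant
linear maps applied to the shape operator, and the brackets [X, Y] = ∇_X Y - ∇_Y X - 2⟨JX, Y⟩T are
explicit.

Tangency of the brackets gives the skew part of h, so with (P1) the form h̃ splits into ℓ on V and a
symmetric block on A, B. The commutator formula applied to ν is a Codazzi equation without curvature
term (`Adapted.codazzi`). With H = 0 it yields Aℓ = Bℓ = 0, Vℓ = -4αℓ and |h̃|² = 3ℓ² - 2(Vα + α²);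
commuting A and B on ℓ then gives (T - αν)ℓ = -2αℓ². Two inequalities follow: |h̃|² ≤ 3ℓ² by (P3),
and Vα + α² ≤ (3/4)ℓ², because the trace of the A, B block is -ℓ.

All derivatives of ℓ are multiples of ℓ, so by Grönwall and connectedness ℓ vanishes identically or
nowhere. If ℓ ≡ 0, then h̃ = 0 and there is nothing to prove. Otherwise ξ = |ℓ|^β ψ is an admissible
test function, with V|ℓ|^β = -4βα|ℓ|^β. The divergence theorem ∫ (Vf + 4αf) dσ = 0 with f = αξ²,
added five times to the stability inequality, removes the terms in Vα and leaves a quadratic form in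
αψ and Vψ. Completing the square bounds ∫ |ℓ|^(2β+2) ψ² by a constant times ∫ |ℓ|^(2β) |∇ψ|² as soon
as d = 12 - (4β - 5)² > 0 (`Adapted.integral_weighted_le`). The choice ψ = |φ|^(β+1) and Young's
inequality give the estimate.

For k ≤ 9/7 the allowed β satisfy d > 0. For k > 9/7 the hypothesis g_{S,k} ≥ 0 and |h̃|² ≤ 3ℓ²
force h̃ = 0, and the left-hand side vanishes.

The analytic foundation consists of an area formula for graphs, which identifies σ_H in a chart, and
the divergence theorem for Jν, obtained from the Euclidean one in charts and a partition of unity.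
-/

/-! ### Area formula for parametrized submanifolds -/

/-- A bound between measures that holds near every point of a set holds on the whole set. -/
theorem MeasureTheory.measure_le_of_forall_nhds_le {X : Type*} [TopologicalSpace X]
    [SecondCountableTopology X] [MeasurableSpace X] [OpensMeasurableSpace X] {μ ν : Measure X}
    {s : Set X}
    (h : ∀ x ∈ s, ∃ t, IsOpen t ∧ x ∈ t ∧ ∀ A ⊆ t, A ⊆ s → MeasurableSet A → μ A ≤ ν A) {A : Set X}
    (hA : MeasurableSet A) (hAs : A ⊆ s) : μ A ≤ ν A := by
  choose! t hto htx ht using h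
  obtain ⟨T, hTs, hTc, hT⟩ := TopologicalSpace.countable_cover_nhdsWithin
    (f := t) (s := s) fun x hx => mem_nhdsWithin_of_mem_nhds ((hto x hx).mem_nhds (htx x hx))
  rcases T.eq_empty_or_nonempty with rfl | hne
  · have : A = ∅ := by
      apply Set.eq_empty_of_subset_empty
      exact hAs.trans (by simpa using hT)
    simp [this]
  obtain ⟨x, rfl⟩ := hTc.exists_eq_range hne
  have hxs : ∀ n, x n ∈ s := fun n => hTs ⟨n, rfl⟩
  have hcov : A = ⋃ n, A ∩ disjointed (fun n => t (x n)) n := by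
    rw [← Set.inter_iUnion, iUnion_disjointed, Set.inter_eq_left.2]
    exact hAs.trans (by simpa using hT)
  have hm : ∀ n, MeasurableSet (A ∩ disjointed (fun n => t (x n)) n) := fun n =>
    hA.inter (MeasurableSet.disjointed (fun n => (hto _ (hxs n)).measurableSet) n)
  have hd : Pairwise (Function.onFun Disjoint fun n => A ∩ disjointed (fun n => t (x n)) n) :=
    fun i j hij => (disjoint_disjointed _ hij).mono inter_subset_right inter_subset_right
  rw [hcov, measure_iUnion hd hm, measure_iUnion hd hm]
  refine ENNReal.tsum_le_tsum fun n => ht _ (hxs n) _ ?_ (inter_subset_left.trans hAs) (hm n)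
  exact inter_subset_right.trans (disjointed_subset _ _)

theorem LipschitzOnWith.euclideanHausdorffMeasure_image_le {X Y : Type*} [EMetricSpace X]
    [MeasurableSpace X] [BorelSpace X] [EMetricSpace Y] [MeasurableSpace Y] [BorelSpace Y]
    {K : NNReal} {f : X → Y} {s : Set X} (h : LipschitzOnWith K f s) (d : ℕ) :
    μHE[d] (f '' s) ≤ (K : ENNReal) ^ d * μHE[d] s := by
  simp only [Measure.euclideanHausdorffMeasure_def, Measure.smul_apply, ENNReal.smul_def, smul_eq_mul]
  calc _ ≤ _ := mul_le_mul_right (h.hausdorffMeasure_image_le (d := d) (by positivity)) _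
    _ = _ := by rw [ENNReal.rpow_natCast]; ring

/-- Near a point where the derivative is injective, a map distorts distances almost as its
derivative does. -/
theorem HasStrictFDerivAt.exists_nhds_norm_sub_le {H E : Type*} [NormedAddCommGroup H]
    [NormedSpace ℝ H] [FiniteDimensional ℝ H] [NormedAddCommGroup E] [NormedSpace ℝ E]
    {G : H → E} {M : H →L[ℝ] E} {u₀ : H} (hG : HasStrictFDerivAt G M u₀)
    (hM : (M : H →ₗ[ℝ] E).ker = ⊥) {c : NNReal} (hc : 1 < c) :
    ∃ t, IsOpen t ∧ u₀ ∈ t ∧ ∀ u ∈ t, ∀ v ∈ t,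
      ‖G u - G v‖ ≤ c * ‖M (u - v)‖ ∧ ‖M (u - v)‖ ≤ c * ‖G u - G v‖ := by
  obtain ⟨K, hK0, hK⟩ := LinearMap.exists_antilipschitzWith (M : H →ₗ[ℝ] E) hM
  have hc' : (1 : ℝ) < c := by exact_mod_cast hc
  have hK0' : (0 : ℝ) < K := by exact_mod_cast hK0
  -- With this δ the linearization error is at most (1 - c⁻¹)‖M(u - v)‖. Hence ‖Gu - Gv‖ lies
  -- between c⁻¹‖M(u - v)‖ and (2 - c⁻¹)‖M(u - v)‖, and 2 - c⁻¹ ≤ c.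
  set δ : ℝ := (1 - (c : ℝ)⁻¹) / K with hδ
  have hcinv : (c : ℝ)⁻¹ < 1 := inv_lt_one_of_one_lt₀ hc'
  have hδ0 : 0 < δ := div_pos (by linarith) hK0'
  obtain ⟨t₁, t₂, ht₁, h1, ht₂, h2, ht⟩ := mem_nhds_prod_iff'.1 (hG.isLittleO.def hδ0)
  refine ⟨t₁ ∩ t₂, ht₁.inter ht₂, ⟨h1, h2⟩, fun u hu v hv => ?_⟩
  have h3 : ‖G u - G v - M (u - v)‖ ≤ δ * ‖u - v‖ := ht (mk_mem_prod hu.1 hv.2)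
  have h4 : ‖u - v‖ ≤ K * ‖M (u - v)‖ := by
    have := hK.le_mul_dist u v
    rw [dist_eq_norm, dist_eq_norm] at this
    rw [map_sub]
    exact this
  have h5 : ‖G u - G v - M (u - v)‖ ≤ (1 - (c : ℝ)⁻¹) * ‖M (u - v)‖ := by
    refine h3.trans ((mul_le_mul_of_nonneg_left h4 hδ0.le).trans (le_of_eq ?_))
    rw [hδ]
    field_simp
  have h6 : ‖G u - G v‖ ≤ ‖G u - G v - M (u - v)‖ + ‖M (u - v)‖ := by
    simpa using norm_add_le (G u - G v - M (u - v)) (M (u - v))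
  have h7 : ‖M (u - v)‖ ≤ ‖G u - G v‖ + ‖G u - G v - M (u - v)‖ := by
    simpa using norm_sub_le (G u - G v) (G u - G v - M (u - v))
  have hcc : (c : ℝ) * (c : ℝ)⁻¹ = 1 := mul_inv_cancel₀ (by linarith)
  have h8 : 2 - (c : ℝ)⁻¹ ≤ c := by nlinarith [sq_nonneg ((c : ℝ) - 1)]
  constructor
  · nlinarith [norm_nonneg (M (u - v))]
  · have h9 : (c : ℝ)⁻¹ * ‖M (u - v)‖ ≤ ‖G u - G v‖ := by linarith
    calc ‖M (u - v)‖ = c * ((c : ℝ)⁻¹ * ‖M (u - v)‖) := by rw [← mul_assoc, hcc, one_mul]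
      _ ≤ _ := by gcongr

section AreaFormula

open Module

variable {H E : Type*} [NormedAddCommGroup H] [InnerProductSpace ℝ H] [FiniteDimensional ℝ H]
  [MeasurableSpace H] [BorelSpace H] [NormedAddCommGroup E] [InnerProductSpace ℝ E]
  [MeasurableSpace E] [BorelSpace E]

/-- The map G ∘ M⁻¹ is c-Lipschitz on M(s), and the linear image M(s) has a known measure. The
converse bound below uses M ∘ G⁻¹ on G(s) in the same way. -/
theorem LinearMap.euclideanHausdorffMeasure_image_le_of_norm_le (M : H →ₗ[ℝ] E) (hM : M.ker = ⊥)
    {G : H → E} {s : Set H} {c : NNReal}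
    (h : ∀ u ∈ s, ∀ v ∈ s, ‖G u - G v‖ ≤ c * ‖M (u - v)‖) :
    μHE[finrank ℝ H] (G '' s) ≤ c ^ finrank ℝ H * (ENNReal.ofReal M.normDet * volume s) := by
  rw [← LinearMap.euclideanHausdorffMeasure_image_eq_normDet_mul_volume]
  have hinj : Function.Injective M := LinearMap.ker_eq_bot.1 hM
  have hG : G '' s = (G ∘ Function.invFun M) '' (M '' s) := by
    rw [← image_comp, Function.comp_assoc, Function.invFun_comp hinj, Function.comp_id]
  rw [hG]
  refine LipschitzOnWith.euclideanHausdorffMeasure_image_le (LipschitzOnWith.of_dist_le_mul ?_) _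
  rintro _ ⟨u, hu, rfl⟩ _ ⟨v, hv, rfl⟩
  simpa [Function.leftInverse_invFun hinj _, dist_eq_norm] using h u hu v hv

theorem LinearMap.le_euclideanHausdorffMeasure_image_of_norm_le (M : H →ₗ[ℝ] E)
    {G : H → E} {s : Set H} {c : NNReal} (hG : InjOn G s)
    (h : ∀ u ∈ s, ∀ v ∈ s, ‖M (u - v)‖ ≤ c * ‖G u - G v‖) :
    ENNReal.ofReal M.normDet * volume s ≤ c ^ finrank ℝ H * μHE[finrank ℝ H] (G '' s) := by
  rw [← LinearMap.euclideanHausdorffMeasure_image_eq_normDet_mul_volume]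
  have hG' : M '' s = (M ∘ Function.invFunOn G s) '' (G '' s) := by
    rw [← image_comp]
    refine image_congr fun u hu => ?_
    simp [hG.leftInvOn_invFunOn hu]
  rw [hG']
  refine LipschitzOnWith.euclideanHausdorffMeasure_image_le (LipschitzOnWith.of_dist_le_mul ?_) _
  rintro _ ⟨u, hu, rfl⟩ _ ⟨v, hv, rfl⟩
  simpa [hG.leftInvOn_invFunOn hu, hG.leftInvOn_invFunOn hv, dist_eq_norm] using h u hu v hv

/-- **Area formula** for a parametrized submanifold with a continuous left inverse of the
parametrization. -/
theorem MeasureTheory.map_restrict_image_euclideanHausdorffMeasure {G : H → E} {G' : H → H →L[ℝ] E}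
    {Ω : Set H} (hΩ : IsOpen Ω) (hG : ∀ u ∈ Ω, HasStrictFDerivAt G (G' u) u)
    (hG' : ∀ u ∈ Ω, (G' u : H →ₗ[ℝ] E).ker = ⊥) {π : E → H} (hπ : Continuous π)
    (hπG : ∀ u ∈ Ω, π (G u) = u) {D : H → ℝ} (hD : ContinuousOn D Ω)
    (hDG : ∀ u ∈ Ω, D u = (G' u : H →ₗ[ℝ] E).normDet) :
    (μHE[finrank ℝ H].restrict (G '' Ω)).map π =
      (volume.restrict Ω).withDensity (fun u => ENNReal.ofReal (D u)) := by
  set ν := (μHE[finrank ℝ H].restrict (G '' Ω)).map π with hν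
  set m := (volume.restrict Ω).withDensity (fun u => ENNReal.ofReal (D u)) with hm
  have hνA : ∀ A, MeasurableSet A → A ⊆ Ω → ν A = μHE[finrank ℝ H] (G '' A) := by
    intro A hA hAΩ
    rw [hν, Measure.map_apply hπ.measurable hA, Measure.restrict_apply (hπ.measurable hA)]
    congr 1
    ext p
    constructor
    · rintro ⟨hp, u, hu, rfl⟩
      rw [mem_preimage, hπG u hu] at hp
      exact ⟨u, hp, rfl⟩
    · rintro ⟨u, hu, rfl⟩
      refine ⟨?_, u, hAΩ hu, rfl⟩
      rw [mem_preimage, hπG u (hAΩ hu)]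
      exact hu
  have hmA : ∀ A, MeasurableSet A → A ⊆ Ω → m A = ∫⁻ u in A, ENNReal.ofReal (D u) := by
    intro A hA hAΩ
    rw [hm, withDensity_apply _ hA, Measure.restrict_restrict hA, inter_eq_left.2 hAΩ]
  have hinj : InjOn G Ω := fun u hu v hv huv => by rw [← hπG u hu, huv, hπG v hv]
  have hDpos : ∀ u ∈ Ω, 0 < D u := by
    intro u hu
    rw [hDG u hu]
    refine lt_of_le_of_ne (LinearMap.normDet_nonneg _) (Ne.symm fun h => ?_)
    exact LinearMap.normDet_eq_zero_iff_ker_ne_bot.1 h (hG' u hu)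
  -- Near each point the two measures agree up to a factor: c to the dimension from the distortion
  -- of distances, and one more c from the oscillation of the density D. The local bounds are summed
  -- over a countable cover, and c ↓ 1 gives equality.
  have key : ∀ c : NNReal, 1 < c → ∀ u₀ ∈ Ω, ∃ t, IsOpen t ∧ u₀ ∈ t ∧ ∀ A ⊆ t, A ⊆ Ω →
      MeasurableSet A → ν A ≤ c ^ (finrank ℝ H + 1) * m A ∧ m A ≤ c ^ (finrank ℝ H + 1) * ν A := by
    intro c hc u₀ hu₀
    have hc' : (1 : ℝ) < c := by exact_mod_cast hc
    obtain ⟨t₁, ht₁o, ht₁u, ht₁⟩ := (hG u₀ hu₀).exists_nhds_norm_sub_le (hG' u₀ hu₀) hc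
    have hd : ∀ᶠ u in nhds u₀, D u < c * D u₀ ∧ D u₀ < c * D u := by
      have hcont := hD.continuousAt (hΩ.mem_nhds hu₀)
      have h0 := hDpos u₀ hu₀
      refine (hcont.eventually_lt continuousAt_const ?_).and
        (continuousAt_const.eventually_lt (continuousAt_const.mul hcont) ?_) <;> nlinarith
    obtain ⟨t₂, ht₂, ht₂o, ht₂u⟩ := eventually_nhds_iff.1 hd
    refine ⟨t₁ ∩ t₂, ht₁o.inter ht₂o, ⟨ht₁u, ht₂u⟩, fun A hA hAΩ hAm => ?_⟩
    rw [hνA A hAm hAΩ, hmA A hAm hAΩ]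
    have e1 := LinearMap.euclideanHausdorffMeasure_image_le_of_norm_le (G' u₀ : H →ₗ[ℝ] E)
      (hG' u₀ hu₀) (G := G) (s := A) (c := c) fun u hu v hv => (ht₁ u (hA hu).1 v (hA hv).1).1
    have e2 := LinearMap.le_euclideanHausdorffMeasure_image_of_norm_le (G' u₀ : H →ₗ[ℝ] E)
      (G := G) (s := A) (c := c) (hinj.mono hAΩ) fun u hu v hv => (ht₁ u (hA hu).1 v (hA hv).1).2
    rw [← hDG u₀ hu₀] at e1 e2
    have e3 : ENNReal.ofReal (D u₀) * volume A ≤ c * ∫⁻ u in A, ENNReal.ofReal (D u) := by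
      rw [← lintegral_const_mul' _ _ ENNReal.coe_ne_top, ← setLIntegral_const]
      refine setLIntegral_mono' hAm fun u hu => ?_
      rw [← ENNReal.ofReal_coe_nnreal, ← ENNReal.ofReal_mul c.coe_nonneg]
      exact ENNReal.ofReal_le_ofReal (ht₂ u (hA hu).2).2.le
    have e4 : ∫⁻ u in A, ENNReal.ofReal (D u) ≤ c * (ENNReal.ofReal (D u₀) * volume A) := by
      rw [← mul_assoc, ← setLIntegral_const]
      refine setLIntegral_mono' hAm fun u hu => ?_
      rw [← ENNReal.ofReal_coe_nnreal, ← ENNReal.ofReal_mul c.coe_nonneg]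
      exact ENNReal.ofReal_le_ofReal (ht₂ u (hA hu).2).1.le
    rw [pow_succ, mul_assoc, mul_assoc]
    refine ⟨e1.trans (mul_le_mul_right e3 _), e4.trans ?_⟩
    calc _ ≤ (c : ENNReal) * (c ^ finrank ℝ H * μHE[finrank ℝ H] (G '' A)) := mul_le_mul_right e2 _
      _ = _ := mul_left_comm _ _ _
  have lim : ∀ a : ENNReal, Filter.Tendsto (fun c : NNReal => (c : ENNReal) ^ (finrank ℝ H + 1) * a)
      (nhdsWithin 1 (Ioi 1)) (nhds a) := by
    intro a
    have h1 : Filter.Tendsto (fun c : NNReal => (c : ENNReal) ^ (finrank ℝ H + 1))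
        (nhdsWithin 1 (Ioi 1)) (nhds 1) := by
      have h2 : Continuous fun c : NNReal => (c : ENNReal) ^ (finrank ℝ H + 1) :=
        (ENNReal.continuous_pow _).comp ENNReal.continuous_coe
      simpa using (h2.tendsto 1).mono_left nhdsWithin_le_nhds
    simpa using ENNReal.Tendsto.mul_const h1 (Or.inl one_ne_zero)
  have hsub : ∀ A, MeasurableSet A → A ⊆ Ω → ν A = m A := by
    intro A hA hAΩ
    apply le_antisymm
    · refine ge_of_tendsto (lim (m A)) (eventually_mem_nhdsWithin.mono fun c hc => ?_)
      refine measure_le_of_forall_nhds_le (μ := ν) (ν := (c : ENNReal) ^ (finrank ℝ H + 1) • m)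
        (s := Ω) (fun u hu => ?_) hA hAΩ
      obtain ⟨t, h1, h2, h3⟩ := key c hc u hu
      exact ⟨t, h1, h2, fun B hB hBΩ hBm => (h3 B hB hBΩ hBm).1⟩
    · refine ge_of_tendsto (lim (ν A)) (eventually_mem_nhdsWithin.mono fun c hc => ?_)
      refine measure_le_of_forall_nhds_le (μ := m) (ν := (c : ENNReal) ^ (finrank ℝ H + 1) • ν)
        (s := Ω) (fun u hu => ?_) hA hAΩ
      obtain ⟨t, h1, h2, h3⟩ := key c hc u hu
      exact ⟨t, h1, h2, fun B hB hBΩ hBm => (h3 B hB hBΩ hBm).2⟩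
  ext A hA
  have hν0 : ν (A \ Ω) = 0 := by
    rw [hν, Measure.map_apply hπ.measurable (hA.diff hΩ.measurableSet), Measure.restrict_apply
      (hπ.measurable (hA.diff hΩ.measurableSet))]
    convert measure_empty (μ := μHE[finrank ℝ H])
    refine Set.eq_empty_of_forall_notMem ?_
    rintro _ ⟨hp, u, hu, rfl⟩
    rw [mem_preimage, hπG u hu] at hp
    exact hp.2 hu
  have hm0 : m (A \ Ω) = 0 := by
    rw [hm, withDensity_apply _ (hA.diff hΩ.measurableSet), Measure.restrict_restrict
      (hA.diff hΩ.measurableSet)]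
    simp
  rw [← measure_inter_add_sdiff A hΩ.measurableSet, ← measure_inter_add_sdiff (μ := m) A
    hΩ.measurableSet, hν0, hm0, hsub _ (hA.inter hΩ.measurableSet) inter_subset_right]

/-- The volume factor of the differential of a graph. -/
theorem LinearMap.normDet_graph {H E : Type*} [NormedAddCommGroup H] [InnerProductSpace ℝ H]
    [FiniteDimensional ℝ H] [NormedAddCommGroup E] [InnerProductSpace ℝ E]
    (L : H →ₗᵢ[ℝ] E) {e : E} (he : ‖e‖ = 1) (hLe : ∀ u, ⟪e, L u⟫ = 0)
    (w : H) :
    (L.toLinearMap + (innerₛₗ ℝ w).smulRight e : H →ₗ[ℝ] E).normDet = √(1 + ‖w‖ ^ 2) := by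
  have h := LinearMap.normDet_sq_eq_det_gram
    (L.toLinearMap + (innerₛₗ ℝ w).smulRight e : H →ₗ[ℝ] E) (stdOrthonormalBasis ℝ H)
  have hLe' : ∀ u, ⟪L u, e⟫ = 0 := fun u => by rw [real_inner_comm]; exact hLe u
  have hgram : Matrix.gram ℝ (fun i => (L.toLinearMap + (innerₛₗ ℝ w).smulRight e : H →ₗ[ℝ] E)
      (stdOrthonormalBasis ℝ H i)) =
      1 + Matrix.replicateCol Unit (fun i => ⟪w, stdOrthonormalBasis ℝ H i⟫) *
        Matrix.replicateRow Unit (fun i => ⟪w, stdOrthonormalBasis ℝ H i⟫) := by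
    ext i j
    simp [Matrix.gram_apply, Matrix.mul_apply, inner_add_left, inner_add_right, inner_smul_left,
      inner_smul_right, hLe, hLe', he, Matrix.one_apply,
      orthonormal_iff_ite.1 (stdOrthonormalBasis ℝ H).orthonormal i j]
    ring
  rw [hgram, Matrix.det_one_add_replicateCol_mul_replicateRow] at h
  have h2 : (fun i => ⟪w, stdOrthonormalBasis ℝ H i⟫) ⬝ᵥ (fun i => ⟪w, stdOrthonormalBasis ℝ H i⟫)
      = ‖w‖ ^ 2 := by
    rw [← (stdOrthonormalBasis ℝ H).sum_sq_inner_left w]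
    simp [dotProduct, sq]
  rw [h2] at h
  rw [← Real.sqrt_sq (LinearMap.normDet_nonneg _)]
  exact congrArg _ (by exact_mod_cast h)

end AreaFormula

/-! ### Hypersurfaces as graphs -/

/-- Every unit vector has an orthonormal complement parametrized by a Euclidean space. -/
theorem exists_linearIsometry_orthogonal {E : Type*} [NormedAddCommGroup E]
    [InnerProductSpace ℝ E] {m : ℕ} (hE : finrank ℝ E = m + 1) {e : E} (he : ‖e‖ = 1) :
    ∃ (L : EuclideanSpace ℝ (Fin m) →ₗᵢ[ℝ] E) (π : E →L[ℝ] EuclideanSpace ℝ (Fin m)),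
      (∀ u, ⟪e, L u⟫ = 0) ∧ (∀ u, π (L u) = u) ∧ π e = 0 ∧ ∀ p, p = L (π p) + ⟪e, p⟫ • e := by
  have : Fact (finrank ℝ E = m + 1) := ⟨hE⟩
  have : FiniteDimensional ℝ E := .of_fact_finrank_eq_succ m
  have he0 : e ≠ 0 := fun h => by simp [h] at he
  have hf : finrank ℝ (ℝ ∙ e)ᗮ = m := Submodule.finrank_orthogonal_span_singleton he0
  let b : OrthonormalBasis (Fin m) ℝ (ℝ ∙ e)ᗮ := (stdOrthonormalBasis ℝ _).reindex (finCongr hf)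
  let L : EuclideanSpace ℝ (Fin m) →ₗᵢ[ℝ] E :=
    ((ℝ ∙ e)ᗮ).subtypeₗᵢ.comp b.repr.symm.toLinearIsometry
  have hL : ∀ u, ⟪e, L u⟫ = 0 := fun u =>
    Submodule.mem_orthogonal_singleton_iff_inner_right.1 (b.repr.symm u).2
  have hπL : ∀ u, L.toContinuousLinearMap.adjoint (L u) = u := fun u => by
    refine ext_inner_left ℝ fun v => ?_
    rw [ContinuousLinearMap.adjoint_inner_right]
    exact L.inner_map_map v u
  have hπe : L.toContinuousLinearMap.adjoint e = 0 := by
    refine ext_inner_left ℝ fun v => ?_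
    rw [ContinuousLinearMap.adjoint_inner_right, inner_zero_right, real_inner_comm]
    exact hL v
  refine ⟨L, L.toContinuousLinearMap.adjoint, hL, hπL, hπe, fun p => ?_⟩
  have hp : p - ⟪e, p⟫ • e ∈ (ℝ ∙ e)ᗮ := by
    rw [Submodule.mem_orthogonal_singleton_iff_inner_right, inner_sub_right, inner_smul_right,
      real_inner_self_eq_norm_sq, he]
    ring
  obtain ⟨u, hu⟩ : ∃ u, L u = p - ⟪e, p⟫ • e :=
    ⟨b.repr ⟨_, hp⟩, by simp [L]⟩
  have hu' : p = L u + ⟪e, p⟫ • e := by rw [hu]; abel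
  have : L.toContinuousLinearMap.adjoint p = u := by
    conv_lhs => rw [hu', map_add, map_smul, hπe, hπL]
    simp
  rw [this]
  exact hu'

/-- Implicit function theorem: the zero set of a function is a graph near a point where the
differential does not vanish on `e`. -/
theorem exists_graph_of_contDiffAt {H E : Type*} [NormedAddCommGroup H] [InnerProductSpace ℝ H]
    [NormedAddCommGroup E] [InnerProductSpace ℝ E] [FiniteDimensional ℝ E] {L : H →ₗᵢ[ℝ] E}
    {π : E →L[ℝ] H} {e : E} (he : ‖e‖ = 1) (hL : ∀ u, ⟪e, L u⟫ = 0) (hπL : ∀ u, π (L u) = u)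
    (hπe : π e = 0) (hdec : ∀ p, p = L (π p) + ⟪e, p⟫ • e) {f : E → ℝ} {p : E} {V : Set E}
    (hV : IsOpen V) (hpV : p ∈ V) (hf : ContDiffAt ℝ ∞ f p) (hfe : fderiv ℝ f p e ≠ 0)
    (hfp : f p = 0) (k : ℕ) (hk : k ≠ 0) :
    ∃ (Ω : Set H) (U : Set E) (g : H → ℝ), IsOpen Ω ∧ π p ∈ Ω ∧ IsOpen U ∧ p ∈ U ∧ U ⊆ V ∧
      ContDiffOn ℝ k g Ω ∧ {q ∈ U | f q = 0} = (fun u => L u + g u • e) '' Ω := by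
  -- This map keeps the component orthogonal to e and replaces the e-component by f, so it
  -- straightens the zero set of f onto a hyperplane. Its local inverse over that hyperplane is the
  -- graph.
  set Ψ : E → E := fun q => L (π q) + f q • e with hΨ
  have hfk : ContDiffAt ℝ k f p := hf.of_le (by exact_mod_cast le_top)
  have hk1 : (k : WithTop ℕ∞) ≠ 0 := by exact_mod_cast hk
  let A : E →L[ℝ] E := L.toContinuousLinearMap.comp π + (fderiv ℝ f p).smulRight e
  have hA : HasFDerivAt Ψ A p :=
    (L.toContinuousLinearMap.comp π).hasFDerivAt.add
      ((hfk.differentiableAt hk1).hasFDerivAt.smul_const e)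
  have hinj : Function.Injective A := by
    rw [injective_iff_map_eq_zero]
    intro v hv
    have hv' : L (π v) + fderiv ℝ f p v • e = 0 := hv
    have h1 : π v = 0 := by simpa [hπL, hπe] using congrArg π hv'
    have h2 : v = ⟪e, v⟫ • e := by simpa [h1] using hdec v
    have he0 : e ≠ 0 := fun h => by simp [h] at he
    have h3 : fderiv ℝ f p v = 0 := by
      have : fderiv ℝ f p v • e = 0 := by simpa [h1] using hv'
      exact (smul_eq_zero.1 this).resolve_right he0
    rw [h2, map_smul, smul_eq_mul] at h3
    rw [h2, (mul_eq_zero.1 h3).resolve_right hfe, zero_smul]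
  let A' : E ≃L[ℝ] E := (LinearEquiv.ofInjectiveEndo (A : E →ₗ[ℝ] E) hinj).toContinuousLinearEquiv
  have hA' : HasFDerivAt Ψ (A' : E →L[ℝ] E) p := by
    have hAA : (A' : E →L[ℝ] E) = A := rfl
    rwa [hAA]
  have hΨk : ContDiffAt ℝ k Ψ p :=
    ((L.toContinuousLinearMap.comp π).contDiff.contDiffAt).add (hfk.smul contDiffAt_const)
  let R := hΨk.toOpenPartialHomeomorph Ψ hA' hk1
  have hRΨ : ∀ q, R q = Ψ q := fun q => rfl
  have hsym : ContDiffAt ℝ k R.symm (Ψ p) := hΨk.to_localInverse hA' hk1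
  have hpR : p ∈ R.source := hΨk.mem_toOpenPartialHomeomorph_source hA' hk1
  -- A finite order of smoothness is essential here: being C^k at a point extends to a neighbourhood
  -- only for k ≠ ∞.
  have hev := hsym.eventually (by simp)
  obtain ⟨W, hW, hWo, hpW⟩ := eventually_nhds_iff.1 hev
  have hΨp : Ψ p = L (π p) := by simp [hΨ, hfp]
  have hπΨ : ∀ q, π (Ψ q) = π q := fun q => by simp [hΨ, hπL, hπe]
  have hfΨ : ∀ q, ⟪e, Ψ q⟫ = f q := fun q => by
    simp [hΨ, inner_add_right, hL, inner_smul_right, he]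
  let T : Set E := R.target ∩ R.symm ⁻¹' (V ∩ R.source) ∩ W
  have hTo : IsOpen T := by
    refine IsOpen.inter ?_ hWo
    exact R.isOpen_inter_preimage_symm (hV.inter R.open_source)
  let U : Set E := R.source ∩ R ⁻¹' T
  have hUV : U ⊆ V := by
    rintro q ⟨hq, hqT⟩
    have := hqT.1.2.1
    rwa [R.left_inv hq] at this
  refine ⟨L ⁻¹' T, U, fun u => ⟪e, R.symm (L u)⟫, hTo.preimage L.continuous, ?_,
    R.isOpen_inter_preimage hTo, ?_, hUV, ?_, ?_⟩
  · rw [mem_preimage, ← hΨp]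
    refine ⟨⟨R.map_source hpR, ?_⟩, hpW⟩
    rw [mem_preimage, ← hRΨ, R.left_inv hpR]
    exact ⟨hpV, hpR⟩
  · refine ⟨hpR, ⟨R.map_source hpR, ?_⟩, hpW⟩
    rw [mem_preimage, R.left_inv hpR]
    exact ⟨hpV, hpR⟩
  · intro u hu
    have h1 : ContDiffAt ℝ k R.symm (L u) := hW _ hu.2
    exact (contDiffAt_const.inner ℝ (h1.comp u L.contDiff.contDiffAt)).contDiffWithinAt
  · ext q
    constructor
    · rintro ⟨⟨hq, hqT⟩, hfq⟩
      have h1 : R q = L (π q) := by simp [hRΨ, hΨ, hfq]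
      refine ⟨π q, ?_, ?_⟩
      · rw [mem_preimage, ← h1]
        exact hqT
      · dsimp only
        rw [← h1, R.left_inv hq, h1]
        exact (hdec q).symm
    · rintro ⟨u, hu, rfl⟩
      have h1 : R (R.symm (L u)) = L u := R.right_inv hu.1.1
      have h2 : π (R.symm (L u)) = u := by rw [← hπΨ, ← hRΨ, h1, hπL]
      have h3 : L u + ⟪e, R.symm (L u)⟫ • e = R.symm (L u) := by
        conv_rhs => rw [hdec (R.symm (L u)), h2]
      have h4 : f (R.symm (L u)) = 0 := by rw [← hfΨ, ← hRΨ, h1, hL]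
      dsimp only
      rw [h3]
      refine ⟨⟨R.map_target hu.1.1, ?_⟩, h4⟩
      rw [mem_preimage, h1]
      exact hu

namespace Heisenberg

variable {n : ℕ}

/-- A description of a part `S ∩ U` of a hypersurface as the graph of a function `g` on a convex
open set `Ω`, in the direction of a unit vector `e`, together with the normal field along it. -/
structure GraphChart (S : Set (Point n)) (η : Point n → Point n) where
  /-- Parametrization of the orthogonal complement of `e`. -/
  L : EuclideanSpace ℝ (Fin (2 * n)) →ₗᵢ[ℝ] Point n
  /-- Projection along `e`. -/
  π : Point n →L[ℝ] EuclideanSpace ℝ (Fin (2 * n))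
  /-- The direction of the graph. -/
  e : Point n
  /-- The part of the ambient space covered by the chart. -/
  U : Set (Point n)
  /-- The domain of the graph function. -/
  Ω : Set (EuclideanSpace ℝ (Fin (2 * n)))
  /-- The graph function. -/
  g : EuclideanSpace ℝ (Fin (2 * n)) → ℝ
  /-- The orientation. -/
  s : ℝ
  norm_e : ‖e‖ = 1
  inner_e_L : ∀ u, ⟪e, L u⟫ = 0
  π_L : ∀ u, π (L u) = u
  π_e : π e = 0
  decomp : ∀ p, p = L (π p) + ⟪e, p⟫ • e
  isOpen_U : IsOpen U
  isOpen_Ω : IsOpen Ω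
  convex_Ω : Convex ℝ Ω
  contDiffOn_g : ContDiffOn ℝ 5 g Ω
  inter_eq : S ∩ U = (fun u => L u + g u • e) '' Ω
  s_sq : s ^ 2 = 1
  normal : ∀ u ∈ Ω, η (L u + g u • e) = (s / √(1 + ‖gradient g u‖ ^ 2)) • (e - L (gradient g u))

theorem finrank_point : finrank ℝ (Point n) = 2 * n + 1 := by
  simp [Point, two_mul]

/-- The surface is a graph in the direction of the gradient of a defining function. As η is
orthogonal to the graph, it is a multiple of e - L(∇g); the sign of the multiple is continuous with
square 1, hence constant near p. The domain is shrunk to a ball because convexity is needed later to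
join parameters by segments. -/
theorem exists_graphChart {S : Set (Point n)} {η : Point n → Point n} (hS : IsHypersurface S)
    (hη : IsUnitNormal S η) {p : Point n} (hp : p ∈ S) : ∃ c : GraphChart S η, p ∈ c.U := by
  obtain ⟨V, f, hVo, hpV, hf, hf0, hSV⟩ := hS p hp
  have hfa : ∀ q ∈ V, ContDiffAt ℝ ∞ f q := fun q hq => hf.contDiffAt (hVo.mem_nhds hq)
  have hga : gradient f p ≠ 0 := by
    intro h
    apply hf0 p hpV
    rw [← toDual_gradient, h, map_zero]
  set e : Point n := ‖gradient f p‖⁻¹ • gradient f p with he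
  have he1 : ‖e‖ = 1 := norm_smul_inv_norm hga
  have hfe : fderiv ℝ f p e ≠ 0 := by
    rw [← inner_gradient_left, he, inner_smul_right, real_inner_self_eq_norm_sq]
    have := norm_ne_zero_iff.2 hga
    positivity
  obtain ⟨L, π, hL, hπL, hπe, hdec⟩ := exists_linearIsometry_orthogonal finrank_point he1
  have hfp : f p = 0 := by
    have : p ∈ S ∩ V := ⟨hp, hpV⟩
    rw [hSV] at this
    exact this.2
  -- Order 5 leaves enough derivatives: ν and α become C⁴, the entries of the shape operator and ℓ
  -- become C³, and commutators of derivatives require C².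
  obtain ⟨Ω, U, g, hΩ, hpΩ, hU, hpU, hUV, hg, hgraph⟩ :=
    exists_graph_of_contDiffAt he1 hL hπL hπe hdec hVo hpV (hfa p hpV) hfe hfp 5 (by norm_num)
  have hSU : S ∩ U = (fun u => L u + g u • e) '' Ω := by
    rw [← hgraph]
    ext q
    constructor
    · rintro ⟨hq, hqU⟩
      have : q ∈ S ∩ V := ⟨hq, hUV hqU⟩
      rw [hSV] at this
      exact ⟨hqU, this.2⟩
    · rintro ⟨hqU, hq⟩
      have : q ∈ S ∩ V := by
        rw [hSV]
        exact ⟨hUV hqU, hq⟩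
      exact ⟨this.1, hqU⟩
  set Γ : EuclideanSpace ℝ (Fin (2 * n)) → Point n := fun u => L u + g u • e with hΓ
  have hΓS : ∀ u ∈ Ω, Γ u ∈ S := fun u hu => by
    have : Γ u ∈ S ∩ U := by rw [hSU]; exact ⟨u, hu, rfl⟩
    exact this.1
  have hg' : ∀ u ∈ Ω, HasFDerivAt g (fderiv ℝ g u) u := fun u hu =>
    ((hg.contDiffAt (hΩ.mem_nhds hu)).differentiableAt (by norm_num)).hasFDerivAt
  have hΓ' : ∀ u ∈ Ω, HasFDerivAt Γ (L.toContinuousLinearMap + (fderiv ℝ g u).smulRight e) u :=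
    fun u hu => L.toContinuousLinearMap.hasFDerivAt.add ((hg' u hu).smul_const e)
  -- The normality of η may refer to a defining function f' other than f. Both vanish on S, so f' ∘
  -- Γ is locally zero and the differential of f' annihilates the tangent vectors of the graph.
  have horth : ∀ u ∈ Ω, ∀ v, ⟪η (Γ u), L v + fderiv ℝ g u v • e⟫ = 0 := by
    intro u hu v
    obtain ⟨-, V', f', ⟨hV'o, hV', hf', -, hSV'⟩, hker⟩ := hη.2 (Γ u) (hΓS u hu)
    refine hker _ ?_
    have hcomp : HasFDerivAt (f' ∘ Γ) _ u :=
      ((hf'.contDiffAt (hV'o.mem_nhds hV')).differentiableAt (by simp)).hasFDerivAt.comp u (hΓ' u hu)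
    have hzero : f' ∘ Γ =ᶠ[nhds u] fun _ => 0 := by
      filter_upwards [hΩ.mem_nhds hu, (hΓ' u hu).continuousAt.preimage_mem_nhds
        (hV'o.mem_nhds hV')] with v hv hv'
      have : Γ v ∈ S ∩ V' := ⟨hΓS v hv, hv'⟩
      rw [hSV'] at this
      exact this.2
    have := (hcomp.congr_of_eventuallyEq hzero.symm).unique (hasFDerivAt_const (0 : ℝ) u)
    simpa using congrArg (fun A => A v) this
  have hform : ∀ u ∈ Ω, η (Γ u) = ⟪e, η (Γ u)⟫ • (e - L (gradient g u)) := by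
    intro u hu
    have h1 : π (η (Γ u)) = - (⟪e, η (Γ u)⟫ • gradient g u) := by
      refine ext_inner_right ℝ fun v => ?_
      have h2 := horth u hu v
      have h3 : ⟪π (η (Γ u)), v⟫ = ⟪η (Γ u), L v⟫ := by
        conv_rhs => rw [hdec (η (Γ u))]
        rw [inner_add_left, inner_smul_left, hL, L.inner_map_map]
        simp
      rw [inner_add_right, inner_smul_right, ← inner_gradient_left, ← h3] at h2
      rw [inner_neg_left, inner_smul_left, real_inner_comm (η (Γ u)) e]
      simp only [conj_trivial]
      rw [real_inner_comm e] at h2 ⊢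
      linarith
    conv_lhs => rw [hdec (η (Γ u)), h1]
    rw [map_neg, map_smul, smul_sub]
    abel
  have hnorm : ∀ w, ‖e - L w‖ ^ 2 = 1 + ‖w‖ ^ 2 := by
    intro w
    rw [norm_sub_sq_real, hL, he1, L.norm_map]
    ring
  set s : EuclideanSpace ℝ (Fin (2 * n)) → ℝ :=
    fun u => ⟪e, η (Γ u)⟫ * √(1 + ‖gradient g u‖ ^ 2) with hs
  have hsq : ∀ u ∈ Ω, s u ^ 2 = 1 := by
    intro u hu
    have h1 : ‖η (Γ u)‖ ^ 2 = 1 := by rw [(hη.2 _ (hΓS u hu)).1]; norm_num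
    rw [hform u hu, norm_smul, mul_pow, hnorm, Real.norm_eq_abs, sq_abs] at h1
    rw [hs, mul_pow, Real.sq_sqrt (by positivity)]
    exact h1
  have hgradc : ContinuousOn (gradient g) Ω := by
    have := hg.continuousOn_fderiv_of_isOpen hΩ (by norm_num)
    exact (InnerProductSpace.toDual ℝ _).symm.continuous.comp_continuousOn this
  have hΓc : ContinuousOn Γ Ω := fun u hu => (hΓ' u hu).continuousAt.continuousWithinAt
  have hsc : ContinuousOn s Ω := by
    refine ContinuousOn.mul ?_ ?_
    · exact continuousOn_const.inner (hη.1.comp hΓc hΓS)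
    · exact (continuousOn_const.add (hgradc.norm.pow 2)).sqrt
  have hss : ∀ᶠ u in nhds (π p), 0 < s u * s (π p) := by
    have h1 := (hsc.continuousAt (hΩ.mem_nhds hpΩ)).mul_const (s (π p))
    refine continuousAt_const.eventually_lt h1 ?_
    have := hsq _ hpΩ
    nlinarith
  obtain ⟨r, hr, hball⟩ := Metric.mem_nhds_iff.1 (inter_mem hss (hΩ.mem_nhds hpΩ))
  have hballΩ : Metric.ball (π p) r ⊆ Ω := fun u hu => (hball hu).2
  refine ⟨⟨L, π, e, U ∩ π ⁻¹' Metric.ball (π p) r, Metric.ball (π p) r, g, s (π p), he1, hL, hπL,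
    hπe, hdec, hU.inter (Metric.isOpen_ball.preimage π.continuous), Metric.isOpen_ball,
    convex_ball _ _, hg.mono hballΩ, ?_, hsq _ hpΩ, fun u hu => ?_⟩, hpU, ?_⟩
  · rw [← inter_assoc, hSU]
    ext q
    constructor
    · rintro ⟨⟨u, hu, rfl⟩, hq⟩
      simp only [mem_preimage, hΓ, map_add, map_smul, hπL, hπe, smul_zero, add_zero] at hq
      exact ⟨u, hq, rfl⟩
    · rintro ⟨u, hu, rfl⟩
      refine ⟨⟨u, hballΩ hu, rfl⟩, ?_⟩
      simp only [mem_preimage, map_add, map_smul, hπL, hπe, smul_zero, add_zero]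
      exact hu
  · have h1 := hsq u (hballΩ hu)
    have h2 := hsq _ hpΩ
    have h3 : 0 < s u * s (π p) := (hball hu).1
    have h4 : s u = s (π p) := by
      have : (s u - s (π p)) * (s u + s (π p)) = 0 := by ring_nf; rw [h1, h2]; ring
      rcases mul_eq_zero.1 this with h | h
      · linarith
      · nlinarith
    rw [← h4]
    change η (Γ u) = _
    conv_lhs => rw [hform u (hballΩ hu)]
    congr 1
    rw [hs]
    have : √(1 + ‖gradient g u‖ ^ 2) ≠ 0 := by positivity
    field_simp
  · exact Metric.mem_ball_self hr

end Heisenberg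

/-! ### Linear algebra of horizontal vectors and the quaternionic structure -/

namespace Heisenberg

variable {n : ℕ}

/-- The horizontal vector with the same coordinates as the `x, y`-part of a point. -/
def hor : Point n →L[ℝ] HVec n := LinearMap.toContinuousLinearMap
  { toFun := fun p => WithLp.toLp 2 fun a => p (.inl a)
    map_add' := fun _ _ => rfl
    map_smul' := fun _ _ => rfl }

/-- The inclusion of `ℝ^{2n}` as the hyperplane `t = 0`. -/
def incl : HVec n →L[ℝ] Point n := LinearMap.toContinuousLinearMap
  { toFun := fun v => WithLp.toLp 2 (Sum.elim (fun a => v a) fun _ => 0)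
    map_add' := fun v w => by ext (a | a) <;> simp
    map_smul' := fun r v => by ext (a | a) <;> simp }

/-- The complex structure as a continuous linear map. -/
def JL : HVec n →L[ℝ] HVec n := LinearMap.toContinuousLinearMap
  { toFun := J
    map_add' := fun v w => by ext (a | a) <;> simp [J]; ring
    map_smul' := fun r v => by ext (a | a) <;> simp [J] }

@[simp] theorem hor_apply (p : Point n) (a : Fin n ⊕ Fin n) : hor p a = p (.inl a) := rfl
@[simp] theorem incl_inl (v : HVec n) (a : Fin n ⊕ Fin n) : incl v (.inl a) = v a := rfl
@[simp] theorem incl_inr (v : HVec n) (a : Unit) : incl v (.inr a) = 0 := rfl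
@[simp] theorem JL_apply (v : HVec n) : JL v = J v := rfl

theorem J_add (v w : HVec n) : J (v + w) = J v + J w := JL.map_add v w
theorem J_sub (v w : HVec n) : J (v - w) = J v - J w := JL.map_sub v w
theorem J_smul (r : ℝ) (v : HVec n) : J (r • v) = r • J v := JL.map_smul r v
theorem J_neg (v : HVec n) : J (-v) = -J v := JL.map_neg v

@[simp] theorem J_J (v : HVec n) : J (J v) = -v := by
  ext (a | a) <;> simp [J]

theorem inner_hvec (v w : HVec n) :
    ⟪v, w⟫ = ∑ j, v (.inl j) * w (.inl j) + ∑ j, v (.inr j) * w (.inr j) := by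
  simp [PiLp.inner_apply, mul_comm]

theorem inner_J_left (v w : HVec n) : ⟪J v, w⟫ = -⟪v, J w⟫ := by
  simp [inner_hvec, J, Finset.sum_neg_distrib]

@[simp] theorem inner_J_self (v : HVec n) : ⟪J v, v⟫ = 0 := by
  have h := inner_J_left v v
  rw [real_inner_comm v (J v)] at h ⊢
  linarith

@[simp] theorem inner_self_J (v : HVec n) : ⟪v, J v⟫ = 0 := by
  rw [real_inner_comm, inner_J_self]

@[simp] theorem inner_J_J (v w : HVec n) : ⟪J v, J w⟫ = ⟪v, w⟫ := by
  rw [inner_J_left, J_J, inner_neg_right, neg_neg]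

@[simp] theorem norm_J (v : HVec n) : ‖J v‖ = ‖v‖ := by
  rw [@norm_eq_sqrt_real_inner _ _ _ (J v), inner_J_J, ← norm_eq_sqrt_real_inner]

theorem inner_point (p q : Point n) : ⟪p, q⟫ = ⟪hor p, hor q⟫ + p (.inr ()) * q (.inr ()) := by
  simp [PiLp.inner_apply, mul_comm]

theorem inner_vertical (p : Point n) : ⟪p, vertical⟫ = p (.inr ()) := by
  simp [vertical, EuclideanSpace.inner_single_right]

@[simp] theorem hor_incl (v : HVec n) : hor (incl v) = v := rfl

@[simp] theorem hor_vertical : hor (vertical : Point n) = 0 := by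
  ext a; simp [vertical]

@[simp] theorem inner_incl_vertical (v : HVec n) : ⟪incl v, vertical⟫ = 0 := by
  simp [inner_vertical]

@[simp] theorem norm_vertical : ‖(vertical : Point n)‖ = 1 := by
  simp [vertical]

theorem inner_incl_right (p : Point n) (v : HVec n) : ⟪p, incl v⟫ = ⟪hor p, v⟫ := by
  simp [inner_point]

theorem lift_eq (p : Point n) (v : HVec n) : lift p v = incl v + ⟪J v, hor p⟫ • vertical := by
  ext (a | a)
  · simp [lift, vertical]
  · simp [lift, vertical, inner_hvec, J, Finset.sum_sub_distrib, Finset.sum_neg_distrib]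
    ring

@[simp] theorem hor_lift (p : Point n) (v : HVec n) : hor (lift p v) = v := by
  simp [lift_eq]

theorem lift_add (p : Point n) (v w : HVec n) : lift p (v + w) = lift p v + lift p w := by
  simp only [lift_eq, map_add, J_add, inner_add_left, add_smul]
  abel

theorem lift_smul (p : Point n) (r : ℝ) (v : HVec n) : lift p (r • v) = r • lift p v := by
  simp only [lift_eq, map_smul, J_smul, inner_smul_left, smul_add, smul_smul, conj_trivial]

theorem lift_sub (p : Point n) (v w : HVec n) : lift p (v - w) = lift p v - lift p w := by
  rw [sub_eq_add_neg, sub_eq_add_neg, lift_add, ← neg_one_smul ℝ w, lift_smul, neg_one_smul]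

/-- The adjoint of `lift p`. -/
def horPart (p w : Point n) : HVec n := hor w - ⟪w, vertical⟫ • J (hor p)

theorem inner_lift (p w : Point n) (v : HVec n) : ⟪w, lift p v⟫ = ⟪horPart p w, v⟫ := by
  have h : ⟪J (hor p), v⟫ = -⟪J v, hor p⟫ := by rw [inner_J_left, real_inner_comm]
  rw [lift_eq, horPart, inner_add_right, inner_incl_right, inner_smul_right, inner_sub_left,
    inner_smul_left, h, conj_trivial]
  ring

theorem horNormal_eq (η : Point n → Point n) (p : Point n) : horNormal η p = horPart p (η p) := by
  ext a
  simp [horNormal, inner_lift, EuclideanSpace.inner_single_right]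

theorem horPart_smul (p : Point n) (r : ℝ) (w : Point n) :
    horPart p (r • w) = r • horPart p w := by
  simp only [horPart, map_smul, inner_smul_left, conj_trivial, smul_sub, smul_smul]

/-- Right multiplication by a unit quaternion orthogonal to `1` and `i`: it anticommutes with the
complex structure. -/
def quatJ : HVec 2 →L[ℝ] HVec 2 := LinearMap.toContinuousLinearMap
  { toFun := fun v => WithLp.toLp 2 (Sum.elim ![-v (.inl 1), v (.inl 0)] ![v (.inr 1), -v (.inr 0)])
    map_add' := fun v w => by
      ext (a | a) <;> fin_cases a <;> simp <;> ring
    map_smul' := fun r v => by ext (a | a) <;> fin_cases a <;> simp }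

theorem quatJ_inl_zero (v : HVec 2) : quatJ v (.inl 0) = -v (.inl 1) := rfl
theorem quatJ_inl_one (v : HVec 2) : quatJ v (.inl 1) = v (.inl 0) := rfl
theorem quatJ_inr_zero (v : HVec 2) : quatJ v (.inr 0) = v (.inr 1) := rfl
theorem quatJ_inr_one (v : HVec 2) : quatJ v (.inr 1) = -v (.inr 0) := rfl

theorem quatJ_J (v : HVec 2) : quatJ (J v) = -J (quatJ v) := by
  ext (a | a) <;> fin_cases a <;>
    simp [J, quatJ_inl_zero, quatJ_inl_one, quatJ_inr_zero, quatJ_inr_one]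

@[simp] theorem quatJ_quatJ (v : HVec 2) : quatJ (quatJ v) = -v := by
  ext (a | a) <;> fin_cases a <;>
    simp [quatJ_inl_zero, quatJ_inl_one, quatJ_inr_zero, quatJ_inr_one]

theorem inner_quatJ_left (v w : HVec 2) : ⟪quatJ v, w⟫ = -⟪v, quatJ w⟫ := by
  simp only [inner_hvec, Fin.sum_univ_two, quatJ_inl_zero, quatJ_inl_one, quatJ_inr_zero,
    quatJ_inr_one]
  ring

@[simp] theorem inner_quatJ_quatJ (v w : HVec 2) : ⟪quatJ v, quatJ w⟫ = ⟪v, w⟫ := by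
  rw [inner_quatJ_left, quatJ_quatJ, inner_neg_right, neg_neg]

@[simp] theorem norm_quatJ (v : HVec 2) : ‖quatJ v‖ = ‖v‖ := by
  rw [@norm_eq_sqrt_real_inner _ _ _ (quatJ v), inner_quatJ_quatJ, ← norm_eq_sqrt_real_inner]

@[simp] theorem inner_self_quatJ (v : HVec 2) : ⟪v, quatJ v⟫ = 0 := by
  have h := inner_quatJ_left v v
  rw [real_inner_comm v (quatJ v)] at h
  linarith

@[simp] theorem inner_quatJ_self (v : HVec 2) : ⟪quatJ v, v⟫ = 0 := by
  rw [real_inner_comm, inner_self_quatJ]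

@[simp] theorem inner_J_quatJ (v : HVec 2) : ⟪J v, quatJ v⟫ = 0 := by
  simp only [inner_hvec, Fin.sum_univ_two, quatJ_inl_zero, quatJ_inl_one, quatJ_inr_zero,
    quatJ_inr_one, J, Sum.elim_inl, Sum.elim_inr]
  ring

@[simp] theorem inner_quatJ_J (v : HVec 2) : ⟪quatJ v, J v⟫ = 0 := by
  rw [real_inner_comm, inner_J_quatJ]

@[simp] theorem inner_self_J_quatJ (v : HVec 2) : ⟪v, J (quatJ v)⟫ = 0 := by
  rw [real_inner_comm, inner_J_left, inner_quatJ_J, neg_zero]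

@[simp] theorem inner_J_quatJ_self (v : HVec 2) : ⟪J (quatJ v), v⟫ = 0 := by
  rw [real_inner_comm, inner_self_J_quatJ]

/-- A unit vector of `ℝ⁴` and its products with the quaternion units form an orthonormal basis. -/
theorem eq_sum_quaternion_frame {ν : HVec 2} (hν : ‖ν‖ = 1) (v : HVec 2) :
    v = ⟪ν, v⟫ • ν + ⟪J ν, v⟫ • J ν + ⟪quatJ ν, v⟫ • quatJ ν +
      ⟪J (quatJ ν), v⟫ • J (quatJ ν) := by
  have h : ⟪ν, ν⟫ = 1 := by rw [real_inner_self_eq_norm_sq, hν]; norm_num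
  rw [inner_hvec] at h
  conv_lhs => rw [← one_smul ℝ v, ← h]
  ext (a | a) <;> fin_cases a <;>
    simp [inner_hvec, Fin.sum_univ_two, quatJ_inl_zero, quatJ_inl_one, quatJ_inr_zero,
      quatJ_inr_one, J] <;> ring

end Heisenberg

/-! ### Tangential derivatives and regularity in graph charts -/

namespace Heisenberg

variable {n : ℕ} {S : Set (Point n)} {η : Point n → Point n}

theorem horNormal_smul_nu (hnc : IsNonCharacteristic S η) {p : Point n} (hp : p ∈ S) :
    horNormal η p = ‖horNormal η p‖ • nu η p := by
  have h : ‖horNormal η p‖ ≠ 0 := norm_ne_zero_iff.2 (hnc p hp)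
  rw [nu, smul_smul, mul_inv_cancel₀ h, one_smul]

theorem norm_nu (hnc : IsNonCharacteristic S η) {p : Point n} (hp : p ∈ S) : ‖nu η p‖ = 1 :=
  norm_smul_inv_norm (hnc p hp)

/-- A horizontal vector orthogonal to `ν` is tangent. -/
theorem inner_lift_eq_zero (hnc : IsNonCharacteristic S η) {p : Point n} (hp : p ∈ S) {v : HVec n}
    (hv : ⟪nu η p, v⟫ = 0) : ⟪η p, lift p v⟫ = 0 := by
  rw [inner_lift, ← horNormal_eq, horNormal_smul_nu hnc hp, inner_smul_left, hv, mul_zero]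

theorem inner_eq_nu_alpha (hnc : IsNonCharacteristic S η) {p : Point n} (hp : p ∈ S) (v : HVec n)
    (r : ℝ) : ⟪η p, lift p v + r • vertical⟫ =
      ‖horNormal η p‖ * (⟪nu η p, v⟫ + r * alpha η p) := by
  have h : ‖horNormal η p‖ ≠ 0 := norm_ne_zero_iff.2 (hnc p hp)
  rw [inner_add_right, inner_lift, ← horNormal_eq, inner_smul_right, alpha]
  conv_lhs => rw [horNormal_smul_nu hnc hp, inner_smul_left]
  simp only [conj_trivial]
  field_simp

/-- Tangency in terms of `ν` and `α`. -/
theorem inner_eq_zero_iff (hnc : IsNonCharacteristic S η) {p : Point n} (hp : p ∈ S) (v : HVec n)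
    (r : ℝ) : ⟪η p, lift p v + r • vertical⟫ = 0 ↔ ⟪nu η p, v⟫ + r * alpha η p = 0 := by
  rw [inner_eq_nu_alpha hnc hp, mul_eq_zero, or_iff_right (norm_ne_zero_iff.2 (hnc p hp))]

namespace GraphChart

variable (c : GraphChart S η)

/-- The parametrization of `S ∩ U`. -/
def Γ (u : EuclideanSpace ℝ (Fin (2 * n))) : Point n := c.L u + c.g u • c.e

/-- The differential of the parametrization. -/
def Γ' (u : EuclideanSpace ℝ (Fin (2 * n))) : EuclideanSpace ℝ (Fin (2 * n)) →L[ℝ] Point n :=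
  c.L.toContinuousLinearMap + (fderiv ℝ c.g u).smulRight c.e

/-- A multiple of the normal field. -/
def N (u : EuclideanSpace ℝ (Fin (2 * n))) : Point n := c.e - c.L (gradient c.g u)

theorem π_Γ (u : EuclideanSpace ℝ (Fin (2 * n))) : c.π (c.Γ u) = u := by
  simp [Γ, c.π_L, c.π_e]

theorem π_Γ' (u v : EuclideanSpace ℝ (Fin (2 * n))) : c.π (c.Γ' u v) = v := by
  simp [Γ', c.π_L, c.π_e]

variable {c}

theorem Γ_mem {u : EuclideanSpace ℝ (Fin (2 * n))} (hu : u ∈ c.Ω) : c.Γ u ∈ S ∩ c.U := by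
  rw [c.inter_eq]; exact ⟨u, hu, rfl⟩

theorem exists_eq_Γ {p : Point n} (hp : p ∈ S) (hpU : p ∈ c.U) : ∃ u ∈ c.Ω, c.Γ u = p := by
  have : p ∈ S ∩ c.U := ⟨hp, hpU⟩
  rw [c.inter_eq] at this
  exact this

theorem contDiffOn_Γ : ContDiffOn ℝ 5 c.Γ c.Ω :=
  c.L.contDiff.contDiffOn.add (c.contDiffOn_g.smul contDiffOn_const)

theorem hasFDerivAt_g {u : EuclideanSpace ℝ (Fin (2 * n))} (hu : u ∈ c.Ω) :
    HasFDerivAt c.g (fderiv ℝ c.g u) u :=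
  ((c.contDiffOn_g.contDiffAt (c.isOpen_Ω.mem_nhds hu)).differentiableAt (by norm_num)).hasFDerivAt

theorem hasFDerivAt_Γ {u : EuclideanSpace ℝ (Fin (2 * n))} (hu : u ∈ c.Ω) :
    HasFDerivAt c.Γ (c.Γ' u) u :=
  c.L.toContinuousLinearMap.hasFDerivAt.add ((hasFDerivAt_g hu).smul_const c.e)

theorem contDiffOn_gradient : ContDiffOn ℝ 4 (gradient c.g) c.Ω := by
  have h : ContDiffOn ℝ 4 (fderiv ℝ c.g) c.Ω :=
    c.contDiffOn_g.fderiv_of_isOpen c.isOpen_Ω (by norm_num)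
  exact (InnerProductSpace.toDual ℝ _).symm.contDiff.comp_contDiffOn h

theorem contDiffOn_N : ContDiffOn ℝ 4 c.N c.Ω :=
  contDiffOn_const.sub (c.L.contDiff.comp_contDiffOn contDiffOn_gradient)

theorem normal_eq {u : EuclideanSpace ℝ (Fin (2 * n))} (hu : u ∈ c.Ω) :
    η (c.Γ u) = (c.s / √(1 + ‖gradient c.g u‖ ^ 2)) • c.N u := c.normal u hu

theorem s_ne_zero : c.s ≠ 0 := fun h => by simpa [h] using c.s_sq

theorem scale_ne_zero (u : EuclideanSpace ℝ (Fin (2 * n))) :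
    c.s / √(1 + ‖gradient c.g u‖ ^ 2) ≠ 0 :=
  div_ne_zero s_ne_zero (by positivity)

theorem inner_N_Γ' (u v : EuclideanSpace ℝ (Fin (2 * n))) : ⟪c.N u, c.Γ' u v⟫ = 0 := by
  have h : ⟪c.L (gradient c.g u), c.e⟫ = 0 := by rw [real_inner_comm, c.inner_e_L]
  simp [N, Γ', inner_sub_left, inner_add_right, c.inner_e_L, inner_smul_right, h,
    c.norm_e]

/-- Tangent vectors are images of vectors in the parameter space. -/
theorem eq_Γ'_π {u : EuclideanSpace ℝ (Fin (2 * n))} (hu : u ∈ c.Ω) {w : Point n}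
    (hw : ⟪η (c.Γ u), w⟫ = 0) : w = c.Γ' u (c.π w) := by
  rw [normal_eq hu, inner_smul_left] at hw
  have h1 : ⟪c.N u, w⟫ = 0 := (mul_eq_zero.1 hw).resolve_left (scale_ne_zero u)
  have h2 : ⟪c.L (gradient c.g u), w⟫ = ⟪gradient c.g u, c.π w⟫ := by
    conv_lhs => rw [c.decomp w]
    rw [inner_add_right, c.L.inner_map_map, inner_smul_right, real_inner_comm c.e,
      c.inner_e_L]
    simp
  rw [N, inner_sub_left, h2, inner_gradient_left] at h1
  conv_lhs => rw [c.decomp w]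
  simp [Γ', sub_eq_zero.1 h1]

theorem inner_η_Γ' {u : EuclideanSpace ℝ (Fin (2 * n))} (hu : u ∈ c.Ω)
    (v : EuclideanSpace ℝ (Fin (2 * n))) : ⟪η (c.Γ u), c.Γ' u v⟫ = 0 := by
  rw [normal_eq hu, inner_smul_left, inner_N_Γ', mul_zero]

variable {F : Type*} [NormedAddCommGroup F] [NormedSpace ℝ F]

theorem hasFDerivAt_comp_Γ {u : EuclideanSpace ℝ (Fin (2 * n))} (hu : u ∈ c.Ω) {φ : Point n → F}
    {φ' : Point n →L[ℝ] F} (h : HasFDerivWithinAt φ φ' S (c.Γ u)) :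
    HasFDerivAt (φ ∘ c.Γ) (φ'.comp (c.Γ' u)) u := by
  have h1 : HasFDerivWithinAt (φ ∘ c.Γ) (φ'.comp (c.Γ' u)) c.Ω u :=
    h.comp u (hasFDerivAt_Γ hu).hasFDerivWithinAt fun v hv => (Γ_mem hv).1
  exact h1.hasFDerivAt (c.isOpen_Ω.mem_nhds hu)

theorem contDiffOn_comp_Γ {φ : Point n → F} {k : WithTop ℕ∞} (hk : k ≤ 5)
    (h : ContDiffOn ℝ k φ S) : ContDiffOn ℝ k (φ ∘ c.Γ) c.Ω :=
  h.comp (contDiffOn_Γ.of_le hk) fun _ hv => (Γ_mem hv).1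

theorem contDiffOn_of_comp_Γ {φ : Point n → F} {k : WithTop ℕ∞}
    (h : ContDiffOn ℝ k (φ ∘ c.Γ) c.Ω) : ContDiffOn ℝ k φ (S ∩ c.U) := by
  have h1 : ContDiffOn ℝ k ((φ ∘ c.Γ) ∘ c.π) (S ∩ c.U) := by
    refine h.comp c.π.contDiff.contDiffOn fun p hp => ?_
    obtain ⟨u, hu, rfl⟩ := exists_eq_Γ hp.1 hp.2
    rwa [π_Γ]
  refine h1.congr fun p hp => ?_
  obtain ⟨u, hu, rfl⟩ := exists_eq_Γ hp.1 hp.2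
  simp [π_Γ]

end GraphChart

variable {F : Type*} [NormedAddCommGroup F] [NormedSpace ℝ F]

/-- Regularity on `S` can be checked in graph charts. -/
theorem contDiffOn_of_forall_chart (hS : IsHypersurface S) (hη : IsUnitNormal S η)
    {φ : Point n → F} {k : WithTop ℕ∞}
    (h : ∀ c : GraphChart S η, ContDiffOn ℝ k (φ ∘ c.Γ) c.Ω) : ContDiffOn ℝ k φ S := by
  intro p hp
  obtain ⟨c, hc⟩ := exists_graphChart hS hη hp
  exact (contDiffWithinAt_inter (c.isOpen_U.mem_nhds hc)).1
    (GraphChart.contDiffOn_of_comp_Γ (h c) p ⟨hp, hc⟩)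

/-- The derivative along `S` of a function on `S` is determined on tangent vectors. -/
theorem fderivWithin_apply_of_tangent (hS : IsHypersurface S) (hη : IsUnitNormal S η)
    {φ : Point n → F} {φ' : Point n →L[ℝ] F} {p : Point n} (hp : p ∈ S)
    (h : HasFDerivWithinAt φ φ' S p) {w : Point n} (hw : ⟪η p, w⟫ = 0) :
    fderivWithin ℝ φ S p w = φ' w := by
  obtain ⟨c, hc⟩ := exists_graphChart hS hη hp
  obtain ⟨u, hu, rfl⟩ := GraphChart.exists_eq_Γ hp hc
  -- A hypersurface is not a set of unique differentiability, so two derivatives within S may differ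
  -- in the normal direction. Composed with Γ they become ordinary derivatives on an open set and
  -- agree, and the image of Γ' is the tangent space.
  have h1 := GraphChart.hasFDerivAt_comp_Γ hu h
  have h2 := GraphChart.hasFDerivAt_comp_Γ hu h.differentiableWithinAt.hasFDerivWithinAt
  have h3 := congrArg (fun A => A (c.π w)) (h2.unique h1)
  simp only [ContinuousLinearMap.comp_apply] at h3
  rwa [← GraphChart.eq_Γ'_π hu hw] at h3

namespace GraphChart

variable {c : GraphChart S η}

theorem fderivWithin_Γ' {u : EuclideanSpace ℝ (Fin (2 * n))} (hu : u ∈ c.Ω) {φ : Point n → F}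
    (h : DifferentiableWithinAt ℝ φ S (c.Γ u)) (v : EuclideanSpace ℝ (Fin (2 * n))) :
    fderivWithin ℝ φ S (c.Γ u) (c.Γ' u v) = fderiv ℝ (φ ∘ c.Γ) u v := by
  rw [(hasFDerivAt_comp_Γ hu h.hasFDerivWithinAt).fderiv]
  rfl

theorem fderivWithin_tangent {u : EuclideanSpace ℝ (Fin (2 * n))} (hu : u ∈ c.Ω) {φ : Point n → F}
    (h : DifferentiableWithinAt ℝ φ S (c.Γ u)) {w : Point n} (hw : ⟪η (c.Γ u), w⟫ = 0) :
    fderivWithin ℝ φ S (c.Γ u) w = fderiv ℝ (φ ∘ c.Γ) u (c.π w) := by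
  rw [← fderivWithin_Γ' hu h, ← eq_Γ'_π hu hw]

variable (c) in
/-- The horizontal part of the multiple `N` of the normal. -/
def hN (u : EuclideanSpace ℝ (Fin (2 * n))) : HVec n := horPart (c.Γ u) (c.N u)

theorem contDiffOn_hN : ContDiffOn ℝ 4 c.hN c.Ω := by
  refine (hor.contDiff.comp_contDiffOn contDiffOn_N).sub ?_
  refine (contDiffOn_N.inner ℝ contDiffOn_const).smul ?_
  exact (JL.comp hor).contDiff.comp_contDiffOn (contDiffOn_Γ.of_le (by norm_num))

theorem horNormal_Γ {u : EuclideanSpace ℝ (Fin (2 * n))} (hu : u ∈ c.Ω) :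
    horNormal η (c.Γ u) = (c.s / √(1 + ‖gradient c.g u‖ ^ 2)) • c.hN u := by
  rw [horNormal_eq, normal_eq hu, horPart_smul, hN]

theorem hN_ne_zero (hnc : IsNonCharacteristic S η) {u : EuclideanSpace ℝ (Fin (2 * n))}
    (hu : u ∈ c.Ω) : c.hN u ≠ 0 := by
  intro h
  apply hnc _ (Γ_mem hu).1
  rw [horNormal_Γ hu, h, smul_zero]

variable (c) in
theorem abs_s : |c.s| = 1 := by
  rw [← sq_eq_sq₀ (abs_nonneg _) zero_le_one, sq_abs, c.s_sq, one_pow]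

theorem norm_horNormal_Γ {u : EuclideanSpace ℝ (Fin (2 * n))} (hu : u ∈ c.Ω) :
    ‖horNormal η (c.Γ u)‖ = ‖c.hN u‖ / √(1 + ‖gradient c.g u‖ ^ 2) := by
  rw [horNormal_Γ hu, norm_smul, Real.norm_eq_abs, abs_div, abs_s, abs_of_nonneg (Real.sqrt_nonneg _)]
  ring

theorem nu_Γ {u : EuclideanSpace ℝ (Fin (2 * n))} (hu : u ∈ c.Ω) :
    nu η (c.Γ u) = (c.s * ‖c.hN u‖⁻¹) • c.hN u := by
  have : √(1 + ‖gradient c.g u‖ ^ 2) ≠ 0 := by positivity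
  rw [nu, norm_horNormal_Γ hu, horNormal_Γ hu, smul_smul]
  congr 1
  field_simp

theorem alpha_Γ {u : EuclideanSpace ℝ (Fin (2 * n))} (hu : u ∈ c.Ω) :
    alpha η (c.Γ u) = c.s * ‖c.hN u‖⁻¹ * ⟪c.N u, vertical⟫ := by
  have : √(1 + ‖gradient c.g u‖ ^ 2) ≠ 0 := by positivity
  rw [alpha, norm_horNormal_Γ hu, normal_eq hu, inner_smul_left, conj_trivial]
  field_simp

theorem contDiffOn_norm_hN_inv (hnc : IsNonCharacteristic S η) :
    ContDiffOn ℝ 4 (fun u => c.s * ‖c.hN u‖⁻¹) c.Ω :=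
  contDiffOn_const.mul ((contDiffOn_hN.norm ℝ fun _ hu => hN_ne_zero hnc hu).inv fun _ hu =>
    norm_ne_zero_iff.2 (hN_ne_zero hnc hu))

end GraphChart

theorem contDiffOn_nu (hS : IsHypersurface S) (hη : IsUnitNormal S η)
    (hnc : IsNonCharacteristic S η) : ContDiffOn ℝ 4 (nu η) S := by
  refine contDiffOn_of_forall_chart hS hη fun c => ?_
  exact ((GraphChart.contDiffOn_norm_hN_inv hnc).smul GraphChart.contDiffOn_hN).congr fun u hu =>
    GraphChart.nu_Γ hu

theorem contDiffOn_alpha (hS : IsHypersurface S) (hη : IsUnitNormal S η)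
    (hnc : IsNonCharacteristic S η) : ContDiffOn ℝ 4 (alpha η) S := by
  refine contDiffOn_of_forall_chart hS hη fun c => ?_
  exact ((GraphChart.contDiffOn_norm_hN_inv hnc).mul
    (GraphChart.contDiffOn_N.inner ℝ contDiffOn_const)).congr fun u hu => GraphChart.alpha_Γ hu

/-- The derivative of a function on `S` along a horizontal field. -/
def dirDeriv (S : Set (Point n)) (φ : Point n → F) (X : Point n → HVec n) (p : Point n) : F :=
  fderivWithin ℝ φ S p (lift p (X p))

theorem ContDiffOn.lift_comp {X : Point n → HVec n} {k : WithTop ℕ∞} {s : Set (Point n)}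
    (h : ContDiffOn ℝ k X s) : ContDiffOn ℝ k (fun p => lift p (X p)) s := by
  simp only [lift_eq]
  exact (incl.contDiff.comp_contDiffOn h).add
    (((JL.contDiff.comp_contDiffOn h).inner ℝ hor.contDiff.contDiffOn).smul contDiffOn_const)

/-- `fderivWithin` itself involves an arbitrary choice transversally to S and need not vary
continuously. Along a tangent field it equals the derivative of φ ∘ Γ applied to the field in the
chart, at the cost of one order of smoothness. -/
theorem contDiffOn_dirDeriv (hS : IsHypersurface S) (hη : IsUnitNormal S η)
    (hnc : IsNonCharacteristic S η) {φ : Point n → F} {X : Point n → HVec n} {k : WithTop ℕ∞}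
    (hk : k + 1 ≤ 5) (hφ : ContDiffOn ℝ (k + 1) φ S) (hX : ContDiffOn ℝ k X S)
    (hXν : ∀ p ∈ S, ⟪nu η p, X p⟫ = 0) : ContDiffOn ℝ k (dirDeriv S φ X) S := by
  refine contDiffOn_of_forall_chart hS hη fun c => ?_
  have h1 : ContDiffOn ℝ k (fderiv ℝ (φ ∘ c.Γ)) c.Ω :=
    (GraphChart.contDiffOn_comp_Γ hk hφ).fderiv_of_isOpen c.isOpen_Ω le_rfl
  have h2 : ContDiffOn ℝ k (fun u => c.π (lift (c.Γ u) (X (c.Γ u)))) c.Ω :=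
    c.π.contDiff.comp_contDiffOn
      (GraphChart.contDiffOn_comp_Γ (le_trans le_self_add hk) (ContDiffOn.lift_comp hX))
  refine (h1.clm_apply h2).congr fun u hu => ?_
  have hp := (GraphChart.Γ_mem hu).1
  exact GraphChart.fderivWithin_tangent hu ((hφ.differentiableOn (by simp)) _ hp)
    (inner_lift_eq_zero hnc hp (hXν _ hp))

end Heisenberg

/-! ### Brackets of horizontal tangent fields -/

namespace Heisenberg

variable {n : ℕ} {S : Set (Point n)} {η : Point n → Point n}
variable {F : Type*} [NormedAddCommGroup F] [NormedSpace ℝ F]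

/-- The vertical term comes from the dependence of the left-invariant frame on the base point. It is
the source of the T-component of brackets. -/
theorem fderiv_lift_apply {H : Type*} [NormedAddCommGroup H] [NormedSpace ℝ H] {G : H → Point n}
    {X : H → HVec n} {G' : H →L[ℝ] Point n} {X' : H →L[ℝ] HVec n} {u : H}
    (hG : HasFDerivAt G G' u) (hX : HasFDerivAt X X' u) (v : H) :
    fderiv ℝ (fun w => lift (G w) (X w)) u v =
      lift (G u) (X' v) + ⟪J (X u), hor (G' v)⟫ • vertical := by
  have h := (incl.hasFDerivAt.comp u hX).add
    (((JL.hasFDerivAt.comp u hX).inner ℝ (hor.hasFDerivAt.comp u hG)).smul_const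
      (vertical : Point n))
  have h' : HasFDerivAt (fun w => lift (G w) (X w)) _ u :=
    h.congr_of_eventuallyEq (.of_forall fun w => lift_eq _ _)
  rw [h'.fderiv]
  simp [lift_eq]
  module

namespace GraphChart

variable {c : GraphChart S η}

variable (c) in
/-- A horizontal field on `S` in the chart. -/
def pull (Z : Point n → HVec n) (v : EuclideanSpace ℝ (Fin (2 * n))) :
    EuclideanSpace ℝ (Fin (2 * n)) := c.π (lift (c.Γ v) (Z (c.Γ v)))

theorem Γ'_pull (hnc : IsNonCharacteristic S η) {Z : Point n → HVec n}
    (hZν : ∀ p ∈ S, ⟪nu η p, Z p⟫ = 0) {v : EuclideanSpace ℝ (Fin (2 * n))} (hv : v ∈ c.Ω) :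
    c.Γ' v (c.pull Z v) = lift (c.Γ v) (Z (c.Γ v)) :=
  (eq_Γ'_π hv (inner_lift_eq_zero hnc (Γ_mem hv).1 (hZν _ (Γ_mem hv).1))).symm

theorem hasFDerivAt_lift_comp {Z : Point n → HVec n} (hZ : ContDiffOn ℝ 1 Z S)
    {u : EuclideanSpace ℝ (Fin (2 * n))} (hu : u ∈ c.Ω) :
    HasFDerivAt (fun v => lift (c.Γ v) (Z (c.Γ v)))
      (fderiv ℝ (fun v => lift (c.Γ v) (Z (c.Γ v))) u) u := by
  have h1 : ContDiffOn ℝ 1 (fun v => lift (c.Γ v) (Z (c.Γ v))) c.Ω :=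
    contDiffOn_comp_Γ (c := c) (by norm_num) (ContDiffOn.lift_comp hZ)
  exact ((h1.contDiffAt (c.isOpen_Ω.mem_nhds hu)).differentiableAt one_ne_zero).hasFDerivAt

theorem hasFDerivAt_pull {Z : Point n → HVec n} (hZ : ContDiffOn ℝ 1 Z S)
    {u : EuclideanSpace ℝ (Fin (2 * n))} (hu : u ∈ c.Ω) :
    HasFDerivAt (c.pull Z) (fderiv ℝ (c.pull Z) u) u :=
  (c.π.hasFDerivAt.comp u (hasFDerivAt_lift_comp hZ hu)).differentiableAt.hasFDerivAt

theorem contDiffOn_Γ' : ContDiffOn ℝ 4 c.Γ' c.Ω :=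
  contDiffOn_const.add
    ((c.contDiffOn_g.fderiv_of_isOpen c.isOpen_Ω (by norm_num)).smulRight contDiffOn_const)

theorem fderiv_Γ'_comm {u : EuclideanSpace ℝ (Fin (2 * n))} (hu : u ∈ c.Ω)
    (v w : EuclideanSpace ℝ (Fin (2 * n))) : fderiv ℝ c.Γ' u v w = fderiv ℝ c.Γ' u w v := by
  have hΩ := c.isOpen_Ω.mem_nhds hu
  have h1 : ContDiffAt ℝ 2 c.Γ u := (contDiffOn_Γ.of_le (by norm_num)).contDiffAt hΩ
  have h2 : fderiv ℝ c.Γ =ᶠ[nhds u] c.Γ' := by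
    filter_upwards [hΩ] with v hv using (hasFDerivAt_Γ hv).fderiv
  rw [← h2.fderiv_eq]
  exact (h1.isSymmSndFDerivAt (by simp)).eq v w

/-- This is the derivative of the identity `Γ'_pull` in the direction w. Antisymmetrizing over two
fields removes the second derivative of Γ and leaves the bracket. -/
theorem fderiv_Γ'_pull (hnc : IsNonCharacteristic S η) {Z : Point n → HVec n}
    (hZ : ContDiffOn ℝ 1 Z S) (hZν : ∀ p ∈ S, ⟪nu η p, Z p⟫ = 0)
    {u : EuclideanSpace ℝ (Fin (2 * n))} (hu : u ∈ c.Ω) (w : EuclideanSpace ℝ (Fin (2 * n))) :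
    fderiv ℝ c.Γ' u w (c.pull Z u) + c.Γ' u (fderiv ℝ (c.pull Z) u w) =
      lift (c.Γ u) (fderivWithin ℝ Z S (c.Γ u) (c.Γ' u w)) +
        ⟪J (Z (c.Γ u)), hor (c.Γ' u w)⟫ • vertical := by
  have hΩ := c.isOpen_Ω.mem_nhds hu
  have h4 := ((contDiffOn_Γ'.contDiffAt hΩ).differentiableAt (by norm_num)).hasFDerivAt
  have h5 := h4.clm_apply (hasFDerivAt_pull hZ hu)
  have h6 : (fun v => c.Γ' v (c.pull Z v)) =ᶠ[nhds u] fun v => lift (c.Γ v) (Z (c.Γ v)) := by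
    filter_upwards [hΩ] with v hv using Γ'_pull hnc hZν hv
  have h7 := congrArg (fun A => A w)
    ((h5.congr_of_eventuallyEq h6.symm).unique (hasFDerivAt_lift_comp hZ hu))
  have h8 := fderiv_lift_apply (X := fun v => Z (c.Γ v)) (hasFDerivAt_Γ hu) (hasFDerivAt_comp_Γ hu
    ((hZ.differentiableOn one_ne_zero) _ (Γ_mem hu).1).hasFDerivWithinAt) w
  refine Eq.trans ?_ (h7.trans h8)
  simp [add_comm]

/-- The bracket of two horizontal fields tangent to `S`. -/
theorem Γ'_bracket (hnc : IsNonCharacteristic S η) {X Y : Point n → HVec n}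
    (hX : ContDiffOn ℝ 1 X S) (hY : ContDiffOn ℝ 1 Y S)
    (hXν : ∀ p ∈ S, ⟪nu η p, X p⟫ = 0) (hYν : ∀ p ∈ S, ⟪nu η p, Y p⟫ = 0)
    {u : EuclideanSpace ℝ (Fin (2 * n))} (hu : u ∈ c.Ω) :
    c.Γ' u (fderiv ℝ (c.pull Y) u (c.pull X u) - fderiv ℝ (c.pull X) u (c.pull Y u)) =
      lift (c.Γ u) (fderivWithin ℝ Y S (c.Γ u) (lift (c.Γ u) (X (c.Γ u))) -
        fderivWithin ℝ X S (c.Γ u) (lift (c.Γ u) (Y (c.Γ u)))) +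
        (-2 * ⟪J (X (c.Γ u)), Y (c.Γ u)⟫) • vertical := by
  have h1 := fderiv_Γ'_pull hnc hY hYν hu (c.pull X u)
  have h2 := fderiv_Γ'_pull hnc hX hXν hu (c.pull Y u)
  rw [Γ'_pull hnc hXν hu, hor_lift] at h1
  rw [Γ'_pull hnc hYν hu, hor_lift] at h2
  rw [fderiv_Γ'_comm hu] at h1
  have h3 : ⟪J (Y (c.Γ u)), X (c.Γ u)⟫ = -⟪J (X (c.Γ u)), Y (c.Γ u)⟫ := by
    rw [inner_J_left, real_inner_comm]
  rw [h3] at h1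
  rw [map_sub, lift_sub, eq_sub_of_add_eq' h1, eq_sub_of_add_eq' h2]
  module

theorem fderivWithin_dirDeriv_Γ' (hS : IsHypersurface S) (hη : IsUnitNormal S η)
    (hnc : IsNonCharacteristic S η) {φ : Point n → F} {Z : Point n → HVec n}
    (hφ : ContDiffOn ℝ 2 φ S) (hZ : ContDiffOn ℝ 1 Z S) (hZν : ∀ p ∈ S, ⟪nu η p, Z p⟫ = 0)
    {u : EuclideanSpace ℝ (Fin (2 * n))} (hu : u ∈ c.Ω) (w : EuclideanSpace ℝ (Fin (2 * n))) :
    fderivWithin ℝ (dirDeriv S φ Z) S (c.Γ u) (c.Γ' u w) =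
      fderiv ℝ (fderiv ℝ (φ ∘ c.Γ)) u w (c.pull Z u) +
      fderiv ℝ (φ ∘ c.Γ) u (fderiv ℝ (c.pull Z) u w) := by
  have hΩ := c.isOpen_Ω.mem_nhds hu
  have h1 : ContDiffOn ℝ 1 (dirDeriv S φ Z) S :=
    contDiffOn_dirDeriv hS hη hnc (by norm_num) (by simpa [one_add_one_eq_two] using hφ) hZ hZν
  rw [fderivWithin_Γ' hu (h1.differentiableOn one_ne_zero _ (Γ_mem hu).1)]
  have h2 : dirDeriv S φ Z ∘ c.Γ =ᶠ[nhds u] fun v => fderiv ℝ (φ ∘ c.Γ) v (c.pull Z v) := by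
    filter_upwards [hΩ] with v hv
    exact fderivWithin_tangent hv (hφ.differentiableOn (by norm_num) _ (Γ_mem hv).1)
      (inner_lift_eq_zero hnc (Γ_mem hv).1 (hZν _ (Γ_mem hv).1))
  have h3 : ContDiffOn ℝ 1 (fderiv ℝ (φ ∘ c.Γ)) c.Ω :=
    (contDiffOn_comp_Γ (by norm_num) hφ).fderiv_of_isOpen c.isOpen_Ω (by norm_num)
  have h4 := ((h3.contDiffAt hΩ).differentiableAt one_ne_zero).hasFDerivAt.clm_apply
    (hasFDerivAt_pull hZ hu)
  rw [h2.fderiv_eq, h4.fderiv]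
  simp [add_comm]

end GraphChart

/-- The commutator of two derivatives along horizontal tangent fields: with the bracket
`[X, Y] = ∇_X Y - ∇_Y X - 2 ⟨J X, Y⟩ T`, which is tangent. -/
theorem dirDeriv_comm (hS : IsHypersurface S) (hη : IsUnitNormal S η)
    (hnc : IsNonCharacteristic S η) {φ : Point n → F} {X Y : Point n → HVec n}
    (hφ : ContDiffOn ℝ 2 φ S) (hX : ContDiffOn ℝ 1 X S) (hY : ContDiffOn ℝ 1 Y S)
    (hXν : ∀ p ∈ S, ⟪nu η p, X p⟫ = 0) (hYν : ∀ p ∈ S, ⟪nu η p, Y p⟫ = 0) {p : Point n}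
    (hp : p ∈ S) :
    dirDeriv S (dirDeriv S φ Y) X p - dirDeriv S (dirDeriv S φ X) Y p =
      fderivWithin ℝ φ S p (lift p (dirDeriv S Y X p - dirDeriv S X Y p) +
        (-2 * ⟪J (X p), Y p⟫) • vertical) := by
  obtain ⟨c, hc⟩ := exists_graphChart hS hη hp
  obtain ⟨u, hu, rfl⟩ := GraphChart.exists_eq_Γ hp hc
  -- In the chart both iterated derivatives contain the same Hessian term of φ ∘ Γ. Its symmetry
  -- leaves only the derivative of φ along the bracket.
  have hsymm := ((GraphChart.contDiffOn_comp_Γ (c := c) (by norm_num) hφ).contDiffAt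
    (c.isOpen_Ω.mem_nhds hu)).isSymmSndFDerivAt (by simp)
  rw [dirDeriv, dirDeriv, dirDeriv, dirDeriv, ← GraphChart.Γ'_bracket hnc hX hY hXν hYν hu,
    GraphChart.fderivWithin_Γ' hu (hφ.differentiableOn (by norm_num) _ hp),
    ← GraphChart.Γ'_pull hnc hXν hu, ← GraphChart.Γ'_pull hnc hYν hu,
    GraphChart.fderivWithin_dirDeriv_Γ' hS hη hnc hφ hY hYν hu,
    GraphChart.fderivWithin_dirDeriv_Γ' hS hη hnc hφ hX hXν hu, map_sub, hsymm.eq]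
  abel

/-- The bracket of horizontal tangent fields is tangent. -/
theorem inner_bracket (hS : IsHypersurface S) (hη : IsUnitNormal S η)
    (hnc : IsNonCharacteristic S η) {X Y : Point n → HVec n}
    (hX : ContDiffOn ℝ 1 X S) (hY : ContDiffOn ℝ 1 Y S)
    (hXν : ∀ p ∈ S, ⟪nu η p, X p⟫ = 0) (hYν : ∀ p ∈ S, ⟪nu η p, Y p⟫ = 0) {p : Point n}
    (hp : p ∈ S) :
    ⟪nu η p, dirDeriv S Y X p - dirDeriv S X Y p⟫ + -2 * ⟪J (X p), Y p⟫ * alpha η p = 0 := by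
  obtain ⟨c, hc⟩ := exists_graphChart hS hη hp
  obtain ⟨u, hu, rfl⟩ := GraphChart.exists_eq_Γ hp hc
  rw [← inner_eq_zero_iff hnc hp, dirDeriv, dirDeriv,
    ← GraphChart.Γ'_bracket hnc hX hY hXν hYν hu]
  exact GraphChart.inner_η_Γ' hu _

end Heisenberg

/-! ### The quaternionic frame and differentiation along it -/

namespace Heisenberg

/-- The orthonormal basis `ν, Jν, ν𝐣, Jν𝐣` of the horizontal space. -/
def quatBasis (ν : HVec 2) (hν : ‖ν‖ = 1) : OrthonormalBasis (Fin 4) ℝ (HVec 2) :=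
  OrthonormalBasis.mk (v := ![ν, J ν, quatJ ν, J (quatJ ν)])
    (by
      rw [orthonormal_iff_ite]
      intro i j
      fin_cases i <;> fin_cases j <;> simp [hν])
    (by
      intro v _
      rw [eq_sum_quaternion_frame hν v]
      refine add_mem (add_mem (add_mem ?_ ?_) ?_) ?_ <;>
        refine Submodule.smul_mem _ _ (Submodule.subset_span ?_)
      exacts [⟨0, rfl⟩, ⟨1, rfl⟩, ⟨2, rfl⟩, ⟨3, rfl⟩])

/-- Such a sum does not depend on the orthonormal basis. This lemma and the next, for the trace,
move |h̃|² and H from the left-invariant frame, in which they are defined, to the frame adapted to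
ν. -/
theorem sum_sq_eq_quat {ν : HVec 2} (hν : ‖ν‖ = 1) (f : HVec 2 →ₗ[ℝ] ℝ) :
    ∑ a, f (EuclideanSpace.single a 1) ^ 2 =
      f ν ^ 2 + f (J ν) ^ 2 + f (quatJ ν) ^ 2 + f (J (quatJ ν)) ^ 2 := by
  obtain ⟨w, hw⟩ : ∃ w, ∀ v, f v = ⟪w, v⟫ :=
    ⟨(InnerProductSpace.toDual ℝ _).symm (LinearMap.toContinuousLinearMap f), fun v => by simp⟩
  have h1 := (EuclideanSpace.basisFun (Fin 2 ⊕ Fin 2) ℝ).sum_sq_inner_left w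
  have h2 := (quatBasis ν hν).sum_sq_inner_left w
  rw [← h1, Fin.sum_univ_four] at h2
  simp only [EuclideanSpace.basisFun_apply] at h2
  simp only [hw]
  rw [← h2]
  simp [quatBasis]

theorem sum_inner_eq_quat {ν : HVec 2} (hν : ‖ν‖ = 1) (T : HVec 2 →ₗ[ℝ] HVec 2) :
    ∑ a, ⟪EuclideanSpace.single a 1, T (EuclideanSpace.single a 1)⟫ =
      ⟪ν, T ν⟫ + ⟪J ν, T (J ν)⟫ + ⟪quatJ ν, T (quatJ ν)⟫ + ⟪J (quatJ ν), T (J (quatJ ν))⟫ := by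
  have h1 := LinearMap.trace_eq_sum_inner T (EuclideanSpace.basisFun (Fin 2 ⊕ Fin 2) ℝ)
  have h2 := LinearMap.trace_eq_sum_inner T (quatBasis ν hν)
  rw [h1, Fin.sum_univ_four] at h2
  simp only [EuclideanSpace.basisFun_apply] at h2
  rw [h2]
  simp [quatBasis]

variable {S : Set (Point 2)} {η : Point 2 → Point 2}

/-- The standing assumptions on the hypersurface. -/
structure Regular {n : ℕ} (S : Set (Point n)) (η : Point n → Point n) : Prop where
  hyp : IsHypersurface S
  normal : IsUnitNormal S η
  nonchar : IsNonCharacteristic S η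

section Calculus

variable {n : ℕ} {S : Set (Point n)} {η : Point n → Point n}
variable {F G : Type*} [NormedAddCommGroup F] [NormedSpace ℝ F]
  [NormedAddCommGroup G] [NormedSpace ℝ G]

theorem fderivWithin_clm_comp (h : Regular S η) {φ : Point n → F} {p : Point n} (hp : p ∈ S)
    (hφ : DifferentiableWithinAt ℝ φ S p) (A : F →L[ℝ] G) {w : Point n} (hw : ⟪η p, w⟫ = 0) :
    fderivWithin ℝ (fun q => A (φ q)) S p w = A (fderivWithin ℝ φ S p w) :=
  fderivWithin_apply_of_tangent h.hyp h.normal hp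
    (A.hasFDerivAt.comp_hasFDerivWithinAt p hφ.hasFDerivWithinAt) hw

theorem fderivWithin_inner_tangent {F : Type*} [NormedAddCommGroup F] [InnerProductSpace ℝ F]
    (h : Regular S η) {φ ψ : Point n → F} {p : Point n}
    (hp : p ∈ S) (hφ : DifferentiableWithinAt ℝ φ S p) (hψ : DifferentiableWithinAt ℝ ψ S p)
    {w : Point n} (hw : ⟪η p, w⟫ = 0) :
    fderivWithin ℝ (fun q => ⟪φ q, ψ q⟫) S p w =
      ⟪φ p, fderivWithin ℝ ψ S p w⟫ + ⟪fderivWithin ℝ φ S p w, ψ p⟫ := by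
  rw [fderivWithin_apply_of_tangent h.hyp h.normal hp
    (hφ.hasFDerivWithinAt.inner ℝ hψ.hasFDerivWithinAt) hw]
  simp

theorem fderivWithin_eq_zero_of_eqOn (h : Regular S η) {φ : Point n → F} {a : F} {p : Point n}
    (hp : p ∈ S) (hφ : ∀ q ∈ S, φ q = a) {w : Point n} (hw : ⟪η p, w⟫ = 0) :
    fderivWithin ℝ φ S p w = 0 :=
  fderivWithin_apply_of_tangent h.hyp h.normal hp
    ((hasFDerivWithinAt_const a p S).congr hφ (hφ p hp)) hw

theorem Regular.tangent (h : Regular S η) {p : Point n} (hp : p ∈ S) {v : HVec n}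
    (hv : ⟪nu η p, v⟫ = 0) : ⟪η p, lift p v⟫ = 0 := inner_lift_eq_zero h.nonchar hp hv

theorem Regular.norm_nu (h : Regular S η) {p : Point n} (hp : p ∈ S) : ‖nu η p‖ = 1 :=
  Heisenberg.norm_nu h.nonchar hp

theorem Regular.inner_nu_nu (h : Regular S η) {p : Point n} (hp : p ∈ S) :
    ⟪nu η p, nu η p⟫ = 1 := by
  rw [real_inner_self_eq_norm_sq, h.norm_nu hp, one_pow]

theorem Regular.contDiffOn_nu (h : Regular S η) : ContDiffOn ℝ 4 (nu η) S :=
  Heisenberg.contDiffOn_nu h.hyp h.normal h.nonchar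

theorem Regular.contDiffOn_alpha (h : Regular S η) : ContDiffOn ℝ 4 (alpha η) S :=
  Heisenberg.contDiffOn_alpha h.hyp h.normal h.nonchar

theorem Regular.differentiable_nu (h : Regular S η) {p : Point n} (hp : p ∈ S) :
    DifferentiableWithinAt ℝ (nu η) S p := h.contDiffOn_nu.differentiableOn (by norm_num) p hp

theorem Regular.inner_shape_nu (h : Regular S η) {p : Point n} (hp : p ∈ S) {v : HVec n}
    (hv : ⟪nu η p, v⟫ = 0) : ⟪nu η p, shape S η p v⟫ = 0 := by
  have h1 := fderivWithin_inner_tangent h hp (h.differentiable_nu hp) (h.differentiable_nu hp)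
    (h.tangent hp hv)
  rw [fderivWithin_eq_zero_of_eqOn h hp (fun q hq => h.inner_nu_nu hq) (h.tangent hp hv),
    real_inner_comm (nu η p) (fderivWithin ℝ (nu η) S p _)] at h1
  rw [shape]
  linarith

theorem Regular.contDiffOn_clm_nu (h : Regular S η) (A : HVec n →L[ℝ] F) :
    ContDiffOn ℝ 4 (fun p => A (nu η p)) S := A.contDiff.comp_contDiffOn h.contDiffOn_nu

/-- The horizontal field `A ν` for a linear map `A`. -/
theorem Regular.dirDeriv_clm_nu (h : Regular S η) (A : HVec n →L[ℝ] F) {X : Point n → HVec n}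
    {p : Point n} (hp : p ∈ S) (hX : ⟪nu η p, X p⟫ = 0) :
    dirDeriv S (fun q => A (nu η q)) X p = A (shape S η p (X p)) :=
  fderivWithin_clm_comp h hp (h.differentiable_nu hp) A (h.tangent hp hX)

theorem Regular.contDiffOn_shape (h : Regular S η) {X : Point n → HVec n}
    (hX : ContDiffOn ℝ 4 X S) (hXν : ∀ p ∈ S, ⟪nu η p, X p⟫ = 0) :
    ContDiffOn ℝ 3 (fun p => shape S η p (X p)) S :=
  contDiffOn_dirDeriv (k := 3) h.hyp h.normal h.nonchar (by norm_num)
    (h.contDiffOn_nu.of_le (by norm_num)) (hX.of_le (by norm_num)) hXν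

theorem shape_add (p : Point n) (v w : HVec n) :
    shape S η p (v + w) = shape S η p v + shape S η p w := by
  rw [shape, lift_add, map_add]; rfl

theorem shape_smul (p : Point n) (r : ℝ) (v : HVec n) :
    shape S η p (r • v) = r • shape S η p v := by
  rw [shape, lift_smul, map_smul]; rfl

/-- Derivative of the inner product of a derivative of `ν` with a linear image of `ν`. -/
theorem Regular.dirDeriv_inner (h : Regular S η) {X Y : Point n → HVec n}
    (A : HVec n →L[ℝ] HVec n) (hY : ContDiffOn ℝ 4 Y S) (hYν : ∀ p ∈ S, ⟪nu η p, Y p⟫ = 0)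
    (hXν : ∀ p ∈ S, ⟪nu η p, X p⟫ = 0) {p : Point n} (hp : p ∈ S) :
    dirDeriv S (fun q => ⟪shape S η q (Y q), A (nu η q)⟫) X p =
      ⟪shape S η p (Y p), A (shape S η p (X p))⟫ +
        ⟪dirDeriv S (dirDeriv S (nu η) Y) X p, A (nu η p)⟫ := by
  rw [← h.dirDeriv_clm_nu A hp (hXν p hp)]
  exact fderivWithin_inner_tangent h hp
    ((h.contDiffOn_shape hY hYν).differentiableOn (by norm_num) p hp)
    ((h.contDiffOn_clm_nu A).differentiableOn (by norm_num) p hp) (h.tangent hp (hXν p hp))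

end Calculus

/-- The field `Jν`. -/
def fieldV (η : Point 2 → Point 2) (p : Point 2) : HVec 2 := J (nu η p)
/-- A horizontal tangent field orthogonal to `Jν`. -/
def fieldA (η : Point 2 → Point 2) (p : Point 2) : HVec 2 := quatJ (nu η p)
/-- The horizontal tangent field that completes `Jν` and `fieldA`. -/
def fieldB (η : Point 2 → Point 2) (p : Point 2) : HVec 2 := J (quatJ (nu η p))

theorem inner_nu_fieldV (p : Point 2) : ⟪nu η p, fieldV η p⟫ = 0 := by simp [fieldV]
theorem inner_nu_fieldA (p : Point 2) : ⟪nu η p, fieldA η p⟫ = 0 := by simp [fieldA]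
theorem inner_nu_fieldB (p : Point 2) : ⟪nu η p, fieldB η p⟫ = 0 := by simp [fieldB]

theorem J_fieldV (p : Point 2) : J (fieldV η p) = -nu η p := by simp [fieldV]
theorem J_fieldA (p : Point 2) : J (fieldA η p) = fieldB η p := rfl
theorem J_fieldB (p : Point 2) : J (fieldB η p) = -fieldA η p := by simp [fieldB, fieldA]
theorem quatJ_fieldV (p : Point 2) : quatJ (fieldV η p) = -fieldB η p := quatJ_J _
theorem quatJ_fieldA (p : Point 2) : quatJ (fieldA η p) = -nu η p := by simp [fieldA]
theorem quatJ_fieldB (p : Point 2) : quatJ (fieldB η p) = fieldV η p := by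
  simp [fieldB, fieldV, quatJ_J, J_neg]

theorem inner_fieldV_fieldA (p : Point 2) : ⟪fieldV η p, fieldA η p⟫ = 0 := by
  simp [fieldV, fieldA]
theorem inner_fieldV_fieldB (p : Point 2) : ⟪fieldV η p, fieldB η p⟫ = 0 := by
  simp [fieldV, fieldB]
theorem inner_fieldA_fieldB (p : Point 2) : ⟪fieldA η p, fieldB η p⟫ = 0 := by
  simp [fieldA, fieldB]

/-- A minimal hypersurface for which `Jν` is an eigenvector of the shape operator. -/
structure Adapted (S : Set (Point 2)) (η : Point 2 → Point 2) : Prop extends Regular S η where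
  minimal : ∀ p ∈ S, meanCurv S η p = 0
  p1 : PropP1 S η

namespace Adapted

variable (h : Adapted S η)
include h

theorem inner_fieldV_self {p : Point 2} (hp : p ∈ S) : ⟪fieldV η p, fieldV η p⟫ = 1 := by
  simp [fieldV, h.norm_nu hp]
theorem inner_fieldA_self {p : Point 2} (hp : p ∈ S) : ⟪fieldA η p, fieldA η p⟫ = 1 := by
  simp [fieldA, h.norm_nu hp]
theorem inner_fieldB_self {p : Point 2} (hp : p ∈ S) : ⟪fieldB η p, fieldB η p⟫ = 1 := by
  simp [fieldB, h.norm_nu hp]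

end Adapted

end Heisenberg

/-! ### The shape operator in the adapted frame -/

namespace Heisenberg

variable {S : Set (Point 2)} {η : Point 2 → Point 2}

namespace Adapted

variable (h : Adapted S η)
include h

theorem contDiffOn_fieldV : ContDiffOn ℝ 4 (fieldV η) S := h.contDiffOn_clm_nu JL
theorem contDiffOn_fieldA : ContDiffOn ℝ 4 (fieldA η) S := h.contDiffOn_clm_nu quatJ
theorem contDiffOn_fieldB : ContDiffOn ℝ 4 (fieldB η) S := h.contDiffOn_clm_nu (JL.comp quatJ)

theorem dirDeriv_fieldV {X : Point 2 → HVec 2} {p : Point 2} (hp : p ∈ S)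
    (hX : ⟪nu η p, X p⟫ = 0) : dirDeriv S (fieldV η) X p = J (shape S η p (X p)) :=
  h.dirDeriv_clm_nu JL hp hX

theorem dirDeriv_fieldA {X : Point 2 → HVec 2} {p : Point 2} (hp : p ∈ S)
    (hX : ⟪nu η p, X p⟫ = 0) : dirDeriv S (fieldA η) X p = quatJ (shape S η p (X p)) :=
  h.dirDeriv_clm_nu quatJ hp hX

theorem dirDeriv_fieldB {X : Point 2 → HVec 2} {p : Point 2} (hp : p ∈ S)
    (hX : ⟪nu η p, X p⟫ = 0) : dirDeriv S (fieldB η) X p = J (quatJ (shape S η p (X p))) :=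
  h.dirDeriv_clm_nu (JL.comp quatJ) hp hX

theorem shape_fieldV {p : Point 2} (hp : p ∈ S) :
    shape S η p (fieldV η p) = ell S η p • fieldV η p := sub_eq_zero.1 (h.p1 p hp)

/-- Tangency of [V, A] says that the skew part of h on this pair is a multiple of α⟨JV, A⟩ = 0. By
(P1) the transposed entry h(V, A) vanishes, hence so does this one. The pair V, B is treated in the
same way. -/
theorem inner_shape_fieldA_fieldV {p : Point 2} (hp : p ∈ S) :
    ⟪fieldV η p, shape S η p (fieldA η p)⟫ = 0 := by
  have h1 := inner_bracket h.hyp h.normal h.nonchar (h.contDiffOn_fieldV.of_le (by norm_num))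
    (h.contDiffOn_fieldA.of_le (by norm_num)) (fun q _ => inner_nu_fieldV q)
    (fun q _ => inner_nu_fieldA q) hp
  rw [h.dirDeriv_fieldA hp (inner_nu_fieldV p), h.dirDeriv_fieldV hp (inner_nu_fieldA p),
    h.shape_fieldV hp, map_smul, quatJ_fieldV, J_fieldV, inner_neg_left, inner_nu_fieldA,
    inner_sub_right, inner_smul_right, inner_neg_right, inner_nu_fieldB] at h1
  rw [fieldV, inner_J_left]
  linarith

theorem inner_shape_fieldB_fieldV {p : Point 2} (hp : p ∈ S) :
    ⟪fieldV η p, shape S η p (fieldB η p)⟫ = 0 := by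
  have h1 := inner_bracket h.hyp h.normal h.nonchar (h.contDiffOn_fieldV.of_le (by norm_num))
    (h.contDiffOn_fieldB.of_le (by norm_num)) (fun q _ => inner_nu_fieldV q)
    (fun q _ => inner_nu_fieldB q) hp
  rw [h.dirDeriv_fieldB hp (inner_nu_fieldV p), h.dirDeriv_fieldV hp (inner_nu_fieldB p),
    h.shape_fieldV hp, map_smul, quatJ_fieldV, J_fieldV, inner_neg_left, inner_nu_fieldB,
    J_smul, J_neg, J_fieldB, inner_sub_right, inner_smul_right, neg_neg, inner_nu_fieldA] at h1
  rw [fieldV, inner_J_left]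
  linarith

theorem eq_sum_frame {p : Point 2} (hp : p ∈ S) {v : HVec 2} (hv : ⟪nu η p, v⟫ = 0) :
    v = ⟪fieldV η p, v⟫ • fieldV η p + ⟪fieldA η p, v⟫ • fieldA η p +
      ⟪fieldB η p, v⟫ • fieldB η p := by
  conv_lhs => rw [eq_sum_quaternion_frame (h.norm_nu hp) v, hv, zero_smul, zero_add]
  rfl

theorem shape_fieldA {p : Point 2} (hp : p ∈ S) :
    shape S η p (fieldA η p) = ⟪shape S η p (fieldA η p), fieldA η p⟫ • fieldA η p +
      ⟪shape S η p (fieldA η p), fieldB η p⟫ • fieldB η p := by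
  conv_lhs => rw [h.eq_sum_frame hp (h.inner_shape_nu hp (inner_nu_fieldA p)),
    h.inner_shape_fieldA_fieldV hp, zero_smul, zero_add]
  rw [real_inner_comm, real_inner_comm (fieldB η p)]

theorem shape_fieldB {p : Point 2} (hp : p ∈ S) :
    shape S η p (fieldB η p) = ⟪shape S η p (fieldB η p), fieldA η p⟫ • fieldA η p +
      ⟪shape S η p (fieldB η p), fieldB η p⟫ • fieldB η p := by
  conv_lhs => rw [h.eq_sum_frame hp (h.inner_shape_nu hp (inner_nu_fieldB p)),
    h.inner_shape_fieldB_fieldV hp, zero_smul, zero_add]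
  rw [real_inner_comm, real_inner_comm (fieldB η p)]

/-- The skew part of the shape operator. -/
theorem shape_skew {p : Point 2} (hp : p ∈ S) :
    ⟪shape S η p (fieldB η p), fieldA η p⟫ - ⟪shape S η p (fieldA η p), fieldB η p⟫ =
      2 * alpha η p := by
  have h1 := inner_bracket h.hyp h.normal h.nonchar (h.contDiffOn_fieldA.of_le (by norm_num))
    (h.contDiffOn_fieldB.of_le (by norm_num)) (fun q _ => inner_nu_fieldA q)
    (fun q _ => inner_nu_fieldB q) hp
  have h2 : ⟪nu η p, J (quatJ (shape S η p (fieldA η p)))⟫ =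
      -⟪shape S η p (fieldA η p), fieldB η p⟫ := by
    rw [← neg_eq_iff_eq_neg, ← inner_J_left, ← neg_eq_iff_eq_neg.2 (inner_quatJ_left _ _),
      quatJ_J, inner_neg_left, neg_neg, real_inner_comm]
    rfl
  have h3 : ⟪nu η p, quatJ (shape S η p (fieldB η p))⟫ =
      -⟪shape S η p (fieldB η p), fieldA η p⟫ := by
    rw [← neg_eq_iff_eq_neg, ← inner_quatJ_left, real_inner_comm]
    rfl
  rw [h.dirDeriv_fieldB hp (inner_nu_fieldA p), h.dirDeriv_fieldA hp (inner_nu_fieldB p),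
    J_fieldA, h.inner_fieldB_self hp, inner_sub_right, h2, h3] at h1
  linarith

omit h in
theorem proj_eq (p : Point 2) {v : HVec 2} (hv : ⟪nu η p, v⟫ = 0) : proj η p v = v := by
  rw [proj, real_inner_comm, hv, zero_smul, sub_zero]

theorem proj_nu {p : Point 2} (hp : p ∈ S) : proj η p (nu η p) = 0 := by
  rw [proj, h.inner_nu_nu hp, one_smul, sub_self]

omit h in
theorem proj_J_nu (p : Point 2) : proj η p (J (nu η p)) = fieldV η p :=
  proj_eq p (inner_nu_fieldV p)
omit h in
theorem proj_quatJ_nu (p : Point 2) : proj η p (quatJ (nu η p)) = fieldA η p :=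
  proj_eq p (inner_nu_fieldA p)
omit h in
theorem proj_J_quatJ_nu (p : Point 2) : proj η p (J (quatJ (nu η p))) = fieldB η p :=
  proj_eq p (inner_nu_fieldB p)

omit h in
theorem inner_nu_proj {p : Point 2} (hν : ⟪nu η p, nu η p⟫ = 1) (v : HVec 2) :
    ⟪nu η p, proj η p v⟫ = 0 := by
  rw [proj, inner_sub_right, inner_smul_right, hν, real_inner_comm]
  ring

omit h in
/-- The projection as a linear map. -/
def projL (η : Point 2 → Point 2) (p : Point 2) : HVec 2 →ₗ[ℝ] HVec 2 where
  toFun := proj η p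
  map_add' v w := by simp only [proj, inner_add_left]; module
  map_smul' r v := by simp only [proj, inner_smul_left, conj_trivial, RingHom.id_apply]; module

omit h in
/-- The shape operator as a linear map. -/
def shapeL (S : Set (Point 2)) (η : Point 2 → Point 2) (p : Point 2) : HVec 2 →ₗ[ℝ] HVec 2 where
  toFun := shape S η p
  map_add' := shape_add p
  map_smul' := shape_smul p

theorem trace_shape {p : Point 2} (hp : p ∈ S) :
    ell S η p + ⟪shape S η p (fieldA η p), fieldA η p⟫ +
      ⟪shape S η p (fieldB η p), fieldB η p⟫ = 0 := by
  have h1 := sum_inner_eq_quat (h.norm_nu hp) (projL η p ∘ₗ shapeL S η p ∘ₗ projL η p)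
  have h2 : ∀ v w, ⟪v, (projL η p ∘ₗ shapeL S η p ∘ₗ projL η p) w⟫ =
      sff S η p (proj η p w) (proj η p v) := by
    intro v w
    have h3 : ⟪nu η p, shape S η p (proj η p w)⟫ = 0 :=
      h.inner_shape_nu hp (inner_nu_proj (h.inner_nu_nu hp) w)
    change ⟪v, proj η p (shape S η p (proj η p w))⟫ = ⟪shape S η p (proj η p w), proj η p v⟫
    rw [proj_eq p h3, proj.eq_1 η p v, inner_sub_right, inner_smul_right,
      real_inner_comm (nu η p) (shape S η p _), h3, real_inner_comm]
    ring
  simp only [h2] at h1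
  have h4 := h.minimal p hp
  rw [meanCurv, h1, h.proj_nu hp, proj_J_nu, proj_quatJ_nu, proj_J_quatJ_nu, sff,
    inner_zero_right, zero_add] at h4
  exact h4

omit h in
/-- The symmetrized second fundamental form as a bilinear map. -/
def symSffL (S : Set (Point 2)) (η : Point 2 → Point 2) (p : Point 2) :
    HVec 2 →ₗ[ℝ] HVec 2 →ₗ[ℝ] ℝ :=
  LinearMap.mk₂ ℝ (symSff S η p)
    (fun v v' w => by simp only [symSff, sff, shape_add, J_add, inner_add_left]; ring)
    (fun r v w => by
      simp only [symSff, sff, shape_smul, J_smul, inner_smul_left, conj_trivial, smul_eq_mul]; ring)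
    (fun v w w' => by simp only [symSff, sff, inner_add_right]; ring)
    (fun r v w => by simp only [symSff, sff, inner_smul_right, smul_eq_mul]; ring)

theorem sum_sq_proj {p : Point 2} (hp : p ∈ S) (f : HVec 2 →ₗ[ℝ] ℝ) :
    ∑ a, f (proj η p (EuclideanSpace.single a 1)) ^ 2 =
      f (fieldV η p) ^ 2 + f (fieldA η p) ^ 2 + f (fieldB η p) ^ 2 := by
  refine (sum_sq_eq_quat (h.norm_nu hp) (f ∘ₗ projL η p)).trans ?_
  change f (proj η p _) ^ 2 + f (proj η p _) ^ 2 + f (proj η p _) ^ 2 + f (proj η p _) ^ 2 = _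
  rw [h.proj_nu hp, proj_J_nu, proj_quatJ_nu, proj_J_quatJ_nu, map_zero]
  ring

/-- In the adapted frame h̃ is the entry ℓ on V and a symmetric block on A, B, whose off-diagonal
entry is h(A, B) + α = h(B, A) - α. -/
theorem symSffSq_eq {p : Point 2} (hp : p ∈ S) :
    symSffSq S η p = ell S η p ^ 2 + ⟪shape S η p (fieldA η p), fieldA η p⟫ ^ 2 +
      ⟪shape S η p (fieldB η p), fieldB η p⟫ ^ 2 +
      2 * (⟪shape S η p (fieldA η p), fieldB η p⟫ + alpha η p) ^ 2 := by
  have e1 : ∀ v, ∑ b, symSff S η p v (proj η p (EuclideanSpace.single b 1)) ^ 2 =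
      symSff S η p v (fieldV η p) ^ 2 + symSff S η p v (fieldA η p) ^ 2 +
        symSff S η p v (fieldB η p) ^ 2 := fun v => h.sum_sq_proj hp (symSffL S η p v)
  have e2 : ∀ w, ∑ a, symSff S η p (proj η p (EuclideanSpace.single a 1)) w ^ 2 =
      symSff S η p (fieldV η p) w ^ 2 + symSff S η p (fieldA η p) w ^ 2 +
        symSff S η p (fieldB η p) w ^ 2 := fun w => h.sum_sq_proj hp ((symSffL S η p).flip w)
  have iVA := inner_fieldV_fieldA (η := η) p
  have iVB := inner_fieldV_fieldB (η := η) p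
  have iAB := inner_fieldA_fieldB (η := η) p
  have iAV : ⟪fieldA η p, fieldV η p⟫ = 0 := by rw [real_inner_comm, iVA]
  have iBV : ⟪fieldB η p, fieldV η p⟫ = 0 := by rw [real_inner_comm, iVB]
  have iBA : ⟪fieldB η p, fieldA η p⟫ = 0 := by rw [real_inner_comm, iAB]
  have hAV : ⟪shape S η p (fieldA η p), fieldV η p⟫ = 0 := by
    rw [real_inner_comm, h.inner_shape_fieldA_fieldV hp]
  have hBV : ⟪shape S η p (fieldB η p), fieldV η p⟫ = 0 := by
    rw [real_inner_comm, h.inner_shape_fieldB_fieldV hp]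
  have hsk := h.shape_skew hp
  rw [symSffSq]
  simp only [e1, Finset.sum_add_distrib, e2]
  simp only [symSff, sff, J_fieldV, J_fieldA, J_fieldB,
    h.shape_fieldV hp, inner_smul_left, inner_neg_left, inner_nu_fieldV, inner_nu_fieldA,
    inner_nu_fieldB, iVA, iVB, iAB, iAV, iBV, iBA, h.inner_fieldV_self hp, h.inner_fieldA_self hp,
    h.inner_fieldB_self hp, hAV, hBV, conj_trivial]
  rw [show ⟪shape S η p (fieldB η p), fieldA η p⟫ =
    ⟪shape S η p (fieldA η p), fieldB η p⟫ + 2 * alpha η p by linarith]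
  ring

end Adapted

end Heisenberg

/-! ### Codazzi equations and the derivatives of ℓ and α -/

namespace Heisenberg

variable {S : Set (Point 2)} {η : Point 2 → Point 2}

namespace Adapted

variable (h : Adapted S η)
include h

/-- The Codazzi equation for two orthogonal fields. -/
theorem codazzi {X Y : Point 2 → HVec 2} (hX : ContDiffOn ℝ 4 X S) (hY : ContDiffOn ℝ 4 Y S)
    (hXν : ∀ p ∈ S, ⟪nu η p, X p⟫ = 0) (hYν : ∀ p ∈ S, ⟪nu η p, Y p⟫ = 0) (M : HVec 2 →L[ℝ] HVec 2)
    {p : Point 2} (hp : p ∈ S) (hXY : ⟪J (X p), Y p⟫ = 0) :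
    dirDeriv S (fun q => ⟪shape S η q (Y q), M (nu η q)⟫) X p -
      dirDeriv S (fun q => ⟪shape S η q (X q), M (nu η q)⟫) Y p =
    ⟪shape S η p (Y p), M (shape S η p (X p))⟫ - ⟪shape S η p (X p), M (shape S η p (Y p))⟫ +
      ⟪shape S η p (dirDeriv S Y X p - dirDeriv S X Y p), M (nu η p)⟫ := by
  -- The commutator formula is applied to ν itself. Its frame coordinates are plain functions, so no
  -- curvature appears, and the T-term vanishes since JX ⊥ Y.
  have h1 := dirDeriv_comm h.hyp h.normal h.nonchar (h.contDiffOn_nu.of_le (by norm_num))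
    (hX.of_le (by norm_num)) (hY.of_le (by norm_num)) hXν hYν hp
  rw [hXY, mul_zero, zero_smul, add_zero] at h1
  rw [h.dirDeriv_inner M hY hYν hXν hp, h.dirDeriv_inner M hX hXν hYν hp,
    ← show _ = shape S η p (dirDeriv S Y X p - dirDeriv S X Y p) from h1, inner_sub_left]
  ring

theorem dirDeriv_eq_zero {φ : Point 2 → ℝ} {X : Point 2 → HVec 2} {a : ℝ} {p : Point 2}
    (hp : p ∈ S) (hφ : ∀ q ∈ S, φ q = a) (hX : ⟪nu η p, X p⟫ = 0) : dirDeriv S φ X p = 0 :=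
  fderivWithin_eq_zero_of_eqOn h.toRegular hp hφ (h.tangent hp hX)

theorem inner_shape_fieldV_fieldA {p : Point 2} (hp : p ∈ S) :
    ⟪shape S η p (fieldV η p), fieldA η p⟫ = 0 := by
  rw [h.shape_fieldV hp, inner_smul_left, inner_fieldV_fieldA, mul_zero]

theorem inner_shape_fieldV_fieldB {p : Point 2} (hp : p ∈ S) :
    ⟪shape S η p (fieldV η p), fieldB η p⟫ = 0 := by
  rw [h.shape_fieldV hp, inner_smul_left, inner_fieldV_fieldB, mul_zero]

omit h in
theorem inner_fieldB_fieldA (p : Point 2) : ⟪fieldB η p, fieldA η p⟫ = 0 := by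
  rw [real_inner_comm, inner_fieldA_fieldB]
omit h in
theorem inner_fieldV_nu (p : Point 2) : ⟪fieldV η p, nu η p⟫ = 0 := by
  rw [real_inner_comm, inner_nu_fieldV]

theorem bracket_fieldV_fieldA {p : Point 2} (hp : p ∈ S) :
    dirDeriv S (fieldA η) (fieldV η) p - dirDeriv S (fieldV η) (fieldA η) p =
      ⟪shape S η p (fieldA η p), fieldB η p⟫ • fieldA η p -
        (ell S η p + ⟪shape S η p (fieldA η p), fieldA η p⟫) • fieldB η p := by
  rw [h.dirDeriv_fieldA hp (inner_nu_fieldV p), h.dirDeriv_fieldV hp (inner_nu_fieldA p),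
    h.shape_fieldV hp, h.shape_fieldA hp, map_smul, quatJ_fieldV, J_add, J_smul, J_smul, J_fieldA,
    J_fieldB, ← h.shape_fieldA hp]
  module

theorem bracket_fieldV_fieldB {p : Point 2} (hp : p ∈ S) :
    dirDeriv S (fieldB η) (fieldV η) p - dirDeriv S (fieldV η) (fieldB η) p =
      (ell S η p + ⟪shape S η p (fieldB η p), fieldB η p⟫) • fieldA η p -
        ⟪shape S η p (fieldB η p), fieldA η p⟫ • fieldB η p := by
  rw [h.dirDeriv_fieldB hp (inner_nu_fieldV p), h.dirDeriv_fieldV hp (inner_nu_fieldB p),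
    h.shape_fieldV hp, h.shape_fieldB hp, map_smul, quatJ_fieldV, J_smul, J_neg, J_fieldB, J_add,
    J_smul, J_smul, J_fieldA, J_fieldB, ← h.shape_fieldB hp]
  module

/-- The coefficient of V is minus the trace of the A, B block, hence ℓ by minimality. The component
2αν combines with the -2T of the commutator formula, so that [A, B] = ℓV - 2(T - αν). -/
theorem bracket_fieldA_fieldB {p : Point 2} (hp : p ∈ S) :
    dirDeriv S (fieldB η) (fieldA η) p - dirDeriv S (fieldA η) (fieldB η) p =
      ell S η p • fieldV η p + (2 * alpha η p) • nu η p := by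
  have h1 := h.trace_shape hp
  rw [← h.shape_skew hp, show ell S η p = -⟪shape S η p (fieldA η p), fieldA η p⟫ -
    ⟪shape S η p (fieldB η p), fieldB η p⟫ by linarith]
  rw [h.dirDeriv_fieldB hp (inner_nu_fieldA p), h.dirDeriv_fieldA hp (inner_nu_fieldB p),
    h.shape_fieldA hp, h.shape_fieldB hp, map_add, map_add, map_smul, map_smul, map_smul, map_smul,
    quatJ_fieldA, quatJ_fieldB, J_add, J_smul, J_smul, J_neg, J_fieldV,
    ← h.shape_fieldA hp, ← h.shape_fieldB hp]
  change _ • -fieldV η p + _ - _ = _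
  module

omit h in
theorem inner_J_fieldV_fieldA (p : Point 2) : ⟪J (fieldV η p), fieldA η p⟫ = 0 := by
  rw [J_fieldV, inner_neg_left, inner_nu_fieldA, neg_zero]
omit h in
theorem inner_J_fieldV_fieldB (p : Point 2) : ⟪J (fieldV η p), fieldB η p⟫ = 0 := by
  rw [J_fieldV, inner_neg_left, inner_nu_fieldB, neg_zero]

/-- This is the Codazzi equation for V, A paired with V. The entry h(A, V) vanishes identically, the
bracket [V, A] lies in the span of A and B, where h(·, V) = 0, and the remaining terms pair the
shape operator with ν. -/
theorem dirDeriv_ell_fieldA {p : Point 2} (hp : p ∈ S) :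
    dirDeriv S (ell S η) (fieldA η) p = 0 := by
  have h1 := h.codazzi h.contDiffOn_fieldV h.contDiffOn_fieldA (fun q _ => inner_nu_fieldV q)
    (fun q _ => inner_nu_fieldA q) JL hp (inner_J_fieldV_fieldA p)
  rw [h.dirDeriv_eq_zero (a := 0) hp (fun q hq => by
    change ⟪_, fieldV η q⟫ = 0
    rw [real_inner_comm, h.inner_shape_fieldA_fieldV hq]) (inner_nu_fieldV p)] at h1
  change 0 - dirDeriv S (ell S η) (fieldA η) p = ⟪_, J _⟫ - ⟪_, J _⟫ + ⟪_, fieldV η p⟫ at h1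
  rw [h.bracket_fieldV_fieldA hp, sub_eq_add_neg (_ • fieldA η p), ← neg_smul, shape_add,
    shape_smul, shape_smul, inner_add_left, inner_smul_left, inner_smul_left,
    real_inner_comm (fieldV η p), h.inner_shape_fieldA_fieldV hp,
    real_inner_comm (fieldV η p), h.inner_shape_fieldB_fieldV hp, h.shape_fieldV hp, J_smul,
    J_fieldV, inner_smul_right, inner_neg_right, real_inner_comm (nu η p),
    h.inner_shape_nu hp (inner_nu_fieldA p), inner_smul_left, ← neg_eq_iff_eq_neg.2
    (inner_J_left (fieldV η p) _), J_fieldV, inner_neg_left,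
    h.inner_shape_nu hp (inner_nu_fieldA p)] at h1
  simpa using h1

theorem dirDeriv_ell_fieldB {p : Point 2} (hp : p ∈ S) :
    dirDeriv S (ell S η) (fieldB η) p = 0 := by
  have h1 := h.codazzi h.contDiffOn_fieldV h.contDiffOn_fieldB (fun q _ => inner_nu_fieldV q)
    (fun q _ => inner_nu_fieldB q) JL hp (inner_J_fieldV_fieldB p)
  rw [h.dirDeriv_eq_zero (a := 0) hp (fun q hq => by
    change ⟪_, fieldV η q⟫ = 0
    rw [real_inner_comm, h.inner_shape_fieldB_fieldV hq]) (inner_nu_fieldV p)] at h1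
  change 0 - dirDeriv S (ell S η) (fieldB η) p = ⟪_, J _⟫ - ⟪_, J _⟫ + ⟪_, fieldV η p⟫ at h1
  rw [h.bracket_fieldV_fieldB hp, sub_eq_add_neg (_ • fieldA η p), ← neg_smul, shape_add,
    shape_smul, shape_smul, inner_add_left, inner_smul_left, inner_smul_left,
    real_inner_comm (fieldV η p), h.inner_shape_fieldA_fieldV hp,
    real_inner_comm (fieldV η p), h.inner_shape_fieldB_fieldV hp, h.shape_fieldV hp, J_smul,
    J_fieldV, inner_smul_right, inner_neg_right, real_inner_comm (nu η p),
    h.inner_shape_nu hp (inner_nu_fieldB p), inner_smul_left, ← neg_eq_iff_eq_neg.2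
    (inner_J_left (fieldV η p) _), J_fieldV, inner_neg_left,
    h.inner_shape_nu hp (inner_nu_fieldB p)] at h1
  simpa using h1

/-- The entries of the shape operator on the plane orthogonal to `ν` and `Jν`. -/
theorem codazzi_entries {p : Point 2} (hp : p ∈ S) {x y z w : ℝ}
    (hx : ⟪shape S η p (fieldA η p), fieldA η p⟫ = x)
    (hy : ⟪shape S η p (fieldA η p), fieldB η p⟫ = y)
    (hz : ⟪shape S η p (fieldB η p), fieldA η p⟫ = z)
    (hw : ⟪shape S η p (fieldB η p), fieldB η p⟫ = w) :
    dirDeriv S (fun q => ⟪shape S η q (fieldA η q), fieldA η q⟫) (fieldV η) p =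
      -2 * ell S η p * y + y * x - (ell S η p + x) * z ∧
    dirDeriv S (fun q => ⟪shape S η q (fieldA η q), fieldB η q⟫) (fieldV η) p =
      2 * ell S η p * x + y * y - (ell S η p + x) * w ∧
    dirDeriv S (fun q => ⟪shape S η q (fieldB η q), fieldA η q⟫) (fieldV η) p =
      -2 * ell S η p * w + (ell S η p + w) * x - z * z ∧
    dirDeriv S (fun q => ⟪shape S η q (fieldB η q), fieldB η q⟫) (fieldV η) p =
      2 * ell S η p * z + (ell S η p + w) * y - z * w := by
  have hA := h.shape_fieldA hp
  have hB := h.shape_fieldB hp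
  rw [hx, hy] at hA
  rw [hz, hw] at hB
  -- The choice M = `quatJ` pairs the Codazzi equation with A, and M = `JL.comp quatJ` pairs it with
  -- B. The derivatives of h(V, A) and h(V, B) drop out, because these entries vanish on S.
  have c1 := h.codazzi h.contDiffOn_fieldV h.contDiffOn_fieldA (fun q _ => inner_nu_fieldV q)
    (fun q _ => inner_nu_fieldA q) quatJ hp (inner_J_fieldV_fieldA p)
  have c2 := h.codazzi h.contDiffOn_fieldV h.contDiffOn_fieldA (fun q _ => inner_nu_fieldV q)
    (fun q _ => inner_nu_fieldA q) (JL.comp quatJ) hp (inner_J_fieldV_fieldA p)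
  have c3 := h.codazzi h.contDiffOn_fieldV h.contDiffOn_fieldB (fun q _ => inner_nu_fieldV q)
    (fun q _ => inner_nu_fieldB q) quatJ hp (inner_J_fieldV_fieldB p)
  have c4 := h.codazzi h.contDiffOn_fieldV h.contDiffOn_fieldB (fun q _ => inner_nu_fieldV q)
    (fun q _ => inner_nu_fieldB q) (JL.comp quatJ) hp (inner_J_fieldV_fieldB p)
  change dirDeriv S (fun q => ⟪_, fieldA η q⟫) _ p - dirDeriv S (fun q => ⟪_, fieldA η q⟫) _ p =
    ⟪_, quatJ _⟫ - ⟪_, quatJ _⟫ + ⟪_, fieldA η p⟫ at c1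
  change dirDeriv S (fun q => ⟪_, fieldB η q⟫) _ p - dirDeriv S (fun q => ⟪_, fieldB η q⟫) _ p =
    ⟪_, J (quatJ _)⟫ - ⟪_, J (quatJ _)⟫ + ⟪_, fieldB η p⟫ at c2
  change dirDeriv S (fun q => ⟪_, fieldA η q⟫) _ p - dirDeriv S (fun q => ⟪_, fieldA η q⟫) _ p =
    ⟪_, quatJ _⟫ - ⟪_, quatJ _⟫ + ⟪_, fieldA η p⟫ at c3
  change dirDeriv S (fun q => ⟪_, fieldB η q⟫) _ p - dirDeriv S (fun q => ⟪_, fieldB η q⟫) _ p =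
    ⟪_, J (quatJ _)⟫ - ⟪_, J (quatJ _)⟫ + ⟪_, fieldB η p⟫ at c4
  rw [h.dirDeriv_eq_zero (a := 0) hp (fun q hq => h.inner_shape_fieldV_fieldA hq)
    (inner_nu_fieldA p), h.bracket_fieldV_fieldA hp] at c1
  rw [h.dirDeriv_eq_zero (a := 0) hp (fun q hq => h.inner_shape_fieldV_fieldB hq)
    (inner_nu_fieldA p), h.bracket_fieldV_fieldA hp] at c2
  rw [h.dirDeriv_eq_zero (a := 0) hp (fun q hq => h.inner_shape_fieldV_fieldA hq)
    (inner_nu_fieldB p), h.bracket_fieldV_fieldB hp] at c3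
  rw [h.dirDeriv_eq_zero (a := 0) hp (fun q hq => h.inner_shape_fieldV_fieldB hq)
    (inner_nu_fieldB p), h.bracket_fieldV_fieldB hp] at c4
  have sub_eq : ∀ r t : ℝ, shape S η p (r • fieldA η p - t • fieldB η p) =
      r • shape S η p (fieldA η p) + (-t) • shape S η p (fieldB η p) := fun r t => by
    rw [sub_eq_add_neg, ← neg_smul, shape_add, shape_smul, shape_smul]
  rw [hx, hy, sub_eq] at c1 c2
  rw [hz, hw, sub_eq] at c3 c4
  simp only [hA, hB, h.shape_fieldV hp, map_add, map_smul, J_add, J_smul, J_neg, quatJ_fieldV,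
    quatJ_fieldA, quatJ_fieldB, J_fieldB, J_fieldV, inner_add_left, inner_add_right,
    inner_smul_left, inner_smul_right, inner_neg_right, inner_fieldV_nu,
    inner_fieldA_fieldB, inner_fieldB_fieldA, h.inner_fieldV_self hp,
    h.inner_fieldA_self hp, h.inner_fieldB_self hp, conj_trivial, sub_zero, neg_neg,
    show J (nu η p) = fieldV η p from rfl] at c1 c2 c3 c4
  refine ⟨?_, ?_, ?_, ?_⟩ <;> linarith

theorem contDiffOn_entry {X Y : Point 2 → HVec 2} (hX : ContDiffOn ℝ 4 X S)
    (hXν : ∀ p ∈ S, ⟪nu η p, X p⟫ = 0) (hY : ContDiffOn ℝ 4 Y S) :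
    ContDiffOn ℝ 3 (fun q => ⟪shape S η q (X q), Y q⟫) S :=
  (h.contDiffOn_shape hX hXν).inner ℝ (hY.of_le (by norm_num))

theorem contDiffOn_ell : ContDiffOn ℝ 3 (ell S η) S :=
  h.contDiffOn_entry h.contDiffOn_fieldV (fun q _ => inner_nu_fieldV q) h.contDiffOn_fieldV

/-- The derivative of `ℓ` and of `α` along `Jν`. -/
theorem dirDeriv_ell_and_alpha {p : Point 2} (hp : p ∈ S) :
    dirDeriv S (ell S η) (fieldV η) p = -4 * alpha η p * ell S η p ∧
    symSffSq S η p = 3 * ell S η p ^ 2 - 2 * (jnuAlpha S η p + alpha η p ^ 2) := by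
  have hV := inner_nu_fieldV (η := η) p
  have hT := h.tangent hp hV
  have dxx := (h.contDiffOn_entry h.contDiffOn_fieldA (fun q _ => inner_nu_fieldA q)
    h.contDiffOn_fieldA).differentiableOn (by norm_num) p hp
  have dxy := (h.contDiffOn_entry h.contDiffOn_fieldA (fun q _ => inner_nu_fieldA q)
    h.contDiffOn_fieldB).differentiableOn (by norm_num) p hp
  have dyx := (h.contDiffOn_entry h.contDiffOn_fieldB (fun q _ => inner_nu_fieldB q)
    h.contDiffOn_fieldA).differentiableOn (by norm_num) p hp
  have dyy := (h.contDiffOn_entry h.contDiffOn_fieldB (fun q _ => inner_nu_fieldB q)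
    h.contDiffOn_fieldB).differentiableOn (by norm_num) p hp
  have dl := h.contDiffOn_ell.differentiableOn (by norm_num) p hp
  have da := h.contDiffOn_alpha.differentiableOn (by norm_num) p hp
  obtain ⟨e1, e2, e3, e4⟩ := h.codazzi_entries hp rfl rfl rfl rfl
  -- The trace relation and the relation h(B, A) - h(A, B) = 2α hold all over S. Differentiating
  -- them along V and inserting the Codazzi equations gives Vℓ and Vα respectively.
  have t1 := fderivWithin_eq_zero_of_eqOn h.toRegular hp (fun q hq => h.trace_shape hq) hT
  replace t1 := (fderivWithin_apply_of_tangent h.hyp h.normal hp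
    ((dl.hasFDerivWithinAt.add dxx.hasFDerivWithinAt).add dyy.hasFDerivWithinAt) hT).symm.trans t1
  have t2 := fderivWithin_eq_zero_of_eqOn h.toRegular hp
    (fun q hq => sub_eq_zero.2 (h.shape_skew hq)) hT
  replace t2 := (fderivWithin_apply_of_tangent h.hyp h.normal hp
    ((dyx.hasFDerivWithinAt.sub dxy.hasFDerivWithinAt).sub
      (da.hasFDerivWithinAt.const_mul 2)) hT).symm.trans t2
  replace t1 : dirDeriv S (ell S η) (fieldV η) p +
    dirDeriv S (fun q => ⟪shape S η q (fieldA η q), fieldA η q⟫) (fieldV η) p +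
    dirDeriv S (fun q => ⟪shape S η q (fieldB η q), fieldB η q⟫) (fieldV η) p = 0 := t1
  replace t2 : dirDeriv S (fun q => ⟪shape S η q (fieldB η q), fieldA η q⟫) (fieldV η) p -
    dirDeriv S (fun q => ⟪shape S η q (fieldA η q), fieldB η q⟫) (fieldV η) p -
    2 * jnuAlpha S η p = 0 := t2
  rw [e1, e4] at t1
  rw [e2, e3] at t2
  have tr := h.trace_shape hp
  have sk := h.shape_skew hp
  rw [h.symSffSq_eq hp]
  set x := ⟪shape S η p (fieldA η p), fieldA η p⟫
  set y := ⟪shape S η p (fieldA η p), fieldB η p⟫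
  set z := ⟪shape S η p (fieldB η p), fieldA η p⟫
  set w := ⟪shape S η p (fieldB η p), fieldB η p⟫
  have hz : z = y + 2 * alpha η p := by linarith
  have hw : w = -ell S η p - x := by linarith
  rw [hz, hw] at t1 t2
  rw [hw]
  constructor
  · linear_combination t1
  · linear_combination -t2

/-- `ℓ²` controls `J(ν)α + α²` from above. -/
theorem jnuAlpha_le {p : Point 2} (hp : p ∈ S) :
    jnuAlpha S η p + alpha η p ^ 2 ≤ 3 / 4 * ell S η p ^ 2 := by
  have h1 := (h.dirDeriv_ell_and_alpha hp).2
  rw [h.symSffSq_eq hp] at h1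
  have tr := h.trace_shape hp
  set x := ⟪shape S η p (fieldA η p), fieldA η p⟫
  set w := ⟪shape S η p (fieldB η p), fieldB η p⟫
  have hl : ell S η p = -(x + w) := by linarith
  rw [hl] at h1 ⊢
  -- Since x + w = -ℓ, x² + w² ≥ ℓ²/2 and so |h̃|² ≥ (3/2)ℓ². Comparison with |h̃|² = 3ℓ² - 2(Vα +
  -- α²) gives the bound.
  nlinarith [sq_nonneg (x - w), sq_nonneg (⟪shape S η p (fieldA η p), fieldB η p⟫ + alpha η p)]

/-- The derivative of `ℓ` along the tangent field `T - α ν`. -/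
theorem fderivWithin_ell_vertical {p : Point 2} (hp : p ∈ S) :
    fderivWithin ℝ (ell S η) S p (vertical - alpha η p • lift p (nu η p)) =
      -2 * alpha η p * ell S η p ^ 2 := by
  -- As Aℓ = Bℓ = 0 on S, the commutator of A and B annihilates ℓ. Thus ℓ · Vℓ = 2(T - αν)ℓ, and Vℓ
  -- is known.
  have h1 := dirDeriv_comm h.hyp h.normal h.nonchar (h.contDiffOn_ell.of_le (by norm_num))
    (h.contDiffOn_fieldA.of_le (by norm_num)) (h.contDiffOn_fieldB.of_le (by norm_num))
    (fun q _ => inner_nu_fieldA q) (fun q _ => inner_nu_fieldB q) hp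
  rw [h.dirDeriv_eq_zero hp (fun q hq => h.dirDeriv_ell_fieldB hq) (inner_nu_fieldA p),
    h.dirDeriv_eq_zero hp (fun q hq => h.dirDeriv_ell_fieldA hq) (inner_nu_fieldB p),
    h.bracket_fieldA_fieldB hp, J_fieldA, h.inner_fieldB_self hp] at h1
  have h2 : lift p (ell S η p • fieldV η p + (2 * alpha η p) • nu η p) + (-2 * 1 : ℝ) • vertical =
      ell S η p • lift p (fieldV η p) +
        (-2 : ℝ) • (vertical - alpha η p • lift p (nu η p)) := by
    rw [lift_add, lift_smul, lift_smul]
    module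
  rw [h2, map_add, map_smul, map_smul] at h1
  have h3 := (h.dirDeriv_ell_and_alpha hp).1
  rw [dirDeriv] at h3
  rw [h3, smul_eq_mul, smul_eq_mul] at h1
  linarith

end Adapted

end Heisenberg

/-! ### The measure σ_H in charts -/

namespace Heisenberg

variable {n : ℕ} {S : Set (Point n)} {η : Point n → Point n}

/-- S is not assumed closed, but it is locally closed, hence the intersection of an open set with
its closure. -/
theorem IsHypersurface.measurableSet (hS : IsHypersurface S) : MeasurableSet S := by
  have h : IsOpen (coborder S) := by
    refine ((isLocallyClosed_tfae S).out 1 2).2 fun p hp => ?_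
    obtain ⟨U, f, hU, hpU, hf, -, hSU⟩ := hS p hp
    refine ⟨U, hU.mem_nhds hpU, ?_⟩
    have h1 : (Subtype.val ⁻¹' S : Set U) = (fun q : U => f q) ⁻¹' {0} := by
      ext q
      have : (q : Point n) ∈ S ∩ U ↔ (q : Point n) ∈ {q ∈ U | f q = 0} := by rw [hSU]
      simpa using this
    rw [h1]
    exact isClosed_singleton.preimage (continuousOn_iff_continuous_domRestrict.1 hf.continuousOn)
  rw [← coborder_inter_closure (s := S)]
  exact h.measurableSet.inter isClosed_closure.measurableSet

theorem continuousOn_horNormal (h : Regular S η) : ContinuousOn (horNormal η) S := by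
  have : ContinuousOn (fun p => horPart p (η p)) S :=
    (hor.continuous.comp_continuousOn h.normal.1).sub
      (ContinuousOn.smul (f := fun p => ⟪η p, vertical⟫) (g := fun p => J (hor p))
        (h.normal.1.inner continuousOn_const)
        (JL.comp hor).continuous.continuousOn)
  exact this.congr fun p _ => horNormal_eq η p

theorem ae_mem_sigmaH (h : Regular S η) : ∀ᵐ p ∂(sigmaH S η), p ∈ S :=
  (withDensity_absolutelyContinuous _ _).ae_le (ae_restrict_mem h.hyp.measurableSet)

namespace GraphChart

variable {c : GraphChart S η}

theorem measurableSet_image_Γ (h : Regular S η) : MeasurableSet (c.Γ '' c.Ω) := by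
  have : S ∩ c.U = c.Γ '' c.Ω := c.inter_eq
  rw [← this]
  exact h.hyp.measurableSet.inter c.isOpen_U.measurableSet

/-- The area formula for the parametrization. -/
theorem map_π_euclideanHausdorffMeasure :
    (μHE[2 * n].restrict (c.Γ '' c.Ω)).map c.π = (volume.restrict c.Ω).withDensity
      (fun u => ENNReal.ofReal (√(1 + ‖gradient c.g u‖ ^ 2))) := by
  have h := MeasureTheory.map_restrict_image_euclideanHausdorffMeasure (G := c.Γ) (G' := c.Γ')
    (π := c.π) c.isOpen_Ω
    (fun u hu => by
      have h1 : HasStrictFDerivAt c.Γ (fderiv ℝ c.Γ u) u :=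
        (contDiffOn_Γ.contDiffAt (c.isOpen_Ω.mem_nhds hu)).hasStrictFDerivAt (by norm_num)
      rwa [(hasFDerivAt_Γ hu).fderiv] at h1)
    (fun u _ => by
      refine LinearMap.ker_eq_bot.2 fun v w hvw => ?_
      have := congrArg c.π (show c.Γ' u v = c.Γ' u w from hvw)
      rwa [c.π_Γ', c.π_Γ'] at this)
    c.π.continuous (fun u _ => c.π_Γ u)
    (D := fun u => √(1 + ‖gradient c.g u‖ ^ 2))
    (Real.continuous_sqrt.comp_continuousOn
      (continuousOn_const.add (contDiffOn_gradient.continuousOn.norm.pow 2)))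
    (fun u _ => by
      rw [← LinearMap.normDet_graph c.L c.norm_e c.inner_e_L (gradient c.g u)]
      congr 1
      ext1 v
      simp [Γ', inner_gradient_left])
  rwa [finrank_euclideanSpace_fin] at h

theorem restrict_sigmaH (h : Regular S η) : (sigmaH S η).restrict c.U =
    (μHE[2 * n].restrict (c.Γ '' c.Ω)).withDensity
      (fun p => ENNReal.ofReal ‖horNormal η (c.Γ (c.π p))‖) := by
  rw [sigmaH, restrict_withDensity c.isOpen_U.measurableSet,
    Measure.restrict_restrict c.isOpen_U.measurableSet, inter_comm,
    show S ∩ c.U = c.Γ '' c.Ω from c.inter_eq]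
  refine withDensity_congr_ae ?_
  filter_upwards [ae_restrict_mem (measurableSet_image_Γ h)] with p hp
  obtain ⟨u, -, rfl⟩ := hp
  rw [π_Γ]

theorem continuousOn_norm_horNormal_Γ (h : Regular S η) :
    ContinuousOn (fun u => ‖horNormal η (c.Γ u)‖) c.Ω :=
  ((continuousOn_horNormal h).comp contDiffOn_Γ.continuousOn fun _ hu => (Γ_mem hu).1).norm

/-- The area factor √(1 + |∇g|²) cancels the normalization of η, so the density in the chart is the
norm of the horizontal part of the unnormalized normal e - L(∇g). -/
theorem map_π_sigmaH (h : Regular S η) : ((sigmaH S η).restrict c.U).map c.π =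
    (volume.restrict c.Ω).withDensity (fun u => ENNReal.ofReal ‖c.hN u‖) := by
  have hm := c.π.continuous.measurable
  have hd : AEMeasurable (fun u => ENNReal.ofReal ‖horNormal η (c.Γ u)‖)
      (volume.restrict c.Ω) :=
    ((continuousOn_norm_horNormal_Γ h).aemeasurable c.isOpen_Ω.measurableSet).ennreal_ofReal
  have hD : AEMeasurable (fun u => ENNReal.ofReal (√(1 + ‖gradient c.g u‖ ^ 2)))
      (volume.restrict c.Ω) :=
    ((Real.continuous_sqrt.comp_continuousOn
      (continuousOn_const.add (contDiffOn_gradient.continuousOn.norm.pow 2))).aemeasurable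
        c.isOpen_Ω.measurableSet).ennreal_ofReal
  have h1 : ((sigmaH S η).restrict c.U).map c.π =
      ((μHE[2 * n].restrict (c.Γ '' c.Ω)).map c.π).withDensity
        (fun u => ENNReal.ofReal ‖horNormal η (c.Γ u)‖) := by
    ext A hA
    rw [Measure.map_apply hm hA, restrict_sigmaH h, withDensity_apply _ (hm hA),
      withDensity_apply _ hA, Measure.restrict_map hm hA, lintegral_map' _ hm.aemeasurable]
    rw [← Measure.restrict_map hm hA, map_π_euclideanHausdorffMeasure]
    exact (hd.mono_ac (withDensity_absolutelyContinuous _ _)).restrict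
  rw [h1, map_π_euclideanHausdorffMeasure, ← withDensity_mul₀ hD hd]
  refine withDensity_congr_ae ?_
  filter_upwards [ae_restrict_mem c.isOpen_Ω.measurableSet] with u hu
  rw [Pi.mul_apply, norm_horNormal_Γ hu, ← ENNReal.ofReal_mul (Real.sqrt_nonneg _)]
  congr 1
  have : √(1 + ‖gradient c.g u‖ ^ 2) ≠ 0 := by positivity
  field_simp

/-- Integration over the part of the hypersurface covered by a chart. -/
theorem setIntegral_sigmaH (h : Regular S η) {f : Point n → ℝ} (hf : ContinuousOn f S) :
    ∫ p in c.U, f p ∂(sigmaH S η) = ∫ u in c.Ω, ‖c.hN u‖ * f (c.Γ u) := by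
  have hm := c.π.continuous.measurable
  have hfΓ : ContinuousOn (fun u => f (c.Γ u)) c.Ω :=
    hf.comp contDiffOn_Γ.continuousOn fun _ hu => (Γ_mem hu).1
  have h1 : ∫ p in c.U, f p ∂(sigmaH S η) = ∫ p in c.U, f (c.Γ (c.π p)) ∂(sigmaH S η) := by
    refine integral_congr_ae ?_
    filter_upwards [ae_restrict_of_ae (ae_mem_sigmaH h), ae_restrict_mem c.isOpen_U.measurableSet]
      with p hp hpU
    obtain ⟨u, -, rfl⟩ := exists_eq_Γ hp hpU
    rw [π_Γ]
  have hd : AEMeasurable (fun u => ENNReal.ofReal ‖c.hN u‖) (volume.restrict c.Ω) :=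
    (contDiffOn_hN.continuousOn.norm.aemeasurable c.isOpen_Ω.measurableSet).ennreal_ofReal
  have h2 : AEStronglyMeasurable (fun u => f (c.Γ u)) (((sigmaH S η).restrict c.U).map c.π) := by
    rw [map_π_sigmaH h]
    exact (hfΓ.aestronglyMeasurable c.isOpen_Ω.measurableSet).mono_ac
      (withDensity_absolutelyContinuous _ _)
  rw [h1, ← integral_map hm.aemeasurable h2, map_π_sigmaH h,
    integral_withDensity_eq_integral_toReal_smul₀ hd (.of_forall fun _ => ENNReal.ofReal_lt_top)]
  simp

end GraphChart

theorem sigmaH_lt_top (h : Regular S η) {K : Set (Point n)} (hK : IsCompact K) (hKS : K ⊆ S) :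
    sigmaH S η K < ⊤ := by
  refine hK.measure_lt_top_of_nhdsWithin fun p hp => ?_
  obtain ⟨c, hc⟩ := exists_graphChart h.hyp h.normal (hKS hp)
  obtain ⟨u, hu, rfl⟩ := GraphChart.exists_eq_Γ (hKS hp) hc
  obtain ⟨r, hr, hrΩ⟩ := Metric.nhds_basis_closedBall.mem_iff.1 (c.isOpen_Ω.mem_nhds hu)
  refine Measure.FiniteAtFilter.filter_mono nhdsWithin_le_nhds
    ⟨c.U ∩ c.π ⁻¹' Metric.ball u r, inter_mem (c.isOpen_U.mem_nhds hc)
      (c.π.continuous.continuousAt.preimage_mem_nhds ?_), ?_⟩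
  · rw [GraphChart.π_Γ]
    exact Metric.ball_mem_nhds u hr
  have hm := c.π.continuous.measurable
  obtain ⟨M, hM⟩ := (isCompact_closedBall u r).exists_bound_of_continuousOn
    (GraphChart.contDiffOn_hN.continuousOn.mono hrΩ)
  rw [inter_comm, ← Measure.restrict_apply (hm measurableSet_ball),
    ← Measure.map_apply hm measurableSet_ball, GraphChart.map_π_sigmaH h,
    withDensity_apply _ measurableSet_ball]
  calc _ ≤ ∫⁻ _ in Metric.ball u r, ENNReal.ofReal M ∂(volume.restrict c.Ω) := by
        refine setLIntegral_mono measurable_const fun v hv => ENNReal.ofReal_le_ofReal ?_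
        exact hM v (Metric.ball_subset_closedBall hv)
    _ < ⊤ := by
        rw [setLIntegral_const]
        exact ENNReal.mul_lt_top ENNReal.ofReal_lt_top
          ((Measure.restrict_apply_le _ _).trans_lt measure_ball_lt_top)

/-- A function with compact support on `S` that is continuous on `S` is integrable. -/
theorem integrable_sigmaH (h : Regular S η) {f : Point n → ℝ} (hf : ContinuousOn f S)
    {K : Set (Point n)} (hK : IsCompact K) (hKS : K ⊆ S) (hf0 : ∀ p ∈ S, p ∉ K → f p = 0) :
    Integrable f (sigmaH S η) := by
  have h1 : IntegrableOn f K (sigmaH S η) :=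
    ContinuousOn.integrableOn_of_subset_isCompact (hf.mono hKS) hK hK.measurableSet Subset.rfl
      (sigmaH_lt_top h hK hKS).ne
  refine h1.integrable_of_ae_notMem_eq_zero ?_
  filter_upwards [ae_mem_sigmaH h] with p hp hpK using hf0 p hp hpK

end Heisenberg

/-! ### The Euclidean divergence theorem -/

section Divergence

variable {H : Type*} [NormedAddCommGroup H] [InnerProductSpace ℝ H] [FiniteDimensional ℝ H]
  [MeasurableSpace H] [BorelSpace H]

theorem integral_fderiv_apply_eq_zero {f : H → ℝ} (hf : ContDiff ℝ 1 f) (hc : HasCompactSupport f)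
    (v : H) : ∫ x, fderiv ℝ f x v = 0 := by
  have h1 : Integrable (fun x => fderiv ℝ f x v) :=
    ((hf.continuous_fderiv one_ne_zero).clm_apply continuous_const).integrable_of_hasCompactSupport
      (hc.fderiv_apply ℝ v)
  have h := integral_mul_fderiv_eq_neg_fderiv_mul_of_integrable (μ := (volume : Measure H))
    (f := f) (g := fun _ => (1 : ℝ)) (v := v) (by simpa using h1) (by simp)
    (by simpa using hf.continuous.integrable_of_hasCompactSupport hc)
    (fun x _ => (hf.differentiable one_ne_zero).differentiableAt)
    (fun x _ => differentiableAt_const _)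
  simpa using h.symm

/-- The divergence theorem for compactly supported vector fields on an open set. -/
theorem setIntegral_trace_fderiv_eq_zero {Ω K : Set H} (hΩ : IsOpen Ω) (hK : IsCompact K)
    (hKΩ : K ⊆ Ω) {F : H → H} (hF : ContDiffOn ℝ 1 F Ω) (hF0 : ∀ u ∈ Ω, u ∉ K → F u = 0) :
    ∫ u in Ω, LinearMap.trace ℝ H (fderiv ℝ F u) = 0 := by
  -- F is only given on Ω, but its extension by zero is C¹ with compact support on the whole space.
  set G := Ω.indicator F with hG
  have hGF : ∀ u ∈ Ω, G =ᶠ[nhds u] F := fun u hu => by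
    filter_upwards [hΩ.mem_nhds hu] with v hv using indicator_of_mem hv F
  have hG0 : ∀ u, u ∉ K → G u = 0 := fun u hu => by
    by_cases huΩ : u ∈ Ω
    · rw [hG, indicator_of_mem huΩ, hF0 u huΩ hu]
    · rw [hG, indicator_of_notMem huΩ]
  have hG0' : ∀ u, u ∉ K → G =ᶠ[nhds u] fun _ => 0 := fun u hu => by
    filter_upwards [hK.isClosed.isOpen_compl.mem_nhds hu] with v hv using hG0 v hv
  have hGc : ContDiff ℝ 1 G := by
    rw [contDiff_iff_contDiffAt]
    intro u
    by_cases hu : u ∈ K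
    · exact (hF.contDiffAt (hΩ.mem_nhds (hKΩ hu))).congr_of_eventuallyEq (hGF u (hKΩ hu))
    · exact contDiffAt_const.congr_of_eventuallyEq (hG0' u hu)
  have hGs : HasCompactSupport G := HasCompactSupport.intro hK hG0
  have h1 : ∫ u in Ω, LinearMap.trace ℝ H (fderiv ℝ F u) =
      ∫ u in Ω, LinearMap.trace ℝ H (fderiv ℝ G u) :=
    setIntegral_congr_fun hΩ.measurableSet fun u hu => by simp only [(hGF u hu).fderiv_eq]
  rw [h1, setIntegral_eq_integral_of_forall_compl_eq_zero fun u hu => by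
    rw [(hG0' u fun hK' => hu (hKΩ hK')).fderiv_eq]; simp]
  have h2 : ∀ u, LinearMap.trace ℝ H (fderiv ℝ G u) = ∑ i,
      fderiv ℝ (fun v => ⟪stdOrthonormalBasis ℝ H i, G v⟫) u (stdOrthonormalBasis ℝ H i) := by
    intro u
    rw [LinearMap.trace_eq_sum_inner _ (stdOrthonormalBasis ℝ H)]
    refine Finset.sum_congr rfl fun i _ => ?_
    have h3 : HasFDerivAt (fun v => ⟪stdOrthonormalBasis ℝ H i, G v⟫) _ u :=
      (innerSL ℝ (stdOrthonormalBasis ℝ H i)).hasFDerivAt.comp u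
        ((hGc.differentiable one_ne_zero).differentiableAt (x := u)).hasFDerivAt
    rw [h3.fderiv]
    simp
  have hc : ∀ i, ContDiff ℝ 1 (fun v => ⟪stdOrthonormalBasis ℝ H i, G v⟫) := fun i =>
    contDiff_const.inner ℝ hGc
  have hs : ∀ i, HasCompactSupport (fun v => ⟪stdOrthonormalBasis ℝ H i, G v⟫) := fun i =>
    HasCompactSupport.intro hK fun u hu => by rw [hG0 u hu, inner_zero_right]
  simp only [h2]
  rw [integral_finsetSum _ fun i _ => ?_]
  · exact Finset.sum_eq_zero fun i _ => integral_fderiv_apply_eq_zero (hc i) (hs i) _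
  · exact (((hc i).continuous_fderiv one_ne_zero).clm_apply
      continuous_const).integrable_of_hasCompactSupport ((hs i).fderiv_apply ℝ _)

end Divergence

/-! ### The divergence theorem for Jν -/

namespace Heisenberg

variable {n : ℕ} {S : Set (Point n)} {η : Point n → Point n}

/-- The derivative in `p` of `lift p (J (horPart p w))`. -/
def rotDeriv (w : Point n) : Point n →L[ℝ] Point n :=
  ⟪w, vertical⟫ • incl.comp hor - ((innerSL ℝ (hor w)).comp hor).smulRight vertical

theorem rotDeriv_apply (w v : Point n) :
    rotDeriv w v = ⟪w, vertical⟫ • incl (hor v) - ⟪hor w, hor v⟫ • vertical := rfl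

/-- The map `w ↦ lift p (J (horPart p w))`. -/
def rot (p : Point n) : Point n →L[ℝ] Point n :=
  incl.comp (JL.comp hor) + (innerSL ℝ vertical).smulRight (incl (hor p)) -
    ((innerSL ℝ (hor p)).comp hor).smulRight vertical

theorem rot_apply (p w : Point n) :
    rot p w = incl (J (hor w)) + ⟪vertical, w⟫ • incl (hor p) - ⟪hor p, hor w⟫ • vertical := rfl

/-- The density of σ_H times Jν is, up to the sign s, the lift of J applied to the horizontal part
of the unnormalized normal N. This field is linear in N, through the map `rot p`, which is moreover
skew; both facts make its divergence computable. -/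
theorem lift_J_horPart (p w : Point n) : lift p (J (horPart p w)) = rot p w := by
  rw [lift_eq, rot_apply, horPart, J_J, inner_neg_left, inner_sub_left, J_sub, J_smul, J_J,
    inner_smul_left, inner_J_self, real_inner_comm w, real_inner_comm (hor p)]
  simp
  module

theorem inner_rot (p v w : Point n) : ⟪v, rot p w⟫ = -⟪w, rot p v⟫ := by
  have h : ⟪hor v, J (hor w)⟫ = -⟪hor w, J (hor v)⟫ := by
    rw [real_inner_comm, inner_J_left]
  simp only [rot_apply, inner_sub_right, inner_add_right, inner_incl_right, inner_smul_right, h,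
    real_inner_comm v vertical, real_inner_comm w vertical]
  rw [real_inner_comm (hor v) (hor p), real_inner_comm (hor w) (hor p)]
  ring

theorem inner_rotDeriv_self (w v : Point n) : ⟪w, rotDeriv w v⟫ = 0 := by
  rw [rotDeriv_apply, inner_sub_right, inner_smul_right, inner_smul_right, inner_incl_right]
  ring

theorem trace_rotDeriv (w : Point n) :
    LinearMap.trace ℝ (Point n) (rotDeriv w) = 2 * n * ⟪w, vertical⟫ := by
  have h1 : ((rotDeriv w : Point n →L[ℝ] Point n) : Point n →ₗ[ℝ] Point n) =
      ⟪w, vertical⟫ • ((incl : HVec n →L[ℝ] Point n) : HVec n →ₗ[ℝ] Point n) ∘ₗ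
        ((hor : Point n →L[ℝ] HVec n) : Point n →ₗ[ℝ] HVec n) -
      ((((innerSL ℝ (hor w)).comp hor : Point n →L[ℝ] ℝ) : Point n →ₗ[ℝ] ℝ)).smulRight
        vertical := rfl
  have h2 : ((hor : Point n →L[ℝ] HVec n) : Point n →ₗ[ℝ] HVec n) ∘ₗ
      ((incl : HVec n →L[ℝ] Point n) : HVec n →ₗ[ℝ] Point n) = LinearMap.id := rfl
  rw [h1, map_sub, map_smul, LinearMap.trace_comp_comm', h2, LinearMap.trace_id,
    LinearMap.trace_smulRight]
  simp
  ring

namespace GraphChart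

variable {c : GraphChart S η}

variable (c) in
/-- The field `J (hN)` in the chart. -/
def rotField (u : EuclideanSpace ℝ (Fin (2 * n))) : EuclideanSpace ℝ (Fin (2 * n)) :=
  c.π (rot (c.Γ u) (c.N u))

variable (c) in
theorem inner_L (a : EuclideanSpace ℝ (Fin (2 * n))) (p : Point n) : ⟪c.L a, p⟫ = ⟪a, c.π p⟫ := by
  conv_lhs => rw [c.decomp p]
  rw [inner_add_right, c.L.inner_map_map, inner_smul_right, real_inner_comm c.e, c.inner_e_L]
  ring

theorem inner_fderiv_gradient_comm {u : EuclideanSpace ℝ (Fin (2 * n))} (hu : u ∈ c.Ω)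
    (v w : EuclideanSpace ℝ (Fin (2 * n))) :
    ⟪fderiv ℝ (gradient c.g) u v, w⟫ = ⟪v, fderiv ℝ (gradient c.g) u w⟫ := by
  have h1 : ∀ᶠ y in nhds u, HasFDerivAt c.g (fderiv ℝ c.g y) y := by
    filter_upwards [c.isOpen_Ω.mem_nhds hu] with y hy using hasFDerivAt_g hy
  have h2 : HasFDerivAt (fderiv ℝ c.g) (fderiv ℝ (fderiv ℝ c.g) u) u :=
    (((c.contDiffOn_g.fderiv_of_isOpen c.isOpen_Ω (m := 4) (by norm_num)).contDiffAt
      (c.isOpen_Ω.mem_nhds hu)).differentiableAt (by norm_num)).hasFDerivAt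
  have h3 : HasFDerivAt (gradient c.g) _ u :=
    (InnerProductSpace.toDual ℝ _).symm.toContinuousLinearEquiv.toContinuousLinearMap.hasFDerivAt.comp
      u h2
  have h4 := second_derivative_symmetric_of_eventually h1 h2 v w
  rw [h3.fderiv, real_inner_comm _ v]
  simpa using h4

theorem contDiffOn_rotField : ContDiffOn ℝ 4 c.rotField c.Ω := by
  have h1 : ContDiffOn ℝ 4 c.Γ c.Ω := contDiffOn_Γ.of_le (by norm_num)
  have h2 : ContDiffOn ℝ 4 c.N c.Ω := contDiffOn_N
  refine c.π.contDiff.comp_contDiffOn (((?_ : ContDiffOn ℝ 4 _ _).add ?_).sub ?_)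
  · exact (incl.comp (JL.comp hor)).contDiff.comp_contDiffOn h2
  · exact (contDiffOn_const.inner ℝ h2).smul ((incl.comp hor).contDiff.comp_contDiffOn h1)
  · exact ((hor.contDiff.comp_contDiffOn h1).inner ℝ
      (hor.contDiff.comp_contDiffOn h2)).smul contDiffOn_const

theorem hasFDerivAt_rotField {u : EuclideanSpace ℝ (Fin (2 * n))} (hu : u ∈ c.Ω) :
    HasFDerivAt c.rotField (c.π.comp ((rotDeriv (c.N u)).comp (c.Γ' u) -
      (rot (c.Γ u)).comp (c.L.toContinuousLinearMap.comp (fderiv ℝ (gradient c.g) u)))) u := by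
  have h1 := hasFDerivAt_Γ hu
  have h2 : HasFDerivAt c.N
      (-(c.L.toContinuousLinearMap.comp (fderiv ℝ (gradient c.g) u))) u := by
    have h3 := ((contDiffOn_gradient.contDiffAt (c.isOpen_Ω.mem_nhds hu)).differentiableAt
      (by norm_num)).hasFDerivAt
    exact (c.L.toContinuousLinearMap.hasFDerivAt.comp u h3).const_sub c.e
  have h3 : HasFDerivAt (fun v => rot (c.Γ v) (c.N v)) _ u :=
    (((incl.comp (JL.comp hor)).hasFDerivAt.comp u h2).add
      (((innerSL ℝ vertical).hasFDerivAt.comp u h2).smul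
        ((incl.comp hor).hasFDerivAt.comp u h1))).sub
      (((hor.hasFDerivAt.comp u h1).inner ℝ (hor.hasFDerivAt.comp u h2)).smul_const vertical)
  refine (c.π.hasFDerivAt.comp u h3).congr_fderiv ?_
  ext1 v
  simp only [ContinuousLinearMap.comp_apply]
  congr 1
  simp [rotDeriv_apply, rot_apply, real_inner_comm (c.N u)]
  rw [real_inner_comm (hor (c.N u))]
  module

/-- The derivative of the field has two parts. The one that differentiates N is a skew map composed
with the Hessian of g, which is symmetric, so its trace vanishes. In the other one, cyclicity of the
trace brings in Γ' ∘ π = id - ⟨N, ·⟩e; the correction has trace ⟨N, `rotDeriv N e`⟩ = 0, and the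
trace of `rotDeriv N` remains. -/
theorem trace_fderiv_rotField {u : EuclideanSpace ℝ (Fin (2 * n))} (hu : u ∈ c.Ω) :
    LinearMap.trace ℝ (EuclideanSpace ℝ (Fin (2 * n))) (fderiv ℝ c.rotField u) = 2 * n * ⟪c.N u, vertical⟫ := by
  set A : EuclideanSpace ℝ (Fin (2 * n)) →ₗ[ℝ] EuclideanSpace ℝ (Fin (2 * n)) :=
    (c.π.comp ((rot (c.Γ u)).comp c.L.toContinuousLinearMap)).toLinearMap with hA
  set B : EuclideanSpace ℝ (Fin (2 * n)) →ₗ[ℝ] EuclideanSpace ℝ (Fin (2 * n)) :=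
    (fderiv ℝ (gradient c.g) u).toLinearMap with hB
  have hAskew : ∀ v w, ⟪v, A w⟫ = -⟪w, A v⟫ := fun v w => by
    change ⟪v, c.π (rot _ (c.L w))⟫ = -⟪w, c.π (rot _ (c.L v))⟫
    rw [← c.inner_L, ← c.inner_L, inner_rot]
  have hAB : LinearMap.trace ℝ _ (A ∘ₗ B) = 0 := by
    have h1 : LinearMap.trace ℝ _ (A ∘ₗ B) = -LinearMap.trace ℝ _ (B ∘ₗ A) := by
      rw [LinearMap.trace_eq_sum_inner _ (EuclideanSpace.basisFun (Fin (2 * n)) ℝ),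
        LinearMap.trace_eq_sum_inner _ (EuclideanSpace.basisFun (Fin (2 * n)) ℝ),
        ← Finset.sum_neg_distrib]
      refine Finset.sum_congr rfl fun i _ => ?_
      rw [LinearMap.comp_apply, LinearMap.comp_apply, hAskew]
      congr 1
      exact inner_fderiv_gradient_comm hu _ _
    rw [LinearMap.trace_comp_comm'] at h1
    rw [LinearMap.trace_comp_comm']
    linarith
  have hΓπ : (c.Γ' u).toLinearMap ∘ₗ c.π.toLinearMap =
      LinearMap.id - (innerSL ℝ (c.N u)).toLinearMap.smulRight c.e := by
    ext1 v
    have h1 : c.L (c.π v) = v - ⟪c.e, v⟫ • c.e := eq_sub_of_add_eq (c.decomp v).symm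
    simp [Γ', N, c.inner_L, inner_gradient_left]
    rw [h1]
    module
  have hT : (rotDeriv (c.N u)).toLinearMap ∘ₗ (innerSL ℝ (c.N u)).toLinearMap.smulRight c.e =
      (innerSL ℝ (c.N u)).toLinearMap.smulRight (rotDeriv (c.N u) c.e) := by
    ext1 v
    simp
  have hR : LinearMap.trace ℝ _ (c.π.toLinearMap ∘ₗ (rotDeriv (c.N u)).toLinearMap ∘ₗ
      (c.Γ' u).toLinearMap) =
      2 * n * ⟪c.N u, vertical⟫ := by
    rw [LinearMap.trace_comp_comm', LinearMap.comp_assoc, hΓπ, LinearMap.comp_sub,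
      LinearMap.comp_id, map_sub, trace_rotDeriv, hT,
      LinearMap.trace_smulRight]
    simp [inner_rotDeriv_self]
  rw [(hasFDerivAt_rotField hu).fderiv, ← hR, ← sub_zero (LinearMap.trace ℝ _ (_ ∘ₗ _)), ← hAB,
    ← map_sub]
  congr 1
  ext1 v
  simp [hA, hB]

end GraphChart

end Heisenberg

namespace Heisenberg

variable {n : ℕ} {S : Set (Point n)} {η : Point n → Point n}

theorem fderivWithin_eq_zero_of_notMem {φ : Point n → ℝ} {K : Set (Point n)} (hK : IsClosed K)
    (hφ : ∀ p ∈ S, p ∉ K → φ p = 0) {p : Point n} (hp : p ∈ S) (hpK : p ∉ K) :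
    fderivWithin ℝ φ S p = 0 := by
  have h1 : φ =ᶠ[nhdsWithin p S] fun _ => 0 := by
    filter_upwards [self_mem_nhdsWithin, mem_nhdsWithin_of_mem_nhds (hK.isOpen_compl.mem_nhds hpK)]
      with q hq hqK using hφ q hq hqK
  rw [h1.fderivWithin_eq (hφ p hp hpK)]
  simp

/-- The characteristic direction field `Jν` is tangent. -/
theorem inner_nu_J_nu (p : Point n) : ⟪nu η p, J (nu η p)⟫ = 0 := inner_self_J _

theorem contDiffOn_J_nu (h : Regular S η) : ContDiffOn ℝ 4 (fun p => J (nu η p)) S :=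
  h.contDiffOn_clm_nu JL

theorem continuousOn_dirDeriv_J_nu (h : Regular S η) {f : Point n → ℝ} (hf : ContDiffOn ℝ 1 f S) :
    ContinuousOn (dirDeriv S f (fun p => J (nu η p))) S :=
  (contDiffOn_dirDeriv (k := 0) h.hyp h.normal h.nonchar (by norm_num) (by simpa using hf)
    ((contDiffOn_J_nu h).of_le (by norm_num)) fun p _ => inner_nu_J_nu p).continuousOn

theorem continuousOn_div_J_nu (h : Regular S η) {f : Point n → ℝ} (hf : ContDiffOn ℝ 1 f S) :
    ContinuousOn (fun p => dirDeriv S f (fun p => J (nu η p)) p + 2 * n * alpha η p * f p) S :=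
  (continuousOn_dirDeriv_J_nu h hf).add
    ((continuousOn_const.mul h.contDiffOn_alpha.continuousOn).mul hf.continuousOn)

theorem div_J_nu_eq_zero {f : Point n → ℝ} {K : Set (Point n)} (hK : IsClosed K)
    (hf0 : ∀ p ∈ S, p ∉ K → f p = 0) {p : Point n} (hp : p ∈ S) (hpK : p ∉ K) :
    dirDeriv S f (fun p => J (nu η p)) p + 2 * n * alpha η p * f p = 0 := by
  rw [dirDeriv, fderivWithin_eq_zero_of_notMem hK hf0 hp hpK, hf0 p hp hpK]
  simp

namespace GraphChart

variable {c : GraphChart S η}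

/-- Multiplied by the density of σ_H, the integrand becomes s times the Euclidean divergence of f ·
`rotField`, a field with compact support in the parameter domain. -/
theorem integral_div_J_nu (h : Regular S η) {f : Point n → ℝ} (hf : ContDiffOn ℝ 1 f S)
    {K : Set (Point n)} (hK : IsCompact K) (hKS : K ⊆ S ∩ c.U)
    (hf0 : ∀ p ∈ S, p ∉ K → f p = 0) :
    ∫ p, (dirDeriv S f (fun p => J (nu η p)) p + 2 * n * alpha η p * f p) ∂(sigmaH S η) = 0 := by
  have h1 : ∀ᵐ p ∂(sigmaH S η), p ∉ c.U →
      dirDeriv S f (fun p => J (nu η p)) p + 2 * n * alpha η p * f p = 0 := by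
    filter_upwards [ae_mem_sigmaH h] with p hp hpU
    exact div_J_nu_eq_zero hK.isClosed hf0 hp fun hpK => hpU (hKS hpK).2
  rw [← setIntegral_eq_integral_of_ae_compl_eq_zero h1,
    setIntegral_sigmaH h (continuousOn_div_J_nu h hf)]
  have hfΓ : ContDiffOn ℝ 1 (f ∘ c.Γ) c.Ω := contDiffOn_comp_Γ (by norm_num) hf
  have h2 : ∀ u ∈ c.Ω, ‖c.hN u‖ * (dirDeriv S f (fun p => J (nu η p)) (c.Γ u) +
      2 * n * alpha η (c.Γ u) * f (c.Γ u)) =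
      c.s * LinearMap.trace ℝ (EuclideanSpace ℝ (Fin (2 * n)))
        (fderiv ℝ (fun v => f (c.Γ v) • c.rotField v) u).toLinearMap := by
    intro u hu
    have hp := (Γ_mem hu).1
    have hN0 : ‖c.hN u‖ ≠ 0 := norm_ne_zero_iff.2 (hN_ne_zero h.nonchar hu)
    have e1 : HasFDerivAt (fun v => f (c.Γ v) • c.rotField v) _ u :=
      (((hfΓ.contDiffAt (c.isOpen_Ω.mem_nhds hu)).differentiableAt
        one_ne_zero).hasFDerivAt).smul (hasFDerivAt_rotField hu)
    have e2 : (fderiv ℝ (fun v => f (c.Γ v) • c.rotField v) u).toLinearMap =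
        f (c.Γ u) • (fderiv ℝ c.rotField u).toLinearMap +
          (fderiv ℝ (f ∘ c.Γ) u).toLinearMap.smulRight (c.rotField u) := by
      rw [e1.fderiv, (hasFDerivAt_rotField hu).fderiv]
      rfl
    rw [e2, map_add, map_smul, trace_fderiv_rotField hu, LinearMap.trace_smulRight, dirDeriv,
      fderivWithin_tangent hu (hf.differentiableOn one_ne_zero _ hp)
        (inner_lift_eq_zero h.nonchar hp (inner_nu_J_nu _)), nu_Γ hu, J_smul, lift_smul, hN,
      lift_J_horPart, map_smul, map_smul, alpha_Γ hu, hN]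
    rw [hN] at hN0
    change _ * (_ • fderiv ℝ (f ∘ c.Γ) u (c.rotField u) + _) =
      _ * (_ + fderiv ℝ (f ∘ c.Γ) u (c.rotField u))
    simp only [smul_eq_mul]
    field_simp
    ring
  rw [setIntegral_congr_fun c.isOpen_Ω.measurableSet h2, integral_const_mul,
    setIntegral_trace_fderiv_eq_zero c.isOpen_Ω (K := c.π '' K) (hK.image c.π.continuous) ?_ ?_ ?_,
    mul_zero]
  · rintro _ ⟨p, hp, rfl⟩
    obtain ⟨u, hu, rfl⟩ := exists_eq_Γ (hKS hp).1 (hKS hp).2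
    rwa [π_Γ]
  · exact hfΓ.smul (contDiffOn_rotField.of_le (by norm_num))
  · intro u hu huK
    rw [hf0 _ (Γ_mem hu).1 fun hK' => huK ⟨_, hK', c.π_Γ u⟩, zero_smul]

end GraphChart

/-- The divergence theorem for the characteristic field `Jν`. -/
theorem integral_div_J_nu (h : Regular S η) {f : Point n → ℝ} (hf : IsC1c S f) :
    ∫ p, (dirDeriv S f (fun p => J (nu η p)) p + 2 * n * alpha η p * f p) ∂(sigmaH S η) = 0 := by
  obtain ⟨hf, K, hKS, hK, hf0⟩ := hf
  -- A smooth partition of unity subordinate to chart domains over the compact support reduces the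
  -- claim to one chart. By local finiteness only finitely many terms meet the support.
  choose c hc using fun p : K => exists_graphChart h.hyp h.normal (hKS p.2)
  obtain ⟨χ, hχ⟩ := SmoothPartitionOfUnity.exists_isSubordinate (modelWithCornersSelf ℝ (Point n))
    hK.isClosed (fun p : K => (c p).U) (fun p => (c p).isOpen_U)
    fun p hp => mem_iUnion.2 ⟨⟨p, hp⟩, hc ⟨p, hp⟩⟩
  have hfin := χ.locallyFinite.finite_nonempty_inter_compact hK
  set T := hfin.toFinset with hT
  have hχs : ∀ i, ContDiff ℝ 1 (χ i) := fun i => ((χ i).contMDiff.contDiff).of_le (by simp)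
  have hsum : ∀ p ∈ S, f p = ∑ i ∈ T, χ i p * f p := by
    intro p hp
    by_cases hpK : p ∈ K
    · rw [← Finset.sum_mul, ← finsum_eq_sum_of_support_subset, χ.sum_eq_one hpK, one_mul]
      intro i hi
      exact hfin.mem_toFinset.2 ⟨p, hi, hpK⟩
    · simp [hf0 p hp hpK]
  have hfi : ∀ i, ContDiffOn ℝ 1 (fun p => χ i p * f p) S := fun i => (hχs i).contDiffOn.mul hf
  have hfi0 : ∀ i, ∀ p ∈ S, p ∉ K ∩ tsupport (χ i) → χ i p * f p = 0 := by
    intro i p hp hpK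
    by_cases hpK' : p ∈ K
    · have : p ∉ tsupport (χ i) := fun h' => hpK ⟨hpK', h'⟩
      rw [image_eq_zero_of_notMem_tsupport this, zero_mul]
    · rw [hf0 p hp hpK', mul_zero]
  have hKi : ∀ i, IsCompact (K ∩ tsupport (χ i)) := fun i => hK.inter_right (isClosed_tsupport _)
  have hderiv : ∀ p ∈ S, dirDeriv S f (fun p => J (nu η p)) p + 2 * n * alpha η p * f p =
      ∑ i ∈ T, (dirDeriv S (fun p => χ i p * f p) (fun p => J (nu η p)) p +
        2 * n * alpha η p * (χ i p * f p)) := by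
    intro p hp
    have e1 : HasFDerivWithinAt (fun q => ∑ i ∈ T, χ i q * f q) _ S p :=
      HasFDerivWithinAt.fun_sum fun i _ =>
        ((hfi i).differentiableOn one_ne_zero p hp).hasFDerivWithinAt
    have e2 := fderivWithin_apply_of_tangent h.hyp h.normal hp
      (e1.congr (fun q hq => hsum q hq) (hsum p hp)) (h.tangent hp (inner_nu_J_nu p))
    rw [Finset.sum_add_distrib, ← Finset.mul_sum, ← hsum p hp, dirDeriv, e2]
    simp [dirDeriv]
  have hae : ∀ᵐ p ∂(sigmaH S η), dirDeriv S f (fun p => J (nu η p)) p +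
      2 * n * alpha η p * f p =
      ∑ i ∈ T, (dirDeriv S (fun p => χ i p * f p) (fun p => J (nu η p)) p +
        2 * n * alpha η p * (χ i p * f p)) := by
    filter_upwards [ae_mem_sigmaH h] with p hp using hderiv p hp
  rw [integral_congr_ae hae, integral_finsetSum _ fun i _ =>
    integrable_sigmaH h (continuousOn_div_J_nu h (hfi i)) (hKi i)
      (inter_subset_left.trans hKS) fun p hp hpK =>
        div_J_nu_eq_zero (hKi i).isClosed (hfi0 i) hp hpK]
  exact Finset.sum_eq_zero fun i _ => GraphChart.integral_div_J_nu (c := c i) h (hfi i) (hKi i)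
    (fun p hp => ⟨hKS hp.1, hχ i hp.2⟩) (hfi0 i)

end Heisenberg

/-! ### The zero set of ℓ -/

namespace Heisenberg

variable {S : Set (Point 2)} {η : Point 2 → Point 2}

/-- The logarithmic derivative of `ℓ`. -/
def ellRate (S : Set (Point 2)) (η : Point 2 → Point 2) (p w : Point 2) : ℝ :=
  -4 * alpha η p * ⟪fieldV η p, hor w⟫ -
    2 * alpha η p * ell S η p * (⟪w, vertical⟫ - ⟪J (hor w), hor p⟫)

theorem eq_lift_add (p w : Point 2) :
    w = lift p (hor w) + (⟪w, vertical⟫ - ⟪J (hor w), hor p⟫) • vertical := by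
  rw [lift_eq, add_assoc, ← add_smul, add_sub_cancel]
  ext (a | a)
  · simp [vertical]
  · rw [inner_vertical]
    simp [vertical]

namespace Adapted

variable (h : Adapted S η)
include h

/-- The directions V, A, B and T - αν span the tangent space, and in each of them the derivative of
ℓ is known and has ℓ as a factor. -/
theorem fderivWithin_ell {p : Point 2} (hp : p ∈ S) {w : Point 2} (hw : ⟪η p, w⟫ = 0) :
    fderivWithin ℝ (ell S η) S p w = ell S η p * ellRate S η p w := by
  set r := ⟪w, vertical⟫ - ⟪J (hor w), hor p⟫ with hr
  have h1 : w = lift p (hor w) + r • vertical := eq_lift_add p w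
  rw [h1, inner_eq_zero_iff h.nonchar hp] at hw
  -- Subtracting r(T - αν) from w leaves a horizontal vector, and the tangency of w makes it
  -- orthogonal to ν.
  have h2 : ⟪nu η p, hor w + (r * alpha η p) • nu η p⟫ = 0 := by
    rw [inner_add_right, inner_smul_right, h.inner_nu_nu hp]
    linarith
  have h3 : w = lift p (hor w + (r * alpha η p) • nu η p) +
      r • (vertical - alpha η p • lift p (nu η p)) := by
    conv_lhs => rw [h1]
    rw [lift_add, lift_smul]
    module
  have e1 : fderivWithin ℝ (ell S η) S p (lift p (fieldV η p)) = -4 * alpha η p * ell S η p :=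
    (h.dirDeriv_ell_and_alpha hp).1
  have e2 : fderivWithin ℝ (ell S η) S p (lift p (fieldA η p)) = 0 := h.dirDeriv_ell_fieldA hp
  have e3 : fderivWithin ℝ (ell S η) S p (lift p (fieldB η p)) = 0 := h.dirDeriv_ell_fieldB hp
  conv_lhs => rw [h3, h.eq_sum_frame hp h2]
  rw [map_add, map_smul, h.fderivWithin_ell_vertical hp, lift_add, lift_add, lift_smul, lift_smul,
    lift_smul, map_add, map_add, map_smul, map_smul, map_smul, e1, e2, e3, inner_add_right,
    inner_smul_right, inner_fieldV_nu, ellRate]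
  simp only [smul_eq_mul]
  ring

/-- Along the segment joining two parameters in the convex domain, ℓ satisfies a linear differential
equation with bounded coefficient, so Grönwall's inequality propagates a zero. -/
theorem ell_eq_zero_of_chart (c : GraphChart S η) {p q : Point 2} (hp : p ∈ S ∩ c.U)
    (hq : q ∈ S ∩ c.U) (h0 : ell S η p = 0) : ell S η q = 0 := by
  obtain ⟨u, hu, rfl⟩ := GraphChart.exists_eq_Γ hp.1 hp.2
  obtain ⟨v, hv, rfl⟩ := GraphChart.exists_eq_Γ hq.1 hq.2
  set γ : ℝ → EuclideanSpace ℝ (Fin (2 * 2)) := fun t => u + t • (v - u) with hγ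
  have hγΩ : ∀ t ∈ Icc (0 : ℝ) 1, γ t ∈ c.Ω := fun t ht =>
    c.convex_Ω.add_smul_sub_mem hu hv ht
  have hγd : ∀ t, HasDerivAt γ (v - u) t := fun t => by
    exact (((hasDerivAt_id t).smul_const (v - u)).const_add u).congr_deriv (one_smul _ _)
  have hγc : ContinuousOn γ (Icc 0 1) := fun t _ => (hγd t).continuousAt.continuousWithinAt
  have hmem : ∀ t ∈ Icc (0 : ℝ) 1, c.Γ (γ t) ∈ S := fun t ht =>
    (GraphChart.Γ_mem (hγΩ t ht)).1
  have hΓc : ContinuousOn (fun t => c.Γ (γ t)) (Icc 0 1) :=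
    GraphChart.contDiffOn_Γ.continuousOn.comp hγc hγΩ
  have hΓ'c : ContinuousOn (fun t => c.Γ' (γ t) (v - u)) (Icc 0 1) :=
    (GraphChart.contDiffOn_Γ'.continuousOn.comp hγc hγΩ).clm_apply continuousOn_const
  have hlc : ContinuousOn (fun t => ell S η (c.Γ (γ t))) (Icc 0 1) :=
    h.contDiffOn_ell.continuousOn.comp hΓc hmem
  have hac : ContinuousOn (fun t => alpha η (c.Γ (γ t))) (Icc 0 1) :=
    h.contDiffOn_alpha.continuousOn.comp hΓc hmem
  have hVc : ContinuousOn (fun t => fieldV η (c.Γ (γ t))) (Icc 0 1) :=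
    h.contDiffOn_fieldV.continuousOn.comp hΓc hmem
  have hrc : ContinuousOn (fun t => ellRate S η (c.Γ (γ t)) (c.Γ' (γ t) (v - u))) (Icc 0 1) := by
    have hh := hor.continuous.comp_continuousOn hΓ'c
    exact ((continuousOn_const.mul hac).mul (hVc.inner hh)).sub
      (((continuousOn_const.mul hac).mul hlc).mul ((hΓ'c.inner continuousOn_const).sub
        ((JL.continuous.comp_continuousOn hh).inner (hor.continuous.comp_continuousOn hΓc))))
  obtain ⟨K, hK⟩ := isCompact_Icc.exists_bound_of_continuousOn hrc
  have hd : ∀ t ∈ Icc (0 : ℝ) 1, HasDerivAt (fun t => ell S η (c.Γ (γ t)))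
      (ell S η (c.Γ (γ t)) * ellRate S η (c.Γ (γ t)) (c.Γ' (γ t) (v - u))) t := by
    intro t ht
    have e1 := GraphChart.hasFDerivAt_comp_Γ (hγΩ t ht)
      (h.contDiffOn_ell.differentiableOn (by norm_num) _ (hmem t ht)).hasFDerivWithinAt
    have e2 := e1.comp_hasDerivAt t (hγd t)
    rwa [ContinuousLinearMap.comp_apply,
      h.fderivWithin_ell (hmem t ht) (GraphChart.inner_η_Γ' (hγΩ t ht) _)] at e2
  have h1 := eq_zero_of_abs_deriv_le_mul_abs_self_of_eq_zero_right (K := K) hlc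
    (fun t ht => (hd t (Ico_subset_Icc_self ht)).hasDerivWithinAt)
    (by simpa [hγ] using h0)
    (fun t ht => by
      rw [norm_mul, mul_comm]
      exact mul_le_mul_of_nonneg_right (hK t (Ico_subset_Icc_self ht)) (norm_nonneg _))
    1 (right_mem_Icc.2 zero_le_one)
  simpa [hγ] using h1

/-- On a connected hypersurface, `ℓ` vanishes identically or has no zeros. -/
theorem ell_eq_zero_or_ne_zero (hS : IsPreconnected S) :
    (∀ p ∈ S, ell S η p = 0) ∨ ∀ p ∈ S, ell S η p ≠ 0 := by
  have : PreconnectedSpace S := Subtype.preconnectedSpace hS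
  have hclopen : IsClopen {p : S | ell S η p = 0} := by
    constructor
    · exact isClosed_singleton.preimage
        (continuousOn_iff_continuous_domRestrict.1 h.contDiffOn_ell.continuousOn)
    · rw [isOpen_iff_mem_nhds]
      intro p hp
      obtain ⟨c, hc⟩ := exists_graphChart h.hyp h.normal p.2
      filter_upwards [continuous_subtype_val.continuousAt.preimage_mem_nhds
        (c.isOpen_U.mem_nhds hc)] with q hq
      exact h.ell_eq_zero_of_chart c ⟨p.2, hc⟩ ⟨q.2, hq⟩ hp
  rcases isClopen_iff.1 hclopen with h1 | h1
  · right
    intro p hp h0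
    have : (⟨p, hp⟩ : S) ∈ {p : S | ell S η p = 0} := h0
    rw [h1] at this
    exact this
  · left
    intro p hp
    have : (⟨p, hp⟩ : S) ∈ {p : S | ell S η p = 0} := h1 ▸ mem_univ _
    exact this

end Adapted

end Heisenberg

/-! ### The stability inequality with weight |ℓ|^β -/

namespace Heisenberg

section Products

variable {n : ℕ} {S : Set (Point n)} {η : Point n → Point n}

theorem dirDeriv_comp (h : Regular S η) {φ : Point n → ℝ} {g : ℝ → ℝ} {g' : ℝ}
    {X : Point n → HVec n} {p : Point n} (hp : p ∈ S) (hX : ⟪nu η p, X p⟫ = 0)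
    (hg : HasDerivAt g g' (φ p)) (hφ : ContDiffOn ℝ 1 φ S) :
    dirDeriv S (fun q => g (φ q)) X p = g' * dirDeriv S φ X p :=
  fderivWithin_apply_of_tangent h.hyp h.normal hp (hg.comp_hasFDerivWithinAt p
    (hφ.differentiableOn one_ne_zero p hp).hasFDerivWithinAt) (h.tangent hp hX)

theorem dirDeriv_mul (h : Regular S η) {φ ψ : Point n → ℝ} {X : Point n → HVec n} {p : Point n}
    (hp : p ∈ S) (hX : ⟪nu η p, X p⟫ = 0) (hφ : ContDiffOn ℝ 1 φ S) (hψ : ContDiffOn ℝ 1 ψ S) :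
    dirDeriv S (fun q => φ q * ψ q) X p = φ p * dirDeriv S ψ X p + ψ p * dirDeriv S φ X p :=
  fderivWithin_apply_of_tangent h.hyp h.normal hp
    ((hφ.differentiableOn one_ne_zero p hp).hasFDerivWithinAt.mul
      (hψ.differentiableOn one_ne_zero p hp).hasFDerivWithinAt) (h.tangent hp hX)

theorem continuousOn_dirDeriv (h : Regular S η) {φ : Point n → ℝ} {X : Point n → HVec n}
    (hφ : ContDiffOn ℝ 1 φ S) (hX : ContDiffOn ℝ 4 X S) (hXν : ∀ p ∈ S, ⟪nu η p, X p⟫ = 0) :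
    ContinuousOn (dirDeriv S φ X) S :=
  (contDiffOn_dirDeriv (k := 0) h.hyp h.normal h.nonchar (by norm_num) (by simpa using hφ)
    (hX.of_le (by norm_num)) hXν).continuousOn

theorem IsC1c.mul_left {ρ φ : Point n → ℝ} (hφ : IsC1c S φ) (hρ : ContDiffOn ℝ 1 ρ S) :
    IsC1c S (fun p => ρ p * φ p) := by
  obtain ⟨h1, K, hKS, hK, h0⟩ := hφ
  exact ⟨hρ.mul h1, K, hKS, hK, fun p hp hpK => by simp [h0 p hp hpK]⟩

theorem IsC1c.comp {φ : Point n → ℝ} (hφ : IsC1c S φ) {g : ℝ → ℝ} (hg : ContDiff ℝ 1 g)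
    (hg0 : g 0 = 0) : IsC1c S (fun p => g (φ p)) := by
  obtain ⟨h1, K, hKS, hK, h0⟩ := hφ
  exact ⟨hg.comp_contDiffOn h1, K, hKS, hK, fun p hp hpK => by simp [h0 p hp hpK, hg0]⟩

end Products

variable {S : Set (Point 2)} {η : Point 2 → Point 2}

theorem symSffSq_nonneg (p : Point 2) : 0 ≤ symSffSq S η p :=
  Finset.sum_nonneg fun _ _ => Finset.sum_nonneg fun _ _ => sq_nonneg _

namespace Adapted

variable (h : Adapted S η)
include h

theorem norm_tGrad_sq (φ : Point 2 → ℝ) {p : Point 2} (hp : p ∈ S) :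
    ‖tGrad S η φ p‖ ^ 2 = dirDeriv S φ (fieldV η) p ^ 2 + dirDeriv S φ (fieldA η) p ^ 2 +
      dirDeriv S φ (fieldB η) p ^ 2 := by
  rw [EuclideanSpace.norm_sq_eq]
  have := h.sum_sq_proj hp (f :=
    { toFun := fun v => fderivWithin ℝ φ S p (lift p v)
      map_add' := fun v w => by rw [lift_add, map_add]
      map_smul' := fun r v => by rw [lift_smul, map_smul]; rfl })
  simpa [tGrad, tDeriv, dirDeriv, sq_abs] using this

theorem continuousOn_norm_tGrad_sq {φ : Point 2 → ℝ} (hφ : ContDiffOn ℝ 1 φ S) :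
    ContinuousOn (fun p => ‖tGrad S η φ p‖ ^ 2) S := by
  refine ContinuousOn.congr (((?_ : ContinuousOn _ S).add ?_).add ?_)
    fun p hp => h.norm_tGrad_sq φ hp
  · exact (continuousOn_dirDeriv h.toRegular hφ h.contDiffOn_fieldV
      fun p _ => inner_nu_fieldV p).pow 2
  · exact (continuousOn_dirDeriv h.toRegular hφ h.contDiffOn_fieldA
      fun p _ => inner_nu_fieldA p).pow 2
  · exact (continuousOn_dirDeriv h.toRegular hφ h.contDiffOn_fieldB
      fun p _ => inner_nu_fieldB p).pow 2

theorem tGrad_sq_eq_zero {φ : Point 2 → ℝ} {K : Set (Point 2)} (hK : IsClosed K)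
    (hφ : ∀ p ∈ S, p ∉ K → φ p = 0) {p : Point 2} (hp : p ∈ S) (hpK : p ∉ K) :
    ‖tGrad S η φ p‖ ^ 2 = 0 := by
  rw [h.norm_tGrad_sq φ hp]
  simp [dirDeriv, fderivWithin_eq_zero_of_notMem hK hφ hp hpK]

theorem continuousOn_jnuAlpha : ContinuousOn (jnuAlpha S η) S :=
  continuousOn_dirDeriv h.toRegular (h.contDiffOn_alpha.of_le (by norm_num)) h.contDiffOn_fieldV
    fun p _ => inner_nu_fieldV p

theorem continuousOn_symSffSq : ContinuousOn (symSffSq S η) S := by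
  refine ContinuousOn.congr (f := fun p => 3 * ell S η p ^ 2 -
    2 * (jnuAlpha S η p + alpha η p ^ 2)) ?_ fun p hp => (h.dirDeriv_ell_and_alpha hp).2
  exact (continuousOn_const.mul (h.contDiffOn_ell.continuousOn.pow 2)).sub
    (continuousOn_const.mul (h.continuousOn_jnuAlpha.add (h.contDiffOn_alpha.continuousOn.pow 2)))

/-- The function is |ℓ|^β, written with ℓ² so that it is visibly smooth where ℓ has no zeros. This
is why the alternative on the zeros of ℓ is needed before choosing the test function. -/
theorem contDiffOn_ell_rpow (h0 : ∀ p ∈ S, ell S η p ≠ 0) (β : ℝ) :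
    ContDiffOn ℝ 1 (fun p => (ell S η p ^ 2) ^ (β / 2)) S :=
  ((h.contDiffOn_ell.of_le (by norm_num)).pow 2).rpow_const_of_ne fun p hp =>
    pow_ne_zero 2 (h0 p hp)

theorem dirDeriv_ell_rpow {p : Point 2} (hp : p ∈ S) (h0 : ell S η p ≠ 0) (β : ℝ)
    {X : Point 2 → HVec 2} (hX : ⟪nu η p, X p⟫ = 0) :
    dirDeriv S (fun p => (ell S η p ^ 2) ^ (β / 2)) X p =
      -4 * β * alpha η p * (ell S η p ^ 2) ^ (β / 2) * ⟪fieldV η p, X p⟫ := by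
  have h2 : HasDerivAt (fun x : ℝ => (x ^ 2) ^ (β / 2)) _ (ell S η p) :=
    (hasDerivAt_pow 2 (ell S η p)).rpow_const (p := β / 2) (Or.inl (pow_ne_zero 2 h0))
  rw [dirDeriv_comp (φ := ell S η) h.toRegular hp hX h2 (h.contDiffOn_ell.of_le (by norm_num)),
    dirDeriv, h.fderivWithin_ell hp (h.tangent hp hX), ellRate, hor_lift,
    Real.rpow_sub_one (pow_ne_zero 2 h0)]
  have h3 : ⟪lift p (X p), vertical⟫ - ⟪J (X p), hor p⟫ = 0 := by
    rw [lift_eq, inner_add_left, inner_incl_vertical, inner_smul_left]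
    simp
  rw [h3]
  field_simp
  ring

/-- The weighted stability inequality. -/
theorem integral_weighted_le (hst : IsStable S η)
    (h0 : ∀ p ∈ S, ell S η p ≠ 0) {β : ℝ} (hβ : 0 < 12 - (4 * β - 5) ^ 2) {ψ : Point 2 → ℝ}
    (hψ : IsC1c S ψ) :
    ∫ p, (ell S η p ^ 2) ^ β * ψ p ^ 2 * ell S η p ^ 2 ∂(sigmaH S η) ≤
      16 / (12 - (4 * β - 5) ^ 2) *
        ∫ p, (ell S η p ^ 2) ^ β * ‖tGrad S η ψ p‖ ^ 2 ∂(sigmaH S η) := by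
  set d := 12 - (4 * β - 5) ^ 2 with hd
  set ρ : Point 2 → ℝ := fun p => (ell S η p ^ 2) ^ (β / 2) with hρ
  have hρ1 : ContDiffOn ℝ 1 ρ S := h.contDiffOn_ell_rpow h0 β
  have hα1 : ContDiffOn ℝ 1 (alpha η) S := h.contDiffOn_alpha.of_le (by norm_num)
  have hρ2 : ∀ p, (ell S η p ^ 2) ^ β = ρ p ^ 2 := fun p => by
    rw [hρ, ← Real.rpow_mul_natCast (sq_nonneg _)]
    congr 1
    push_cast
    ring
  have hξ : IsC1c S (fun p => ρ p * ψ p) := hψ.mul_left hρ1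
  -- With ξ = ρψ, the divergence theorem for f = αξ² reads ∫ (Vα) ξ² + 2αξ Vξ + 4α² ξ² = 0. It
  -- trades Vα, which has no useful lower bound against α², for terms that a square can absorb.
  have hf : IsC1c S (fun p => alpha η p * (ρ p * ψ p * (ρ p * ψ p))) :=
    (hξ.mul_left hξ.1).mul_left hα1
  have hst' := hst.2 _ hξ
  have hdiv := integral_div_J_nu h.toRegular hf
  obtain ⟨hψ1, K, hKS, hK, hψ0⟩ := hψ
  have hint : ∀ {f : Point 2 → ℝ}, ContinuousOn f S → (∀ p ∈ S, p ∉ K → f p = 0) →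
      Integrable f (sigmaH S η) := fun hc h0' => integrable_sigmaH h.toRegular hc hK hKS h0'
  have hξ0 : ∀ p ∈ S, p ∉ K → ρ p * ψ p = 0 := fun p hp hpK => by
    rw [hψ0 p hp hpK, mul_zero]
  have i1 : Integrable (fun p => stabFun S η p * (ρ p * ψ p) ^ 2) (sigmaH S η) := by
    refine hint ?_ fun p hp hpK => by rw [hξ0 p hp hpK]; ring
    exact ((h.continuousOn_symSffSq.add (continuousOn_const.mul h.continuousOn_jnuAlpha)).add
      (continuousOn_const.mul (h.contDiffOn_alpha.continuousOn.pow 2))).mul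
        (hξ.1.continuousOn.pow 2)
  have i2 : Integrable (fun p => ‖tGrad S η (fun p => ρ p * ψ p) p‖ ^ 2) (sigmaH S η) :=
    hint (h.continuousOn_norm_tGrad_sq hξ.1) fun p hp hpK =>
      h.tGrad_sq_eq_zero hK.isClosed hξ0 hp hpK
  have i3 := hint (continuousOn_div_J_nu h.toRegular hf.1) fun p hp hpK =>
    div_J_nu_eq_zero hK.isClosed (fun q hq hqK => by rw [hξ0 q hq hqK]; ring) hp hpK
  have i4 : Integrable (fun p => (ell S η p ^ 2) ^ β * ψ p ^ 2 * ell S η p ^ 2) (sigmaH S η) := by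
    simp only [hρ2]
    refine hint (((hρ1.continuousOn.pow 2).mul (hψ1.continuousOn.pow 2)).mul
      (h.contDiffOn_ell.continuousOn.pow 2)) fun p hp hpK => by rw [hψ0 p hp hpK]; ring
  have i5 : Integrable (fun p => (ell S η p ^ 2) ^ β * ‖tGrad S η ψ p‖ ^ 2) (sigmaH S η) := by
    simp only [hρ2]
    refine hint ((hρ1.continuousOn.pow 2).mul (h.continuousOn_norm_tGrad_sq hψ1))
      fun p hp hpK => by rw [h.tGrad_sq_eq_zero hK.isClosed hψ0 hp hpK, mul_zero]
  -- Subtract λ times the divergence identity, 2 ≤ λ < 6, and use q = 3ℓ² + 2Vα + 4α² and Vα + α² ≤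
  -- (3/4)ℓ². The coefficient of ℓ² becomes 3(6 - λ)/4 and that of α²ψ² becomes (λ - 1)(λ - 2) - (4β
  -- - λ)². The value λ = 5 gives 3/4 and d.
  have key : ∀ p ∈ S, 3 / 4 * ((ell S η p ^ 2) ^ β * ψ p ^ 2 * ell S η p ^ 2) -
      12 / d * ((ell S η p ^ 2) ^ β * ‖tGrad S η ψ p‖ ^ 2) ≤
      stabFun S η p * (ρ p * ψ p) ^ 2 - ‖tGrad S η (fun p => ρ p * ψ p) p‖ ^ 2 -
      5 * (dirDeriv S (fun p => alpha η p * (ρ p * ψ p * (ρ p * ψ p))) (fieldV η) p +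
        2 * (2 : ℕ) * alpha η p * (alpha η p * (ρ p * ψ p * (ρ p * ψ p)))) := by
    intro p hp
    have eV : dirDeriv S (fun p => ρ p * ψ p) (fieldV η) p =
        ρ p * (dirDeriv S ψ (fieldV η) p - 4 * β * alpha η p * ψ p) := by
      rw [dirDeriv_mul h.toRegular hp (inner_nu_fieldV p) hρ1 hψ1,
        h.dirDeriv_ell_rpow hp (h0 p hp) β (inner_nu_fieldV p), h.inner_fieldV_self hp]
      ring
    have eA : dirDeriv S (fun p => ρ p * ψ p) (fieldA η) p =
        ρ p * dirDeriv S ψ (fieldA η) p := by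
      rw [dirDeriv_mul h.toRegular hp (inner_nu_fieldA p) hρ1 hψ1,
        h.dirDeriv_ell_rpow hp (h0 p hp) β (inner_nu_fieldA p), inner_fieldV_fieldA]
      ring
    have eB : dirDeriv S (fun p => ρ p * ψ p) (fieldB η) p =
        ρ p * dirDeriv S ψ (fieldB η) p := by
      rw [dirDeriv_mul h.toRegular hp (inner_nu_fieldB p) hρ1 hψ1,
        h.dirDeriv_ell_rpow hp (h0 p hp) β (inner_nu_fieldB p), inner_fieldV_fieldB]
      ring
    have ef := dirDeriv_mul h.toRegular hp (inner_nu_fieldV p) hα1 (hξ.1.mul hξ.1)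
    rw [dirDeriv_mul h.toRegular hp (inner_nu_fieldV p) hξ.1 hξ.1, eV] at ef
    have hw := (h.dirDeriv_ell_and_alpha hp).2
    have hP := h.jnuAlpha_le hp
    have hj : dirDeriv S (alpha η) (fieldV η) p = jnuAlpha S η p := rfl
    rw [ef, hj, h.norm_tGrad_sq _ hp, h.norm_tGrad_sq _ hp, eV, eA, eB, hρ2, stabFun, hw]
    push_cast
    set a := alpha η p
    set j := jnuAlpha S η p
    set l := ell S η p
    set V := dirDeriv S ψ (fieldV η) p
    set A := dirDeriv S ψ (fieldA η) p
    set B := dirDeriv S ψ (fieldB η) p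
    -- Completing the square costs (12/d)(Vψ)². Since d ≤ 12, the same constant also dominates the A
    -- and B parts of |∇ψ|².
    have hd12 : 1 ≤ 12 / d := by
      rw [one_le_div hβ, hd]
      nlinarith [sq_nonneg (4 * β - 5)]
    have s1 : 0 ≤ ρ p ^ 2 * ψ p ^ 2 * (3 / 4 * l ^ 2 - (j + a ^ 2)) :=
      mul_nonneg (by positivity) (by linarith)
    have s2 : 0 ≤ ρ p ^ 2 * ((12 / d - 1) * (A ^ 2 + B ^ 2)) :=
      mul_nonneg (by positivity) (mul_nonneg (by linarith) (by positivity))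
    -- The terms d·α²ψ² - 2(5 - 4β)αψ Vψ - (Vψ)² equal this square minus (12/d)(Vψ)², because (5 -
    -- 4β)² = 12 - d.
    have s3 : 0 ≤ ρ p ^ 2 * (d * (a * ψ p - (5 - 4 * β) / d * V) ^ 2) := by positivity
    have s4 : ρ p ^ 2 * (d * (a * ψ p - (5 - 4 * β) / d * V) ^ 2) =
        ρ p ^ 2 * (d * a ^ 2 * ψ p ^ 2 - 2 * (5 - 4 * β) * a * ψ p * V +
          (12 / d - 1) * V ^ 2) := by
      have : (5 - 4 * β) ^ 2 = 12 - d := by rw [hd]; ring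
      field_simp
      linear_combination (ρ p ^ 2 * V ^ 2) * this
    rw [s4] at s3
    have hd' : d * a ^ 2 * ψ p ^ 2 = (12 - (4 * β - 5) ^ 2) * a ^ 2 * ψ p ^ 2 := rfl
    rw [hd'] at s3
    nlinarith [s1, s2, s3]
  have i12 : Integrable (fun p => stabFun S η p * (ρ p * ψ p) ^ 2 -
      ‖tGrad S η (fun p => ρ p * ψ p) p‖ ^ 2) (sigmaH S η) := i1.sub i2
  have hI := integral_mono_ae ((i4.const_mul (3 / 4)).sub (i5.const_mul (12 / d)))
    (i12.sub (i3.const_mul 5)) (by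
      filter_upwards [ae_mem_sigmaH h.toRegular] with p hp using key p hp)
  simp only [Pi.sub_apply] at hI
  rw [integral_sub (i4.const_mul _) (i5.const_mul _), integral_const_mul, integral_const_mul,
    integral_sub i12 (i3.const_mul 5), integral_const_mul, hdiv, integral_sub i1 i2] at hI
  have : 16 / d = 4 / 3 * (12 / d) := by ring
  rw [this]
  linarith

end Adapted

end Heisenberg

/-! ### Young's inequality and the L^(2β+2) estimates -/

/-- A weak form of Young's inequality for real powers. -/
theorem Real.rpow_mul_le_add {β ε u y : ℝ} (hβ : 0 < β) (hε : 0 < ε) (hu : 0 ≤ u) (hy : 0 ≤ y) :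
    u ^ β * y ≤ ε * u ^ (β + 1) + (ε⁻¹) ^ β * y ^ (β + 1) := by
  have h1 : u ^ (β + 1) = u ^ β * u := Real.rpow_add_one' hu (by linarith)
  have h2 : y ^ (β + 1) = y ^ β * y := Real.rpow_add_one' hy (by linarith)
  have hu' : 0 ≤ u ^ β := Real.rpow_nonneg hu _
  rw [h1, h2]
  rcases le_total y (ε * u) with h | h
  · have : 0 ≤ (ε⁻¹) ^ β * (y ^ β * y) := by positivity
    nlinarith [mul_le_mul_of_nonneg_left h hu']
  · have h3 : u ≤ ε⁻¹ * y := by rwa [← div_eq_inv_mul, le_div_iff₀' hε]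
    have h4 : u ^ β ≤ (ε⁻¹) ^ β * y ^ β := by
      rw [← Real.mul_rpow (by positivity) hy]
      exact Real.rpow_le_rpow hu h3 hβ.le
    have : 0 ≤ ε * (u ^ β * u) := by positivity
    nlinarith [mul_le_mul_of_nonneg_right h4 hy]

namespace Heisenberg

variable {S : Set (Point 2)} {η : Point 2 → Point 2}

namespace Adapted

variable (h : Adapted S η)
include h

theorem symSffSq_le (h3 : PropP3 S η) {p : Point 2} (hp : p ∈ S) :
    symSffSq S η p ≤ 3 * ell S η p ^ 2 := by
  rw [(h.dirDeriv_ell_and_alpha hp).2]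
  linarith [h3 p hp]

theorem tGrad_abs_rpow_sq {φ : Point 2 → ℝ} (hφ : ContDiffOn ℝ 1 φ S) {β : ℝ} (hβ : 0 < β)
    {p : Point 2} (hp : p ∈ S) :
    ‖tGrad S η (fun q => |φ q| ^ (β + 1)) p‖ ^ 2 =
      (β + 1) ^ 2 * ((φ p ^ 2) ^ β * ‖tGrad S η φ p‖ ^ 2) := by
  have hd := hasDerivAt_abs_rpow (φ p) (p := β + 1) (by linarith)
  have hc : ((β + 1) * |φ p| ^ (β + 1 - 2) * φ p) ^ 2 = (β + 1) ^ 2 * (φ p ^ 2) ^ β := by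
    rcases eq_or_ne (φ p) 0 with h0 | h0
    · simp [h0, Real.zero_rpow hβ.ne']
    · have e1 : |φ p| ^ (β + 1 - 2) = |φ p| ^ β / |φ p| := by
        rw [← Real.rpow_sub_one (abs_ne_zero.2 h0)]
        congr 1
        ring
      have e2 : (φ p ^ 2) ^ β = (|φ p| ^ β) ^ 2 := by
        rw [← sq_abs, ← Real.rpow_natCast, ← Real.rpow_natCast, ← Real.rpow_mul (abs_nonneg _),
          ← Real.rpow_mul (abs_nonneg _), mul_comm]
      rw [e1, e2, mul_pow, mul_pow, div_pow, sq_abs]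
      field_simp
  rw [h.norm_tGrad_sq _ hp, h.norm_tGrad_sq _ hp,
    dirDeriv_comp h.toRegular hp (inner_nu_fieldV p) hd hφ,
    dirDeriv_comp h.toRegular hp (inner_nu_fieldA p) hd hφ,
    dirDeriv_comp h.toRegular hp (inner_nu_fieldB p) hd hφ, ← mul_assoc, ← hc]
  ring

/-- The integral estimate for `ℓ`. -/
theorem integral_ell_rpow_le (hst : IsStable S η) (h0 : ∀ p ∈ S, ell S η p ≠ 0) {β : ℝ}
    (hβ0 : 0 < β) (hβ : 0 < 12 - (4 * β - 5) ^ 2) {φ : Point 2 → ℝ} (hφ : IsC1c S φ) :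
    ∫ p, (ell S η p ^ 2 * φ p ^ 2) ^ (β + 1) ∂(sigmaH S η) ≤
      (32 * (β + 1) ^ 2 / (12 - (4 * β - 5) ^ 2)) ^ (β + 1) *
        ∫ p, (‖tGrad S η φ p‖ ^ 2) ^ (β + 1) ∂(sigmaH S η) := by
  set d := 12 - (4 * β - 5) ^ 2 with hd
  have hψ : IsC1c S (fun q => |φ q| ^ (β + 1)) :=
    hφ.comp (g := fun x => |x| ^ (β + 1)) (contDiff_norm_rpow (by linarith))
      (by simp [Real.zero_rpow (by linarith : β + 1 ≠ 0)])
  have hle := h.integral_weighted_le hst h0 hβ hψ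
  obtain ⟨hφ1, K, hKS, hK, hφ0⟩ := hφ
  -- The weighted inequality with ψ = |φ|^(β+1) has the constant 16(β + 1)²/d = D/2. Young's
  -- inequality with ε = D⁻¹ then returns exactly half of the left-hand side, which is finite and
  -- can be absorbed.
  set D := 32 * (β + 1) ^ 2 / d with hD
  have hD0 : 0 < D := by positivity
  have i1 : Integrable (fun p => (ell S η p ^ 2 * φ p ^ 2) ^ (β + 1)) (sigmaH S η) := by
    refine integrable_sigmaH h.toRegular ?_ hK hKS fun p hp hpK => ?_
    · exact ((h.contDiffOn_ell.continuousOn.pow 2).mul (hφ1.continuousOn.pow 2)).rpow_const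
        fun _ _ => Or.inr (by linarith)
    · rw [hφ0 p hp hpK, zero_pow two_ne_zero, mul_zero, Real.zero_rpow (by linarith)]
  have i2 : Integrable (fun p => (‖tGrad S η φ p‖ ^ 2) ^ (β + 1)) (sigmaH S η) := by
    refine integrable_sigmaH h.toRegular ?_ hK hKS fun p hp hpK => ?_
    · exact (h.continuousOn_norm_tGrad_sq hφ1).rpow_const fun _ _ => Or.inr (by linarith)
    · rw [h.tGrad_sq_eq_zero hK.isClosed hφ0 hp hpK, Real.zero_rpow (by linarith)]
  have i3 : Integrable (fun p => (ell S η p ^ 2 * φ p ^ 2) ^ β * ‖tGrad S η φ p‖ ^ 2)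
      (sigmaH S η) := by
    refine integrable_sigmaH h.toRegular ?_ hK hKS fun p hp hpK => ?_
    · exact (((h.contDiffOn_ell.continuousOn.pow 2).mul (hφ1.continuousOn.pow 2)).rpow_const
        fun _ _ => Or.inr hβ0.le).mul (h.continuousOn_norm_tGrad_sq hφ1)
    · rw [h.tGrad_sq_eq_zero hK.isClosed hφ0 hp hpK, mul_zero]
  have e1 : ∫ p, (ell S η p ^ 2) ^ β * (|φ p| ^ (β + 1)) ^ 2 * ell S η p ^ 2 ∂(sigmaH S η) =
      ∫ p, (ell S η p ^ 2 * φ p ^ 2) ^ (β + 1) ∂(sigmaH S η) := by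
    refine integral_congr_ae (.of_forall fun p => ?_)
    have : (|φ p| ^ (β + 1)) ^ 2 = (φ p ^ 2) ^ (β + 1) := by
      rw [← sq_abs (φ p), ← Real.rpow_natCast, ← Real.rpow_natCast,
        ← Real.rpow_mul (abs_nonneg _), ← Real.rpow_mul (abs_nonneg _), mul_comm]
    simp only [this]
    rw [Real.mul_rpow (sq_nonneg _) (sq_nonneg _),
      Real.rpow_add_one' (sq_nonneg (ell S η p)) (by linarith)]
    ring
  have e2 : ∫ p, (ell S η p ^ 2) ^ β * ‖tGrad S η (fun q => |φ q| ^ (β + 1)) p‖ ^ 2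
      ∂(sigmaH S η) = (β + 1) ^ 2 *
      ∫ p, (ell S η p ^ 2 * φ p ^ 2) ^ β * ‖tGrad S η φ p‖ ^ 2 ∂(sigmaH S η) := by
    rw [← integral_const_mul]
    refine integral_congr_ae ?_
    filter_upwards [ae_mem_sigmaH h.toRegular] with p hp
    rw [h.tGrad_abs_rpow_sq hφ1 hβ0 hp, Real.mul_rpow (sq_nonneg _) (sq_nonneg _)]
    ring
  rw [e1, e2] at hle
  have hyoung : ∫ p, (ell S η p ^ 2 * φ p ^ 2) ^ β * ‖tGrad S η φ p‖ ^ 2 ∂(sigmaH S η) ≤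
      D⁻¹ * ∫ p, (ell S η p ^ 2 * φ p ^ 2) ^ (β + 1) ∂(sigmaH S η) +
        D ^ β * ∫ p, (‖tGrad S η φ p‖ ^ 2) ^ (β + 1) ∂(sigmaH S η) := by
    rw [← integral_const_mul, ← integral_const_mul,
      ← integral_add (i1.const_mul _) (i2.const_mul _)]
    refine integral_mono i3 ((i1.const_mul _).add (i2.const_mul _)) fun p => ?_
    have := Real.rpow_mul_le_add hβ0 (inv_pos.2 hD0)
      (by positivity : 0 ≤ ell S η p ^ 2 * φ p ^ 2) (sq_nonneg ‖tGrad S η φ p‖)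
    rwa [inv_inv] at this
  set I := ∫ p, (ell S η p ^ 2 * φ p ^ 2) ^ (β + 1) ∂(sigmaH S η)
  set Y := ∫ p, (‖tGrad S η φ p‖ ^ 2) ^ (β + 1) ∂(sigmaH S η)
  set M := ∫ p, (ell S η p ^ 2 * φ p ^ 2) ^ β * ‖tGrad S η φ p‖ ^ 2 ∂(sigmaH S η)
  have h1 : 16 / d * ((β + 1) ^ 2 * M) = D / 2 * M := by rw [hD]; ring
  rw [h1] at hle
  have h2 := mul_le_mul_of_nonneg_left hyoung (by positivity : 0 ≤ D / 2)
  have h3 : D / 2 * (D⁻¹ * I + D ^ β * Y) = I / 2 + D ^ (β + 1) * Y / 2 := by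
    rw [Real.rpow_add_one hD0.ne']
    field_simp
  linarith

end Adapted

theorem integral_symSffNorm_eq_zero (h : Regular S η) (hw : ∀ p ∈ S, symSffSq S η p ≤ 0)
    {r : ℝ} (hr : 0 < r) (φ : Point 2 → ℝ) :
    ∫ p, symSffNorm S η p ^ r * |φ p| ^ r ∂(sigmaH S η) = 0 := by
  refine integral_eq_zero_of_ae ?_
  filter_upwards [ae_mem_sigmaH h] with p hp
  rw [symSffNorm, Real.sqrt_eq_zero_of_nonpos (hw p hp), Real.zero_rpow hr.ne', zero_mul,
    Pi.zero_apply]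

/-- By (P3), |h̃|² ≤ 3ℓ² pointwise, so the estimate for ℓ passes to |h̃| with the extra factor
3^(β+1). -/
theorem Adapted.integral_symSffNorm_le (h : Adapted S η) (h3 : PropP3 S η) (hst : IsStable S η)
    (h0 : ∀ p ∈ S, ell S η p ≠ 0) {β : ℝ} (hβ0 : 0 < β) (hβ : 0 < 12 - (4 * β - 5) ^ 2)
    {φ : Point 2 → ℝ} (hφ : IsC1c S φ) :
    ∫ p, symSffNorm S η p ^ (2 * β + 2) * |φ p| ^ (2 * β + 2) ∂(sigmaH S η) ≤
      (3 : ℝ) ^ (β + 1) * (32 * (β + 1) ^ 2 / (12 - (4 * β - 5) ^ 2)) ^ (β + 1) *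
        ∫ p, ‖tGrad S η φ p‖ ^ (2 * β + 2) ∂(sigmaH S η) := by
  have hpow : ∀ x : ℝ, 0 ≤ x → x ^ (2 * β + 2) = (x ^ 2) ^ (β + 1) := fun x hx => by
    rw [← Real.rpow_natCast, ← Real.rpow_mul hx]
    congr 1
    push_cast
    ring
  have hle := h.integral_ell_rpow_le hst h0 hβ0 hβ hφ
  have e1 : ∀ p, symSffNorm S η p ^ (2 * β + 2) * |φ p| ^ (2 * β + 2) =
      (symSffSq S η p * φ p ^ 2) ^ (β + 1) := fun p => by
    rw [symSffNorm, hpow _ (Real.sqrt_nonneg _), hpow _ (abs_nonneg _),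
      Real.sq_sqrt (symSffSq_nonneg p), sq_abs, Real.mul_rpow (symSffSq_nonneg p) (sq_nonneg _)]
  have e2 : ∀ p, ‖tGrad S η φ p‖ ^ (2 * β + 2) = (‖tGrad S η φ p‖ ^ 2) ^ (β + 1) := fun p =>
    hpow _ (norm_nonneg _)
  simp only [e1, e2]
  rw [mul_assoc]
  refine le_trans ?_ (mul_le_mul_of_nonneg_left hle (by positivity))
  rw [← integral_const_mul]
  obtain ⟨hφ1, K, hKS, hK, hφ0⟩ := hφ
  refine integral_mono_ae ?_ (Integrable.const_mul ?_ _) ?_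
  · refine integrable_sigmaH h.toRegular ?_ hK hKS fun p hp hpK => ?_
    · exact (h.continuousOn_symSffSq.mul (hφ1.continuousOn.pow 2)).rpow_const
        fun _ _ => Or.inr (by linarith)
    · rw [hφ0 p hp hpK, zero_pow two_ne_zero, mul_zero, Real.zero_rpow (by linarith)]
  · refine integrable_sigmaH h.toRegular ?_ hK hKS fun p hp hpK => ?_
    · exact ((h.contDiffOn_ell.continuousOn.pow 2).mul (hφ1.continuousOn.pow 2)).rpow_const
        fun _ _ => Or.inr (by linarith)
    · rw [hφ0 p hp hpK, zero_pow two_ne_zero, mul_zero, Real.zero_rpow (by linarith)]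
  · filter_upwards [ae_mem_sigmaH h.toRegular] with p hp
    rw [← Real.mul_rpow (by norm_num) (by positivity)]
    refine Real.rpow_le_rpow (mul_nonneg (symSffSq_nonneg p) (sq_nonneg _)) ?_ (by linarith)
    rw [← mul_assoc]
    exact mul_le_mul_of_nonneg_right (h.symSffSq_le h3 hp) (sq_nonneg _)

end Heisenberg
end

/-! ### The theorem: range of β and the two cases for k -/

theorem theorem1p4 (k : ℝ) (hk : k ∈ Set.Icc (0 : ℝ) 2) (β : ℝ)
    (hβ : β ∈ Set.Ico (1 - k / 3) (1 + Real.sqrt (k / 3))) :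
    ∃ C : ℝ, 0 < C ∧
      ∀ (S : Set (Heisenberg.Point 2)) (η : Heisenberg.Point 2 → Heisenberg.Point 2),
        Heisenberg.IsHypersurface S → IsConnected S → Heisenberg.IsUnitNormal S η →
        Heisenberg.IsNonCharacteristic S η → Heisenberg.IsStable S η →
        Heisenberg.PropP1 S η → Heisenberg.PropP2 S η → Heisenberg.PropP3 S η →
        (∀ p ∈ S, 0 ≤ Heisenberg.gFun S η k p) →
        ∀ φ : Heisenberg.Point 2 → ℝ, Heisenberg.IsC1c S φ →
          ∫ p, Heisenberg.symSffNorm S η p ^ (2 * β + 2) * |φ p| ^ (2 * β + 2)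
              ∂(Heisenberg.sigmaH S η) ≤
            C * ∫ p, ‖Heisenberg.tGrad S η φ p‖ ^ (2 * β + 2) ∂(Heisenberg.sigmaH S η) := by
  obtain ⟨hk0, hk2⟩ := hk
  obtain ⟨hβ1, hβ2⟩ := hβ
  have hβ0 : 0 < β := by linarith
  have trivial_of_nonpos : ∀ {C : ℝ}, 0 < C → ∀ {S : Set (Heisenberg.Point 2)}
      {η : Heisenberg.Point 2 → Heisenberg.Point 2}, Heisenberg.Regular S η →
      (∀ p ∈ S, Heisenberg.symSffSq S η p ≤ 0) → ∀ φ : Heisenberg.Point 2 → ℝ,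
      ∫ p, Heisenberg.symSffNorm S η p ^ (2 * β + 2) * |φ p| ^ (2 * β + 2)
          ∂(Heisenberg.sigmaH S η) ≤
        C * ∫ p, ‖Heisenberg.tGrad S η φ p‖ ^ (2 * β + 2) ∂(Heisenberg.sigmaH S η) := by
    intro C hC S η h hw φ
    rw [Heisenberg.integral_symSffNorm_eq_zero h hw (by linarith)]
    exact mul_nonneg hC.le (integral_nonneg fun p => Real.rpow_nonneg (norm_nonneg _) _)
  -- The threshold is the zero of 6 - 4k - 2k/3: beyond it, g_{S,k} ≥ 0 together with |h̃|² ≤ 3ℓ² is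
  -- only possible for h̃ = 0.
  by_cases hk97 : k ≤ 9 / 7
  · have hsqrt : √(k / 3) ≤ 2 / 3 := by
      rw [Real.sqrt_le_left (by norm_num)]
      linarith
    -- Here 4/7 ≤ β < 5/3, so 4β - 5 lies between -19/7 and 5/3, and (19/7)² < 12.
    have hd : 0 < 12 - (4 * β - 5) ^ 2 := by nlinarith
    refine ⟨(3 : ℝ) ^ (β + 1) * (32 * (β + 1) ^ 2 / (12 - (4 * β - 5) ^ 2)) ^ (β + 1),
      by positivity, ?_⟩
    intro S η hS hconn hη hnc hst hP1 _ hP3 _ φ hφ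
    have h : Heisenberg.Adapted S η := ⟨⟨hS, hη, hnc⟩, hst.1, hP1⟩
    rcases h.ell_eq_zero_or_ne_zero hconn.isPreconnected with h0 | h0
    · refine trivial_of_nonpos (by positivity) h.toRegular (fun p hp => ?_) φ
      simpa [h0 p hp] using h.symSffSq_le hP3 hp
    · exact h.integral_symSffNorm_le hP3 hst h0 hβ0 hd hφ
  · refine ⟨1, one_pos, ?_⟩
    intro S η hS _ hη hnc hst hP1 _ hP3 hg φ _
    have h : Heisenberg.Adapted S η := ⟨⟨hS, hη, hnc⟩, hst.1, hP1⟩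
    refine trivial_of_nonpos one_pos h.toRegular (fun p hp => ?_) φ
    have h1 := h.symSffSq_le hP3 hp
    have h2 := hg p hp
    rw [Heisenberg.gFun] at h2
    by_contra hpos
    push Not at hk97 hpos
    -- From k|h̃|² ≤ 3kℓ² and g_{S,k} ≥ 0 one gets (6 - 4k - 2k/3)|h̃|² ≥ 0, which contradicts |h̃|²
    -- > 0 for k > 9/7.
    nlinarith [mul_le_mul_of_nonneg_left h1 hk0]
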